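/- Let $M$ be a non-empty $C^\infty$ manifold of dimension $3$ (Hausdorff, second countable, without boundary), and let $\Omega\subset\mathbb{R}^3$ be a non-empty open set. For a triple $X=(X_1,X_2,X_3)$ of $C^\infty$ vector fields on $M$ let $$\Sigma_X=\{x\in M \mid X_1(x),X_2(x),X_3(x)\text{ are linearly dependent}\}$$ be its dependence locus. A control on $I=[a,b]$ ($a<b$) is an essentially bounded measurable map $u:I\to\Omega$. An $X$-trajectory generated by $u$ is an absolutely continuous curve $x:I\to M$ with $\dot x(t)=\sum_{i=1}^3u_i(t)X_i(x(t))$ for almost every $t\in I$. Every $\tilde u$ in a neighbourhood of $u$ in $L^\infty(I;\mathbb{R}^3)$ generates a unique trajectory $\tilde x$ on $I$ with $\tilde x(a)=x(a)$; the map $\tilde u\mapsto\tilde x(b)\in M$ is the endpoint mapping. The control $u$ is singular if the differential of the endpoint mapping at $u$ is not surjective, and an $X$-trajectory is singular if it is generated by a singular control. A curve $x:I\to M$ is non-trivial if it is not constant on any non-degenerate subinterval of $I$. Theorem. There is a non-empty set $\mathcal U$ of triples of $C^\infty$ vector fields on $M$, open in the $C^\infty$ topology (uniform convergence of all derivatives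 on compact sets), such that every $X\in\mathcal U$ has a one-parameter family of non-trivial singular $X$-trajectories embedded in $\Sigma_X$, each of which is generated by an essentially unique singular control. Precisely: for every $X\in\mathcal U$ there are $a<b$ and a map $\Phi:(-1,1)\times[a,b]\to M$ that is $C^\infty$ and injective, such that for every $s\in(-1,1)$ the curve $x_s=\Phi(s,\cdot)$ has nowhere vanishing velocity, is non-trivial, satisfies $x_s([a,b])\subset\Sigma_X$, and is an $X$-trajectory generated by a singular control $u:[a,b]\to\Omega$, where any two singular controls $[a,b]\to\Omega$ generating $x_s$ agree almost everywhere. -/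

import Mathlib

open scoped Manifold ContDiff Topology ENNReal
open MeasureTheory Set

noncomputable section

/-- `ℝ³`, the model space of 3-manifolds and the space of control values `(u₁, u₂, u₃)`. -/
abbrev E3 : Type := EuclideanSpace ℝ (Fin 3)

section VectorFields

variable (M : Type*) [TopologicalSpace M] [ChartedSpace E3 M] [IsManifold (𝓡 3) ∞ M]

/-- `C^∞` vector fields on a 3-manifold: smooth sections of the tangent bundle. -/
abbrev SmoothVectorField : Type _ :=
  ContMDiffSection (𝓡 3) E3 ∞ (fun x : M => TangentSpace (𝓡 3) x)

variable {M}

/-- The coordinate expression of a vector field in the preferred chart `φ` at `p`: the map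
`y ↦ dφ (V (φ⁻¹ y))`. It is meaningful (and smooth) for `y` in the image of the chart. -/
def SmoothVectorField.inChart (V : SmoothVectorField M) (p : M) : E3 → E3 := fun y =>
  mfderiv (𝓡 3) 𝓘(ℝ, E3) (extChartAt (𝓡 3) p) ((extChartAt (𝓡 3) p).symm y)
    (V ((extChartAt (𝓡 3) p).symm y))

/-- The `C^∞` topology: uniform convergence of the partial derivatives of every order of the
coordinate expressions, on the compact subsets of the chart images. -/
instance SmoothVectorField.instTopologicalSpace : TopologicalSpace (SmoothVectorField M) :=
  ⨅ (p : M) (k : ℕ), TopologicalSpace.induced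
    (fun V => UniformOnFun.ofFun {K : Set E3 | IsCompact K ∧ K ⊆ (extChartAt (𝓡 3) p).target}
      (iteratedFDeriv ℝ k (V.inChart p)))
    inferInstance

end VectorFields

/-- The space `L^∞([a, b]; ℝ³)` of essentially bounded measurable maps, up to equality almost
everywhere, with the essential supremum norm. -/
abbrev LInftyControl (a b : ℝ) : Type :=
  Lp E3 ∞ (volume.restrict (Icc a b))

section ControlSystem

variable {M : Type*} [TopologicalSpace M] [ChartedSpace E3 M] [IsManifold (𝓡 3) ∞ M]

/-- The locus where `X₁, X₂, X₃` are linearly dependent. -/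
def dependenceLocus (X : Fin 3 → SmoothVectorField M) : Set M :=
  {x | ¬ LinearIndependent ℝ (fun i => X i x)}

/-- A curve in a manifold is absolutely continuous on `[a, b]` if it is continuous there and
absolutely continuous in charts. -/
def IsAbsContCurve (a b : ℝ) (x : ℝ → M) : Prop :=
  ContinuousOn x (Icc a b) ∧
  ∀ (p : M) (c d : ℝ), a ≤ c → c ≤ d → d ≤ b → x '' Icc c d ⊆ (extChartAt (𝓡 3) p).source →
    AbsolutelyContinuousOnInterval (fun t => extChartAt (𝓡 3) p (x t)) c d

/-- `x` is, on `[a, b]`, a solution of `ẋ = ∑ uᵢ(t) Xᵢ(x)`: it is absolutely continuous and solves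
the equation almost everywhere. -/
def IsTrajectory (X : Fin 3 → SmoothVectorField M) (a b : ℝ) (u : LInftyControl a b)
    (x : ℝ → M) : Prop :=
  IsAbsContCurve a b x ∧
  ∀ᵐ t ∂(volume.restrict (Icc a b)), HasMFDerivAt 𝓘(ℝ, ℝ) (𝓡 3) x t
    ((1 : ℝ →L[ℝ] ℝ).smulRight (∑ i, u t i • X i (x t)))

/-- `F` is the endpoint mapping on the set `C` of controls, for the initial point `x₀` and the time
interval `[a, b]`: every control in `C` has a trajectory on `[a, b]` that starts at `x₀`, and all
such trajectories (there is only one, on `[a, b]`) end at the value of `F`. -/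
def IsEndpointMapOn (X : Fin 3 → SmoothVectorField M) (a b : ℝ) (x₀ : M)
    (C : Set (LInftyControl a b)) (F : LInftyControl a b → M) : Prop :=
  ∀ v ∈ C, (∃ y : ℝ → M, IsTrajectory X a b v y ∧ y a = x₀) ∧
    ∀ y : ℝ → M, IsTrajectory X a b v y → y a = x₀ → F v = y b

/-- `u` is a singular point of the endpoint mapping with initial point `x₀`: the endpoint mapping is
defined on a neighbourhood of `u` in `L^∞`, and its Fréchet derivative at `u` is not surjective. -/
def IsSingularControl (X : Fin 3 → SmoothVectorField M) (a b : ℝ) (x₀ : M)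
    (u : LInftyControl a b) : Prop :=
  ∃ C ∈ 𝓝 u, ∃ F : LInftyControl a b → M, IsEndpointMapOn X a b x₀ C F ∧
    ∃ D : LInftyControl a b →L[ℝ] TangentSpace (𝓡 3) (F u),
      HasMFDerivAt 𝓘(ℝ, LInftyControl a b) (𝓡 3) F u D ∧ ¬ Function.Surjective D

/-- `u` is a control with values in `Ω` that generates the curve `x` on `[a, b]` and is singular. -/
def IsSingularLift (Ω : Set E3) (X : Fin 3 → SmoothVectorField M) (a b : ℝ) (x : ℝ → M)
    (u : LInftyControl a b) : Prop :=
  (∀ᵐ t ∂(volume.restrict (Icc a b)), u t ∈ Ω) ∧ IsTrajectory X a b u x ∧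
    IsSingularControl X a b (x a) u

/-- The curve is not constant on any non-degenerate subinterval of `[a, b]`. -/
def IsNontrivialCurve {M : Type*} (a b : ℝ) (x : ℝ → M) : Prop :=
  ∀ c d : ℝ, a ≤ c → c < d → d ≤ b → ¬ ∃ m : M, ∀ t ∈ Icc c d, x t = m

/-- A smooth one-parameter family, with parameter in `(-1, 1)`, of pairwise disjoint smoothly
embedded arcs `Φ s : [a, b] → M`. -/
def IsEmbeddedArcFamily (a b : ℝ) (Φ : ℝ → ℝ → M) : Prop :=
  ContMDiffOn 𝓘(ℝ, ℝ × ℝ) (𝓡 3) ∞ (fun q : ℝ × ℝ => Φ q.1 q.2) (Ioo (-1) 1 ×ˢ Icc a b) ∧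
  InjOn (fun q : ℝ × ℝ => Φ q.1 q.2) (Ioo (-1) 1 ×ˢ Icc a b) ∧
  ∀ s ∈ Ioo (-1 : ℝ) 1, ∀ t ∈ Icc a b, mfderivWithin 𝓘(ℝ, ℝ) (𝓡 3) (Φ s) (Icc a b) t ≠ 0

end ControlSystem

end

/-!
The singular controls that generate a curve in the dependence locus can be computed. Let `h` be the
covector `X₀ × X₁` and `hᵢⱼ = ⟨h, [Xᵢ, Xⱼ]⟩`. A control `u` is singular along a trajectory `x` exactly
when some nonzero solution of the adjoint equation annihilates `X₀, X₁, X₂` along `x`. In the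
dependence locus, where `X₀` and `X₁` are independent, such a covector is a multiple of `h`, and
differentiating the three relations gives `∑ⱼ uⱼ hⱼᵢ = 0`. Hence `u` is proportional to the kernel
`(h₁₂, h₂₀, h₀₁)` of the skew-symmetric matrix `(hᵢⱼ)`. If the velocity `∑ᵢ uᵢ Xᵢ` is prescribed and
equal to that of the kernel vector, and does not vanish, then `u` is the kernel vector: the singular
feedback control (`jetControl`, `singularControl`).

Conversely the field `F = h₁₂ X₀ + h₂₀ X₁ + h₀₁ X₂` generated by this feedback is tangent to the
dependence locus, since its derivative of the determinant `d` of the three fields is a multiple of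
`d` (`tripleProduct_mul_jetDetDeriv_jetVelocity`). Along its integral curves in `{d = 0}` the derivative
of `h` under the adjoint flow is a multiple of `h` (`tripleProduct_mul_adjoint_defect`), so that `h`
annihilates all variations of the endpoint (`IsSingularArc.not_surjective`), and the feedback is the
only singular control generating the curve (`IsSingularArc.ae_eq_singularControl`). Where
`F ≠ 0` and `∇d ≠ 0`, the flows of `F` and of `∇d × F` parametrize `{d = 0}` by a smooth family of such
arcs (`exists_singularArc_family`).

It remains to find an open set of triples with such points. The conditions `F ≠ 0`, `∇d ≠ 0`, feedback
in `Ω` and independence of `X₀` and `X₁` are open conditions on the 1-jet, and zeros of `d` persist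
when `d` changes sign; so it suffices to write down one triple in a chart with a prescribed feedback
value in `Ω` (`exists_eventually_isNondegenerateJet`).

The analytic part is that trajectories depend smoothly on the control in `L^∞`, with the expected
linearization. It follows from the implicit function theorem for the integral equation in the space
of continuous curves, where the linearized equation is a Volterra equation
(`exists_contDiffOn_trajectory`); smooth flows are a special case (`exists_contDiffOn_flow`). Everything
is carried out on `ℝ³` with compactly supported fields, and transferred to the manifold by a chart
(`exists_isLinearization_isSingularControl_iff`), using that a trajectory on the manifold with the same
initial point and control cannot leave the one found in the chart
(`IsTrajectory.eq_extChartAt_symm`).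
-/

noncomputable section

/-! ### Superposition operators on spaces of continuous functions -/

section Nemytskii

variable {X : Type*} [TopologicalSpace X] [CompactSpace X]

/-- Pointwise application of a continuous family of operators to a continuous function, as a
continuous bilinear map. -/
def pointwiseApply (X : Type*) [TopologicalSpace X] [CompactSpace X]
    (E G : Type*) [NormedAddCommGroup E] [NormedSpace ℝ E] [NormedAddCommGroup G]
    [NormedSpace ℝ G] : C(X, E →L[ℝ] G) →L[ℝ] C(X, E) →L[ℝ] C(X, G) :=
  LinearMap.mkContinuous₂
    (LinearMap.mk₂ ℝ (fun (A : C(X, E →L[ℝ] G)) (h : C(X, E)) =>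
        (⟨fun s => A s (h s), by fun_prop⟩ : C(X, G)))
      (fun _ _ _ => by ext; simp) (fun _ _ _ => by ext; simp)
      (fun _ _ _ => by ext; simp) (fun _ _ _ => by ext; simp)) 1
    (fun A h => by
      rw [one_mul, ContinuousMap.norm_le _ (by positivity)]
      intro s
      exact (A s).le_of_opNorm_le_of_le (A.norm_coe_le_norm s) (h.norm_coe_le_norm s))

@[simp]
lemma pointwiseApply_apply {E G : Type*} [NormedAddCommGroup E] [NormedSpace ℝ E]
    [NormedAddCommGroup G] [NormedSpace ℝ G] (A : C(X, E →L[ℝ] G)) (h : C(X, E)) (s : X) :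
    pointwiseApply X E G A h s = A s (h s) := rfl

/-- Pointwise application is bounded pointwise, not only in the supremum norm; this is what makes
the iterates of Volterra operators small. -/
lemma exists_norm_pointwiseApply_le {E G : Type*} [NormedAddCommGroup E] [NormedSpace ℝ E]
    [NormedAddCommGroup G] [NormedSpace ℝ G] (A : C(X, E →L[ℝ] G)) :
    ∃ L : ℝ, 0 ≤ L ∧ ∀ h s, ‖pointwiseApply X E G A h s‖ ≤ L * ‖h s‖ :=
  ⟨‖A‖, by positivity, fun h s => (A s).le_of_opNorm_le (A.norm_coe_le_norm s) (h s)⟩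

/-- The superposition operator `y ↦ F ∘ y` is differentiable in the supremum norm: its derivative at
`y` is pointwise application of `fderiv ℝ F ∘ y`. -/
lemma hasFDerivAt_superposition {E G : Type*} [NormedAddCommGroup E] [NormedSpace ℝ E]
    [NormedAddCommGroup G] [NormedSpace ℝ G] (F : C(E, G)) (F' : C(E, E →L[ℝ] G))
    (hF : ∀ e, HasFDerivAt F (F' e) e) (y : C(X, E)) :
    HasFDerivAt (fun y : C(X, E) => F.comp y) (pointwiseApply X E G (F'.comp y)) y := by
  rw [hasFDerivAt_iff_isLittleO_nhds_zero, Asymptotics.isLittleO_iff]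
  intro ε hε
  have hc : Continuous fun y : C(X, E) => F'.comp y := ContinuousMap.continuous_postcomp F'
  obtain ⟨δ, hδ, hball⟩ := (Metric.continuous_iff (α := C(X, E)) (β := C(X, E →L[ℝ] G))).mp hc y ε hε
  filter_upwards [Metric.ball_mem_nhds (0 : C(X, E)) hδ] with h hh
  rw [mem_ball_zero_iff] at hh
  rw [ContinuousMap.norm_le _ (by positivity)]
  intro s
  have key := (convex_ball (y s) δ).norm_image_sub_le_of_norm_hasFDerivWithin_le' (f := F)
    (f' := fun e => F' e) (φ := F' (y s)) (C := ε) (x := y s) (y := y s + h s)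
    (fun e _ => (hF e).hasFDerivWithinAt) (fun e he => by
      -- the point `e` is the value at `s` of a uniformly small perturbation of `y`
      have h1 := hball (y + ContinuousMap.const X (e - y s)) (by
        rw [dist_eq_norm, add_sub_cancel_left]
        refine lt_of_le_of_lt ((ContinuousMap.norm_le _ (norm_nonneg (e - y s))).mpr
          fun _ => le_rfl) ?_
        rwa [mem_ball_iff_norm] at he)
      have h2 := (ContinuousMap.dist_apply_le_dist s).trans h1.le
      simpa [dist_eq_norm] using h2)
    (Metric.mem_ball_self hδ) (by
      rw [mem_ball_iff_norm, add_sub_cancel_left]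
      exact (h.norm_coe_le_norm s).trans_lt hh)
  rw [add_sub_cancel_left] at key
  refine le_trans ?_ (key.trans (by gcongr; exact h.norm_coe_le_norm s))
  simp

universe u in
lemma contDiff_nat_superposition {X : Type*} [TopologicalSpace X] [CompactSpace X] (n : ℕ) :
    ∀ {E G : Type u} [NormedAddCommGroup E] [NormedSpace ℝ E]
      [NormedAddCommGroup G] [NormedSpace ℝ G] (F : C(E, G)), ContDiff ℝ n F →
      ContDiff ℝ n (fun y : C(X, E) => F.comp y) := by
  induction n with
  | zero =>
    intro E G _ _ _ _ F _
    exact contDiff_zero.mpr (ContinuousMap.continuous_postcomp F)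
  | succ n ih =>
    intro E G _ _ _ _ F hF
    have h := (contDiff_succ_iff_fderiv (n := (n : WithTop ℕ∞))).mp (by exact_mod_cast hF)
    let F' : C(E, E →L[ℝ] G) := ⟨fderiv ℝ F, h.2.2.continuous⟩
    have hd := fun y : C(X, E) => hasFDerivAt_superposition F F' (fun e => (h.1 e).hasFDerivAt) y
    have hn : ((n + 1 : ℕ) : WithTop ℕ∞) = (n : WithTop ℕ∞) + 1 := by norm_cast
    rw [hn, contDiff_succ_iff_fderiv]
    refine ⟨fun y => (hd y).differentiableAt, fun h => absurd h (by simp), ?_⟩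
    rw [funext fun y => (hd y).fderiv]
    exact (pointwiseApply X E G).contDiff.comp (ih F' h.2.2)

universe u in
lemma contDiff_superposition {E G : Type u} [NormedAddCommGroup E] [NormedSpace ℝ E]
    [NormedAddCommGroup G] [NormedSpace ℝ G] (F : C(E, G)) (hF : ContDiff ℝ ∞ F) :
    ContDiff ℝ ∞ (fun y : C(X, E) => F.comp y) :=
  contDiff_infty.mpr fun n => contDiff_nat_superposition n F (contDiff_infty.mp hF n)

end Nemytskii

/-! ### Integration against a control and Volterra operators -/

section Volterra

variable {a b : ℝ} {U G : Type*} [NormedAddCommGroup U] [NormedSpace ℝ U]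
  [NormedAddCommGroup G] [NormedSpace ℝ G]

/-- The integrand `s ↦ B(s) v(s)`, for a control `v ∈ L^∞([a, b]; U)` and a continuous family of
operators `B` on `[a, b]`, extended by its end values outside `[a, b]`. -/
def controlIntegrand (hab : a ≤ b) (v : Lp U ∞ (volume.restrict (Icc a b)))
    (B : C(Icc a b, U →L[ℝ] G)) (s : ℝ) : G :=
  B (projIcc a b hab s) (v s)

lemma ae_norm_le_norm_Lp {U : Type*} [NormedAddCommGroup U]
    (v : Lp U ∞ (volume.restrict (Icc a b))) :
    ∀ᵐ s ∂(volume.restrict (Icc a b)), ‖v s‖ ≤ ‖v‖ := by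
  have h := ae_le_eLpNormEssSup (f := v) (μ := volume.restrict (Icc a b))
  filter_upwards [h] with s hs
  rw [Lp.norm_def, eLpNorm_exponent_top, ← toReal_enorm]
  refine ENNReal.toReal_mono ?_ hs
  have := Lp.eLpNorm_ne_top v
  rwa [eLpNorm_exponent_top] at this

lemma integrableOn_controlIntegrand (hab : a ≤ b) (v : Lp U ∞ (volume.restrict (Icc a b)))
    (B : C(Icc a b, U →L[ℝ] G)) : IntegrableOn (controlIntegrand hab v B) (Icc a b) := by
  have hB : Continuous fun s : ℝ => B (projIcc a b hab s) := B.continuous.comp continuous_projIcc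
  refine Integrable.of_bound (C := ‖B‖ * ‖v‖) ?_ ?_
  · exact (ContinuousLinearMap.id ℝ (U →L[ℝ] G)).aestronglyMeasurable_comp₂
      hB.aestronglyMeasurable (Lp.aestronglyMeasurable v)
  · filter_upwards [ae_norm_le_norm_Lp v] with s hs
    exact (B _).le_of_opNorm_le_of_le (B.norm_coe_le_norm _) hs

lemma intervalIntegrable_controlIntegrand (hab : a ≤ b)
    (v : Lp U ∞ (volume.restrict (Icc a b))) (B : C(Icc a b, U →L[ℝ] G)) {c d : ℝ}
    (hc : c ∈ Icc a b) (hd : d ∈ Icc a b) :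
    IntervalIntegrable (controlIntegrand hab v B) volume c d :=
  ((integrableOn_controlIntegrand hab v B).mono_set (uIcc_subset_Icc hc hd)).intervalIntegrable

lemma ae_uIoc_of_ae_Icc {p : ℝ → Prop} (h : ∀ᵐ s ∂(volume.restrict (Icc a b)), p s) {c d : ℝ}
    (hc : c ∈ Icc a b) (hd : d ∈ Icc a b) : ∀ᵐ s, s ∈ uIoc c d → p s := by
  rw [ae_restrict_iff' measurableSet_Icc] at h
  filter_upwards [h] with s hs hs'
  exact hs (uIcc_subset_Icc hc hd (uIoc_subset_uIcc hs'))

/-- The primitive `t ↦ ∫ s in t₀..t, B(s) v(s)` as a continuous function on `[a, b]`. -/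
def controlPrimitive (hab : a ≤ b) (t₀ : Icc a b) (v : Lp U ∞ (volume.restrict (Icc a b)))
    (B : C(Icc a b, U →L[ℝ] G)) : C(Icc a b, G) where
  toFun t := ∫ s in (t₀ : ℝ)..t, controlIntegrand hab v B s
  continuous_toFun := by
    have := intervalIntegral.continuousOn_primitive_interval'
      (intervalIntegrable_controlIntegrand hab v B (left_mem_Icc.mpr hab)
        (right_mem_Icc.mpr hab)) (a := t₀) (by rw [uIcc_of_le hab]; exact t₀.2)
    rw [uIcc_of_le hab] at this
    exact this.comp_continuous continuous_subtype_val fun t => t.2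

lemma controlPrimitive_apply (hab : a ≤ b) (t₀ : Icc a b) (v : Lp U ∞ (volume.restrict (Icc a b)))
    (B : C(Icc a b, U →L[ℝ] G)) (t : Icc a b) :
    controlPrimitive hab t₀ v B t = ∫ s in (t₀ : ℝ)..t, controlIntegrand hab v B s := rfl

/-- Integration from `t₀` against a control: the continuous bilinear map sending `v` and `B` to the
continuous function `t ↦ ∫ s in t₀..t, B(s) v(s)` on `[a, b]`. -/
def controlIntegral (hab : a ≤ b) (t₀ : Icc a b) :
    Lp U ∞ (volume.restrict (Icc a b)) →L[ℝ] C(Icc a b, U →L[ℝ] G) →L[ℝ] C(Icc a b, G) :=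
  LinearMap.mkContinuous₂
    (LinearMap.mk₂ ℝ (controlPrimitive (U := U) (G := G) hab t₀)
      (fun v w B => by
        ext t
        simp only [controlPrimitive_apply, ContinuousMap.add_apply]
        rw [← intervalIntegral.integral_add
          (intervalIntegrable_controlIntegrand hab v B t₀.2 t.2)
          (intervalIntegrable_controlIntegrand hab w B t₀.2 t.2)]
        refine intervalIntegral.integral_congr_ae
          (ae_uIoc_of_ae_Icc ?_ t₀.2 t.2)
        filter_upwards [Lp.coeFn_add v w] with s hs
        simp only [controlIntegrand, hs, Pi.add_apply, map_add])
      (fun c v B => by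
        ext t
        simp only [controlPrimitive_apply, ContinuousMap.smul_apply]
        rw [← intervalIntegral.integral_smul]
        refine intervalIntegral.integral_congr_ae
          (ae_uIoc_of_ae_Icc ?_ t₀.2 t.2)
        filter_upwards [Lp.coeFn_smul c v] with s hs
        simp only [controlIntegrand, hs, Pi.smul_apply, map_smul])
      (fun v B B' => by
        ext t
        simp only [controlPrimitive_apply, ContinuousMap.add_apply]
        rw [← intervalIntegral.integral_add
          (intervalIntegrable_controlIntegrand hab v B t₀.2 t.2)
          (intervalIntegrable_controlIntegrand hab v B' t₀.2 t.2)]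
        simp [controlIntegrand])
      (fun c v B => by
        ext t
        simp only [controlPrimitive_apply, ContinuousMap.smul_apply]
        rw [← intervalIntegral.integral_smul]
        simp [controlIntegrand])) (b - a)
    (fun v B => by
      have hab' : 0 ≤ b - a := sub_nonneg.mpr hab
      rw [ContinuousMap.norm_le _ (by positivity)]
      intro t
      have h := intervalIntegral.norm_integral_le_of_norm_le_const_ae (a := (t₀ : ℝ)) (b := t)
        (f := controlIntegrand hab v B) (C := ‖B‖ * ‖v‖)
        (ae_uIoc_of_ae_Icc (by
          filter_upwards [ae_norm_le_norm_Lp v] with s hs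
          exact (B _).le_of_opNorm_le_of_le (B.norm_coe_le_norm _) hs) t₀.2 t.2)
      refine h.trans ?_
      have h2 : |(t : ℝ) - t₀| ≤ b - a := abs_sub_le_of_le_of_le t.2.1 t.2.2 t₀.2.1 t₀.2.2
      calc ‖B‖ * ‖v‖ * |(t : ℝ) - t₀| ≤ ‖B‖ * ‖v‖ * (b - a) := by gcongr
        _ = _ := by ring)

lemma controlIntegral_apply (hab : a ≤ b) (t₀ : Icc a b) (v : Lp U ∞ (volume.restrict (Icc a b)))
    (B : C(Icc a b, U →L[ℝ] G)) (t : Icc a b) :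
    controlIntegral hab t₀ v B t = ∫ s in (t₀ : ℝ)..t, controlIntegrand hab v B s := rfl

/-- Iterates of a Volterra operator have factorially small norm. -/
lemma norm_volterra_pow_apply_le (hab : a ≤ b) (t₀ : Icc a b)
    (v : Lp U ∞ (volume.restrict (Icc a b))) (T : C(Icc a b, G) →L[ℝ] C(Icc a b, U →L[ℝ] G))
    {L : ℝ} (hL : 0 ≤ L) (hT : ∀ h s, ‖T h s‖ ≤ L * ‖h s‖) (n : ℕ) (h : C(Icc a b, G))
    (t : Icc a b) :
    ‖(((controlIntegral hab t₀ v).comp T) ^ n) h t‖ ≤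
      (L * ‖v‖ * |(t : ℝ) - t₀|) ^ n / n.factorial * ‖h‖ := by
  induction n generalizing t with
  | zero => simpa using h.norm_coe_le_norm t
  | succ n ih =>
    rw [pow_succ', mul_apply_eq_comp, ContinuousLinearMap.comp_apply,
      controlIntegral_apply]
    set g := (((controlIntegral hab t₀ v).comp T) ^ n) h
    have hb : ∀ᵐ s, s ∈ uIoc (t₀ : ℝ) t → ‖controlIntegrand hab v (T g) s‖ ≤
        (L * ‖v‖) ^ (n + 1) / n.factorial * ‖h‖ * |s - t₀| ^ n := by
      have := ae_uIoc_of_ae_Icc (ae_norm_le_norm_Lp v) t₀.2 t.2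
      filter_upwards [this] with s hs hs'
      have hsI : s ∈ Icc a b := uIcc_subset_Icc t₀.2 t.2 (uIoc_subset_uIcc hs')
      have h1 := ih ⟨s, hsI⟩
      rw [controlIntegrand, projIcc_of_mem hab hsI]
      calc ‖(T g ⟨s, hsI⟩) (v s)‖ ≤ (L * ‖g ⟨s, hsI⟩‖) * ‖v‖ :=
            (T g _).le_of_opNorm_le_of_le (hT g _) (hs hs')
        _ ≤ (L * ((L * ‖v‖ * |s - t₀|) ^ n / n.factorial * ‖h‖)) * ‖v‖ := by gcongr
        _ = _ := by rw [mul_pow, pow_succ]; ring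
    have h2 := intervalIntegral.norm_integral_le_abs_of_norm_le
      (μ := volume) (a := (t₀ : ℝ)) (b := t) (f := controlIntegrand hab v (T g))
      (g := fun s => (L * ‖v‖) ^ (n + 1) / n.factorial * ‖h‖ * |s - t₀| ^ n)
      ((ae_restrict_iff' measurableSet_uIoc).mpr hb)
      (Continuous.intervalIntegrable (by fun_prop) _ _)
    refine h2.trans (le_of_eq ?_)
    rw [intervalIntegral.integral_const_mul, abs_mul, intervalIntegral.abs_intervalIntegral_eq,
      integral_pow_abs_sub_uIoc, abs_of_nonneg (by positivity), abs_of_nonneg (by positivity),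
      Nat.factorial_succ, mul_pow _ |(t : ℝ) - t₀|]
    push_cast
    field_simp

/-- `1 - K` is invertible for a Volterra operator `K` with `L^∞` coefficients. -/
lemma isUnit_one_sub_volterra [CompleteSpace G] (hab : a ≤ b) (t₀ : Icc a b)
    (v : Lp U ∞ (volume.restrict (Icc a b))) (T : C(Icc a b, G) →L[ℝ] C(Icc a b, U →L[ℝ] G))
    {L : ℝ} (hL : 0 ≤ L) (hT : ∀ h s, ‖T h s‖ ≤ L * ‖h s‖) :
    IsUnit (1 - (controlIntegral hab t₀ v).comp T) := by
  set K := (controlIntegral hab t₀ v).comp T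
  have hab' : 0 ≤ b - a := sub_nonneg.mpr hab
  have hlim := FloorSemiring.tendsto_pow_div_factorial_atTop (L * ‖v‖ * (b - a))
  obtain ⟨n, hn⟩ := (hlim.eventually (gt_mem_nhds one_pos)).exists
  have hK : ‖K ^ n‖ < 1 := by
    refine lt_of_le_of_lt (ContinuousLinearMap.opNorm_le_bound _ (by positivity) fun h => ?_) hn
    rw [ContinuousMap.norm_le _ (by positivity)]
    intro t
    refine (norm_volterra_pow_apply_le hab t₀ v T hL hT n h t).trans ?_
    have h2 : |(t : ℝ) - t₀| ≤ b - a := abs_sub_le_of_le_of_le t.2.1 t.2.2 t₀.2.1 t₀.2.2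
    gcongr
  -- `1 - K` divides the invertible operator `1 - K ^ n`
  have h1 : IsUnit (1 - K ^ n) :=
    isUnit_one_sub_of_norm_lt_one (R := C(Icc a b, G) →L[ℝ] C(Icc a b, G)) hK
  rw [← mul_neg_geom_sum K n] at h1
  refine ((Commute.isUnit_mul_iff ?_).mp h1).1
  rw [Commute, SemiconjBy, mul_neg_geom_sum, geom_sum_mul_neg]

end Volterra

/-! ### Smooth dependence of trajectories on the control -/

section EndpointMap

universe u
variable {a b : ℝ} {U E : Type u} [NormedAddCommGroup U] [NormedSpace ℝ U]
  [NormedAddCommGroup E] [NormedSpace ℝ E]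

/-- The defect of `y` in the integral equation `y(t) = z + ∫ s in t₀..t, V(y(s)) v(s)`, as a function
of the data `(z, v)` and of the curve `y`. -/
def trajectoryDefect (hab : a ≤ b) (t₀ : Icc a b) (V : C(E, U →L[ℝ] E))
    (q : (E × Lp U ∞ (volume.restrict (Icc a b))) × C(Icc a b, E)) : C(Icc a b, E) :=
  q.2 - ContinuousLinearMap.const ℝ (Icc a b) q.1.1 - controlIntegral hab t₀ q.1.2 (V.comp q.2)

/-- `y` solves `ẏ = V(y) v`, `y(t₀) = z` on `[a, b]` in integral form. -/
def IsIntegralTrajectory (hab : a ≤ b) (t₀ : Icc a b) (V : C(E, U →L[ℝ] E)) (z : E)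
    (v : Lp U ∞ (volume.restrict (Icc a b))) (y : C(Icc a b, E)) : Prop :=
  ∀ t, y t = z + ∫ s in (t₀ : ℝ)..t, controlIntegrand hab v (V.comp y) s

lemma trajectoryDefect_eq_zero_iff (hab : a ≤ b) (t₀ : Icc a b) (V : C(E, U →L[ℝ] E)) (z : E)
    (v : Lp U ∞ (volume.restrict (Icc a b))) (y : C(Icc a b, E)) :
    trajectoryDefect hab t₀ V ((z, v), y) = 0 ↔ IsIntegralTrajectory hab t₀ V z v y := by
  rw [trajectoryDefect, ContinuousMap.ext_iff]
  refine forall_congr' fun t => ?_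
  rw [ContinuousMap.sub_apply, ContinuousMap.sub_apply, controlIntegral_apply, sub_sub,
    ContinuousMap.zero_apply, sub_eq_zero]
  rfl

lemma contDiff_trajectoryDefect (hab : a ≤ b) (t₀ : Icc a b) (V : C(E, U →L[ℝ] E))
    (hV : ContDiff ℝ ∞ V) : ContDiff ℝ ∞ (trajectoryDefect hab t₀ V) := by
  have h1 := contDiff_superposition (X := Icc a b) V hV
  have h2 : ContDiff ℝ ∞ fun q : (E × Lp U ∞ (volume.restrict (Icc a b))) × C(Icc a b, E) =>
      controlIntegral (G := E) hab t₀ q.1.2 (V.comp q.2) :=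
    ((controlIntegral hab t₀).contDiff.comp (contDiff_snd.comp contDiff_fst)).clm_apply
      (h1.comp contDiff_snd)
  exact (contDiff_snd.sub ((ContinuousLinearMap.const (M := E) ℝ (Icc a b)).contDiff.comp
    (contDiff_fst.comp contDiff_fst))).sub h2

/-- The coefficient `h ↦ (s ↦ DV(y(s)) h(s))` of the linearization of `ẏ = V(y) v` along `y`. -/
def linearizedDynamics (V' : C(E, E →L[ℝ] U →L[ℝ] E)) (y : C(Icc a b, E)) :
    C(Icc a b, E) →L[ℝ] C(Icc a b, U →L[ℝ] E) :=
  pointwiseApply (Icc a b) E (U →L[ℝ] E) (V'.comp y)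

lemma hasFDerivAt_trajectoryDefect (hab : a ≤ b) (t₀ : Icc a b) (V : C(E, U →L[ℝ] E))
    (V' : C(E, E →L[ℝ] U →L[ℝ] E)) (hV : ∀ e, HasFDerivAt V (V' e) e)
    (q : (E × Lp U ∞ (volume.restrict (Icc a b))) × C(Icc a b, E)) :
    ∃ D : ((E × Lp U ∞ (volume.restrict (Icc a b))) × C(Icc a b, E)) →L[ℝ] C(Icc a b, E),
      HasFDerivAt (trajectoryDefect hab t₀ V) D q ∧ ∀ dz dv dy,
      D ((dz, dv), dy) = dy - ContinuousLinearMap.const (M := E) ℝ (Icc a b) dz -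
        (controlIntegral hab t₀ dv (V.comp q.2) +
          controlIntegral hab t₀ q.1.2 (linearizedDynamics V' q.2 dy)) := by
  have h1 : HasFDerivAt
      (fun q : (E × Lp U ∞ (volume.restrict (Icc a b))) × C(Icc a b, E) => V.comp q.2) _ q :=
    (hasFDerivAt_superposition (X := Icc a b) V V' hV q.2).comp q hasFDerivAt_snd
  let A : ((E × Lp U ∞ (volume.restrict (Icc a b))) × C(Icc a b, E)) →L[ℝ] E :=
    (ContinuousLinearMap.fst ℝ _ _).comp (ContinuousLinearMap.fst ℝ _ _)
  let B : ((E × Lp U ∞ (volume.restrict (Icc a b))) × C(Icc a b, E)) →L[ℝ]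
      Lp U ∞ (volume.restrict (Icc a b)) :=
    (ContinuousLinearMap.snd ℝ _ _).comp (ContinuousLinearMap.fst ℝ _ _)
  have h2 := (controlIntegral (G := E) (U := U) hab t₀).hasFDerivAt_of_bilinear
    (B.hasFDerivAt (x := q)) h1
  have h3 := ((ContinuousLinearMap.const (M := E) ℝ (Icc a b)).comp A).hasFDerivAt (x := q)
  refine ⟨_, ((hasFDerivAt_snd (𝕜 := ℝ) (p := q)).sub h3).sub h2, fun dz dv dy => ?_⟩
  rw [add_comm (controlIntegral hab t₀ dv (V.comp q.2))]
  rfl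

/-- Inhomogeneous linear integral equations with `L^∞` coefficients have solutions; in operator
form, `1 - K` is invertible for the linearized dynamics. -/
lemma isUnit_one_sub_linearizedDynamics [CompleteSpace E] (hab : a ≤ b) (t₀ : Icc a b)
    (V' : C(E, E →L[ℝ] U →L[ℝ] E)) (y : C(Icc a b, E))
    (v : Lp U ∞ (volume.restrict (Icc a b))) :
    IsUnit (1 - (controlIntegral hab t₀ v).comp (linearizedDynamics V' y)) := by
  obtain ⟨L, hL, h⟩ := exists_norm_pointwiseApply_le (V'.comp y)
  exact isUnit_one_sub_volterra hab t₀ v _ hL h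

/-- **Smooth dependence of trajectories on the initial point and on the control.** Near the data of
a given trajectory, `ẏ = V(y) v`, `y(t₀) = z` has a solution depending smoothly on `(z, v)`. -/
theorem exists_contDiffOn_trajectory [CompleteSpace U] [CompleteSpace E] (hab : a ≤ b) (t₀ : Icc a b)
    (V : C(E, U →L[ℝ] E)) (hV : ContDiff ℝ ∞ V) {x₀ : E}
    {u : Lp U ∞ (volume.restrict (Icc a b))} {x : C(Icc a b, E)}
    (hx : IsIntegralTrajectory hab t₀ V x₀ u x) :
    ∃ (N : Set (E × Lp U ∞ (volume.restrict (Icc a b))))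
      (Y : E × Lp U ∞ (volume.restrict (Icc a b)) → C(Icc a b, E)),
      IsOpen N ∧ (x₀, u) ∈ N ∧ ContDiffOn ℝ ∞ Y N ∧ Y (x₀, u) = x ∧
        ∀ q ∈ N, IsIntegralTrajectory hab t₀ V q.1 q.2 (Y q) := by
  have hcd := contDiff_trajectoryDefect hab t₀ V hV
  let V' : C(E, E →L[ℝ] U →L[ℝ] E) := ⟨fderiv ℝ V, hV.continuous_fderiv (by simp)⟩
  have hV' : ∀ e, HasFDerivAt V (V' e) e := fun e =>
    (hV.differentiable (by simp) e).hasFDerivAt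
  have hinv : ∀ q, (fderiv ℝ (trajectoryDefect hab t₀ V) q ∘L .inr ℝ _ _).IsInvertible := by
    intro q
    obtain ⟨D, hD, hD'⟩ := hasFDerivAt_trajectoryDefect hab t₀ V V' hV' q
    obtain ⟨e, he⟩ := isUnit_one_sub_linearizedDynamics hab t₀ V' q.2 q.1.2
    refine ⟨ContinuousLinearEquiv.unitsEquiv ℝ _ e, ?_⟩
    rw [hD.fderiv]
    ext1 dy
    have h2 := hD' 0 0 dy
    rw [map_zero, map_zero, sub_zero, zero_apply, zero_add] at h2
    rw [ContinuousLinearMap.comp_apply, ContinuousLinearMap.inr_apply]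
    refine Eq.trans ?_ h2.symm
    show (e : C(Icc a b, E) →L[ℝ] C(Icc a b, E)) dy = _
    rw [he]
    rfl
  have h0 := (trajectoryDefect_eq_zero_iff hab t₀ V x₀ u x).mpr hx
  have hne : (∞ : WithTop ℕ∞) ≠ 0 := by simp
  have hat := fun q => hcd.contDiffAt (x := q)
  let Y := (hat ((x₀, u), x)).implicitFunction hne (hinv _)
  have hYsm : ContDiffAt ℝ ∞ Y (x₀, u) := (hat _).contDiffAt_implicitFunction hne (hinv _)
  have hYx : Y (x₀, u) = x := (hat ((x₀, u), x)).implicitFunction_apply_self hne (hinv _)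
  have hYeq := (hat ((x₀, u), x)).eventually_apply_implicitFunction hne (hinv _)
  rw [h0] at hYeq
  have hYc : ∀ᶠ q in 𝓝 (x₀, u), ContinuousAt Y q := by
    have h1 : ContDiffAt ℝ 1 Y (x₀, u) := hYsm.of_le (by simp)
    exact (h1.eventually (by simp)).mono fun q hq => hq.continuousAt
  obtain ⟨N, hN, hNo, hmem⟩ := eventually_nhds_iff.mp (hYeq.and hYc)
  refine ⟨N, Y, hNo, hmem, fun q hq => ContDiffAt.contDiffWithinAt ?_, hYx, fun q hq =>
    (trajectoryDefect_eq_zero_iff hab t₀ V q.1 q.2 (Y q)).mp (hN q hq).1⟩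
  -- the implicit function based at another point of the graph coincides with `Y` near that point
  have h3 := (hat (q, Y q)).eventually_apply_eq_iff_implicitFunction hne (hinv _)
  have h4 : Filter.Tendsto (fun r => (r, Y r)) (𝓝 q) (𝓝 (q, Y q)) :=
    Filter.Tendsto.prodMk_nhds Filter.tendsto_id (hN q hq).2
  refine ((hat (q, Y q)).contDiffAt_implicitFunction hne (hinv _)).congr_of_eventuallyEq ?_
  filter_upwards [h4.eventually h3, hNo.mem_nhds hq] with r hr hrN
  exact (hr.mp ((hN r hrN).1.trans (hN q hq).1.symm)).symm

/-- The derivative of a family of trajectories in the control solves the linearized equation. -/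
lemma linearized_of_hasFDerivAt (hab : a ≤ b) (t₀ : Icc a b) (V : C(E, U →L[ℝ] E))
    (V' : C(E, E →L[ℝ] U →L[ℝ] E)) (hV : ∀ e, HasFDerivAt V (V' e) e) {x₀ : E}
    {u : Lp U ∞ (volume.restrict (Icc a b))} {Y : Lp U ∞ (volume.restrict (Icc a b)) → C(Icc a b, E)}
    {Y' : Lp U ∞ (volume.restrict (Icc a b)) →L[ℝ] C(Icc a b, E)} (hY : HasFDerivAt Y Y' u)
    (hsol : ∀ᶠ v in 𝓝 u, IsIntegralTrajectory hab t₀ V x₀ v (Y v))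
    (dv : Lp U ∞ (volume.restrict (Icc a b))) :
    Y' dv = controlIntegral hab t₀ dv (V.comp (Y u)) +
      controlIntegral hab t₀ u (linearizedDynamics V' (Y u) (Y' dv)) := by
  obtain ⟨D, hD, hD'⟩ := hasFDerivAt_trajectoryDefect hab t₀ V V' hV ((x₀, u), Y u)
  have h1 : HasFDerivAt (fun v => trajectoryDefect hab t₀ V ((x₀, v), Y v)) _ u :=
    HasFDerivAt.comp (g := trajectoryDefect hab t₀ V) (f := fun v => ((x₀, v), Y v)) u hD
      (((hasFDerivAt_const x₀ u).prodMk (hasFDerivAt_id u)).prodMk hY)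
  have h2 : (fun v => trajectoryDefect hab t₀ V ((x₀, v), Y v)) =ᶠ[𝓝 u] fun _ => 0 :=
    hsol.mono fun v hv => (trajectoryDefect_eq_zero_iff hab t₀ V x₀ v (Y v)).mpr hv
  have h3 := (h1.congr_of_eventuallyEq h2.symm).unique (hasFDerivAt_const 0 u)
  have h4 := congrArg (fun A => A dv) h3
  have h5 : D ((0, dv), Y' dv) = 0 := h4
  rw [hD', map_zero, sub_zero, sub_eq_zero] at h5
  exact h5

end EndpointMap

/-! ### Uniqueness of trajectories -/

section Uniqueness

variable {U E : Type*} [NormedAddCommGroup U] [NormedSpace ℝ U]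
  [NormedAddCommGroup E] {c d : ℝ}

/-- Integral form of Grönwall's inequality, homogeneous case. -/
lemma eq_zero_of_norm_le_integral_norm (hcd : c ≤ d) {w : ℝ → E} (hw : ContinuousOn w (Icc c d))
    {L : ℝ} (h : ∀ t ∈ Icc c d, ‖w t‖ ≤ L * ∫ s in c..t, ‖w s‖) :
    ∀ t ∈ Icc c d, w t = 0 := by
  let W : ℝ → ℝ := IccExtend hcd ((Icc c d).domRestrict fun s => ‖w s‖)
  have hWc : Continuous W :=
    (continuousOn_iff_continuous_domRestrict.mp hw.norm).Icc_extend'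
  have hWw : ∀ s ∈ Icc c d, W s = ‖w s‖ := fun s hs => by
    simp only [W, IccExtend_of_mem hcd _ hs, domRestrict_apply]
  have hint : ∀ t ∈ Icc c d, ∫ s in c..t, ‖w s‖ = ∫ s in c..t, W s := fun t ht =>
    intervalIntegral.integral_congr fun s hs =>
      (hWw s (uIcc_subset_Icc (left_mem_Icc.mpr hcd) ht hs)).symm
  have hW0 : ∀ s, 0 ≤ W s := fun s => by
    simp only [W, IccExtend, Function.comp_apply, domRestrict_apply]; positivity
  have key := eq_zero_of_abs_deriv_le_mul_abs_self_of_eq_zero_right (a := c) (b := d)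
    (f := fun t => ∫ s in c..t, W s) (f' := W) (K := L)
    (intervalIntegral.continuous_primitive (fun _ _ => hWc.intervalIntegrable _ _) c).continuousOn
    (fun t _ => (hWc.integral_hasStrictDerivAt c t).hasDerivAt.hasDerivWithinAt)
    (by simp)
    (fun t ht => by
      have ht' := Ico_subset_Icc_self ht
      have h1 := h t ht'
      rw [hint t ht', ← hWw t ht'] at h1
      rw [Real.norm_of_nonneg (hW0 t), Real.norm_of_nonneg
        (intervalIntegral.integral_nonneg ht.1 fun s _ => hW0 s)]
      exact h1)
  intro t ht
  have h1 := h t ht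
  rw [hint t ht, key t ht, mul_zero] at h1
  exact norm_le_zero_iff.mp h1

/-- Trajectories of a Lipschitz control system are determined by their initial point and by the
(essentially bounded) control. -/
lemma eqOn_of_integral_equation [NormedSpace ℝ E] (hcd : c ≤ d) {V : E → U →L[ℝ] E} {K : NNReal}
    (hV : LipschitzWith K V) {v : ℝ → U} {m : ℝ}
    (hvm : AEStronglyMeasurable v (volume.restrict (Icc c d)))
    (hvb : ∀ᵐ s ∂(volume.restrict (Icc c d)), ‖v s‖ ≤ m) {y₁ y₂ : ℝ → E}
    (hc₁ : ContinuousOn y₁ (Icc c d)) (hc₂ : ContinuousOn y₂ (Icc c d))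
    (h₁ : ∀ t ∈ Icc c d, y₁ t = y₁ c + ∫ s in c..t, V (y₁ s) (v s))
    (h₂ : ∀ t ∈ Icc c d, y₂ t = y₂ c + ∫ s in c..t, V (y₂ s) (v s))
    (h₀ : y₁ c = y₂ c) : EqOn y₁ y₂ (Icc c d) := by
  have hint : ∀ y : ℝ → E, ContinuousOn y (Icc c d) → ∀ t ∈ Icc c d,
      IntervalIntegrable (fun s => V (y s) (v s)) volume c t := by
    intro y hy t ht
    have hVy : ContinuousOn (fun s => V (y s)) (Icc c d) := hV.continuous.comp_continuousOn hy
    obtain ⟨C, hC⟩ := isCompact_Icc.exists_bound_of_continuousOn hVy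
    have : IntegrableOn (fun s => V (y s) (v s)) (Icc c d) := by
      refine Integrable.of_bound (C := C * m) ?_ ?_
      · exact (ContinuousLinearMap.id ℝ (U →L[ℝ] E)).aestronglyMeasurable_comp₂
          (hVy.aestronglyMeasurable measurableSet_Icc) hvm
      · filter_upwards [hvb, ae_restrict_mem measurableSet_Icc] with s hs hs'
        exact (V (y s)).le_of_opNorm_le_of_le (hC s hs') hs
    exact (this.mono_set (uIcc_subset_Icc (left_mem_Icc.mpr hcd) ht)).intervalIntegrable
  have hw : ContinuousOn (fun t => y₁ t - y₂ t) (Icc c d) := hc₁.sub hc₂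
  have key := eq_zero_of_norm_le_integral_norm hcd hw (L := K * m) (fun t ht => by
    have h3 : y₁ t - y₂ t = ∫ s in c..t, (V (y₁ s) (v s) - V (y₂ s) (v s)) := by
      rw [intervalIntegral.integral_sub (hint y₁ hc₁ t ht) (hint y₂ hc₂ t ht), h₁ t ht, h₂ t ht, h₀]
      abel
    rw [h3, ← intervalIntegral.integral_const_mul]
    refine intervalIntegral.norm_integral_le_of_norm_le ht.1 ?_
      ((ContinuousOn.intervalIntegrable (by
        rw [uIcc_of_le ht.1]
        exact hw.norm.mono (Icc_subset_Icc_right ht.2))).const_mul _)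
    filter_upwards [(ae_restrict_iff' measurableSet_Icc).mp hvb] with s hs hs'
    have hsI : s ∈ Icc c d := ⟨hs'.1.le, hs'.2.trans ht.2⟩
    calc ‖V (y₁ s) (v s) - V (y₂ s) (v s)‖ = ‖(V (y₁ s) - V (y₂ s)) (v s)‖ := by
          rw [sub_apply]
      _ ≤ (K * ‖y₁ s - y₂ s‖) * m :=
          (V (y₁ s) - V (y₂ s)).le_of_opNorm_le_of_le (hV.norm_sub_le _ _) (hs hsI)
      _ = K * m * ‖y₁ s - y₂ s‖ := by ring)
  exact fun t ht => sub_eq_zero.mp (key t ht)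

end Uniqueness

/-! ### Smooth flows -/

section Flow

variable {E : Type} [NormedAddCommGroup E] [NormedSpace ℝ E] [CompleteSpace E]

/-- **Smooth local flow.** The flow of a smooth Lipschitz vector field is jointly smooth in time and
in the initial point. The time `t` enters through the control of the system `y' = v F(y)` on
`[0, 1]`: the constant control `v = t` reaches at time `1` the value of the flow at time `t`. -/
theorem exists_contDiffOn_flow {F : E → E} (hF : ContDiff ℝ ∞ F) {K : NNReal}
    (hK : LipschitzWith K F) (x₀ : E) :
    ∃ ε > 0, ∃ θ : E × ℝ → E, ContDiffOn ℝ ∞ θ (Metric.ball x₀ ε ×ˢ Metric.ball 0 ε) ∧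
      (∀ z ∈ Metric.ball x₀ ε, θ (z, 0) = z) ∧
      ∀ z ∈ Metric.ball x₀ ε, ∀ t ∈ Metric.ball (0 : ℝ) ε,
        HasDerivAt (fun s => θ (z, s)) (F (θ (z, t))) t := by
  let T : E →L[ℝ] (ℝ →L[ℝ] E) := (ContinuousLinearMap.smulRightL ℝ ℝ E) 1
  have hT : ∀ e (r : ℝ), T e r = r • e := fun e r => by simp [T]
  let V : C(E, ℝ →L[ℝ] E) := ⟨fun e => T (F e), T.continuous.comp hF.continuous⟩
  have hV : ContDiff ℝ ∞ V := T.contDiff.comp hF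
  have hVK : LipschitzWith (‖T‖₊ * K) V := T.lipschitz.comp hK
  let ι : ℝ →L[ℝ] Lp ℝ ∞ (volume.restrict (Icc (0 : ℝ) 1)) := Lp.constL ∞ _ ℝ
  have hι : ∀ r, ∀ᵐ s ∂(volume.restrict (Icc (0 : ℝ) 1)), ι r s = r := fun r =>
    Lp.coeFn_const (p := ∞) (μ := volume.restrict (Icc (0 : ℝ) 1)) (c := r)
  have h01 : (0 : ℝ) ≤ 1 := zero_le_one
  let t₀ : Icc (0 : ℝ) 1 := ⟨0, left_mem_Icc.mpr h01⟩
  let t₁ : Icc (0 : ℝ) 1 := ⟨1, right_mem_Icc.mpr h01⟩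
  have hx : IsIntegralTrajectory h01 t₀ V x₀ (ι 0) (ContinuousMap.const _ x₀) := by
    intro t
    rw [map_zero, intervalIntegral.integral_congr_ae (g := fun _ => (0 : E))]
    · simp
    · refine ae_uIoc_of_ae_Icc ?_ t₀.2 t.2
      filter_upwards [Lp.coeFn_zero ℝ ∞ (volume.restrict (Icc (0 : ℝ) 1))] with s hs
      rw [controlIntegrand, hs]
      simp
  obtain ⟨N, Y, hNo, hN, hY, -, hsol⟩ := exists_contDiffOn_trajectory h01 t₀ V hV hx
  let j : E × ℝ →L[ℝ] E × Lp ℝ ∞ (volume.restrict (Icc (0 : ℝ) 1)) :=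
    (ContinuousLinearMap.id ℝ E).prodMap ι
  have hj : j ⁻¹' N ∈ 𝓝 (x₀, (0 : ℝ)) := (hNo.preimage j.continuous).mem_nhds hN
  obtain ⟨ε, hε, hεN⟩ := Metric.mem_nhds_iff.mp hj
  rw [← ball_prod_same] at hεN
  let θ : E × ℝ → E := fun q => Y (j q) t₁
  have hθ : ContDiffOn ℝ ∞ θ (Metric.ball x₀ ε ×ˢ Metric.ball 0 ε) :=
    (ContinuousMap.evalCLM (M := E) ℝ t₁).contDiff.comp_contDiffOn
      (f := fun q => Y (j q)) (hY.comp j.contDiff.contDiffOn fun q hq => hεN hq)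
  -- the trajectory for the constant control `t`, extended to `ℝ`
  let y : E → ℝ → ℝ → E := fun z t => IccExtend h01 (Y (j (z, t)))
  have hyc : ∀ z t, Continuous (y z t) := fun z t => (Y (j (z, t))).continuous.Icc_extend'
  have hy : ∀ z ∈ Metric.ball x₀ ε, ∀ t ∈ Metric.ball (0 : ℝ) ε, ∀ τ ∈ Icc (0 : ℝ) 1,
      y z t τ = z + ∫ s in (0 : ℝ)..τ, V (y z t s) t := by
    intro z hz t ht τ hτ
    have h1 := hsol _ (hεN (mk_mem_prod hz ht)) ⟨τ, hτ⟩
    simp only [y]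
    rw [IccExtend_of_mem h01 _ hτ, h1]
    congr 1
    refine intervalIntegral.integral_congr_ae
      (ae_uIoc_of_ae_Icc ?_ (left_mem_Icc.mpr h01) hτ)
    filter_upwards [hι t] with s hs
    show V _ (ι t s) = _
    rw [hs]
    rfl
  -- scaling of time: the curve with control `τ t` is the curve with control `t` run to time `τ`
  have hscale : ∀ z ∈ Metric.ball x₀ ε, ∀ t ∈ Metric.ball (0 : ℝ) ε, ∀ τ ∈ Icc (0 : ℝ) 1,
      θ (z, τ * t) = y z t τ := by
    intro z hz t ht τ hτ
    have htt : τ * t ∈ Metric.ball (0 : ℝ) ε := by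
      rw [mem_ball_zero_iff, norm_mul] at *
      refine lt_of_le_of_lt ?_ ht
      rw [Real.norm_of_nonneg hτ.1]
      exact mul_le_of_le_one_left (norm_nonneg _) hτ.2
    have e1 : ∀ s ∈ Icc (0 : ℝ) 1, s * τ ∈ Icc (0 : ℝ) 1 := fun s hs =>
      ⟨mul_nonneg hs.1 hτ.1, mul_le_one₀ hs.2 hτ.1 hτ.2⟩
    have h0 := hy z hz _ htt 0 (left_mem_Icc.mpr h01)
    have h0' := hy z hz t ht 0 (left_mem_Icc.mpr h01)
    rw [intervalIntegral.integral_same, add_zero] at h0 h0'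
    have key := eqOn_of_integral_equation h01 hVK (v := fun _ => τ * t) (m := ‖τ * t‖)
      aestronglyMeasurable_const (by simp) (y₁ := y z (τ * t)) (y₂ := fun s => y z t (s * τ))
      (hyc _ _).continuousOn ((hyc _ _).comp (continuous_mul_const τ)).continuousOn
      (fun s hs => by rw [h0]; exact hy z hz _ htt s hs)
      (fun s hs => by
        simp only [zero_mul]
        rw [h0', hy z hz t ht (s * τ) (e1 s hs)]
        congr 1
        have h2 := intervalIntegral.smul_integral_comp_mul_right (a := 0) (b := s)
          (fun r => V (y z t r) t) τ
        rw [zero_mul] at h2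
        rw [← h2, ← intervalIntegral.integral_smul]
        refine intervalIntegral.integral_congr fun r _ => ?_
        show τ • T _ t = T _ (τ * t)
        rw [hT, hT, smul_smul])
      (by simp only [zero_mul]; rw [h0, h0'])
    have h1 := key (right_mem_Icc.mpr h01)
    simp only [one_mul] at h1
    rw [← h1]
    simp only [y, θ]
    rw [IccExtend_of_mem h01 _ (right_mem_Icc.mpr h01)]
  have hy0 : ∀ z ∈ Metric.ball x₀ ε, ∀ t ∈ Metric.ball (0 : ℝ) ε, y z t 0 = z := by
    intro z hz t ht
    rw [hy z hz t ht 0 (left_mem_Icc.mpr h01), intervalIntegral.integral_same, add_zero]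
  refine ⟨ε, hε, θ, hθ, fun z hz => ?_, fun z hz t ht => ?_⟩
  · have h0 := Metric.mem_ball_self (x := (0 : ℝ)) hε
    have := hscale z hz 0 h0 0 (left_mem_Icc.mpr h01)
    rw [zero_mul] at this
    rw [this, hy0 z hz 0 h0]
  · -- write `t = τ r` with `τ ∈ [0, 1]` and `r ≠ 0`, and compare derivatives in `τ`
    obtain ⟨r, hr, hr0, τ, hτ, rfl⟩ : ∃ r ∈ Metric.ball (0 : ℝ) ε, r ≠ 0 ∧
        ∃ τ ∈ Icc (0 : ℝ) 1, t = τ * r := by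
      by_cases h : t = 0
      · refine ⟨ε / 2, ?_, by positivity, 0, left_mem_Icc.mpr h01, by simp [h]⟩
        rw [mem_ball_zero_iff, Real.norm_of_nonneg (by positivity)]; linarith
      · exact ⟨t, ht, h, 1, right_mem_Icc.mpr h01, by simp⟩
    have hd : DifferentiableAt ℝ (fun s => θ (z, s)) (τ * r) := by
      have h1 : ContDiffAt ℝ ∞ θ (z, τ * r) := hθ.contDiffAt
        ((Metric.isOpen_ball.prod Metric.isOpen_ball).mem_nhds (mk_mem_prod hz ht))
      have h2 := h1.differentiableAt (by simp)
      exact h2.comp (τ * r) (by fun_prop)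
    have h3 : HasDerivWithinAt (fun σ => θ (z, σ * r)) (r • deriv (fun s => θ (z, s)) (τ * r))
        (Icc 0 1) τ := by
      have := HasDerivAt.scomp (h := fun σ : ℝ => σ * r) τ hd.hasDerivAt (hasDerivAt_mul_const r)
      exact this.hasDerivWithinAt
    have h4 : HasDerivWithinAt (fun σ => θ (z, σ * r)) (r • F (θ (z, τ * r))) (Icc 0 1) τ := by
      have hVc : Continuous fun s => V (y z r s) r :=
        (V.continuous.comp (hyc z r)).clm_apply continuous_const
      have h5 := ((hVc.integral_hasStrictDerivAt 0 τ).hasDerivAt.const_add z).hasDerivWithinAt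
        (s := Icc (0 : ℝ) 1)
      have h6 : r • F (θ (z, τ * r)) = V (y z r τ) r := by
        rw [hscale z hz r hr τ hτ]
        exact (hT _ _).symm
      rw [h6]
      exact h5.congr (fun σ hσ => by rw [hscale z hz r hr σ hσ, hy z hz r hr σ hσ])
        (by rw [hscale z hz r hr τ hτ, hy z hz r hr τ hτ])
    have h7 := (uniqueDiffOn_Icc zero_lt_one τ hτ).eq_deriv _ h3 h4
    rw [← (smul_right_injective E hr0) h7]
    exact hd.hasDerivAt

end Flow

/-! ### Determinants in `ℝ³` -/

section TripleProduct

/-- The determinant of three vectors of `ℝ³`. -/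
def tripleProduct (x y z : E3) : ℝ :=
  x 0 * (y 1 * z 2 - y 2 * z 1) - x 1 * (y 0 * z 2 - y 2 * z 0) + x 2 * (y 0 * z 1 - y 1 * z 0)

/-- The vector product of two vectors of `ℝ³`. -/
def vectorProduct (x y : E3) : E3 :=
  !₂[x 1 * y 2 - x 2 * y 1, x 2 * y 0 - x 0 * y 2, x 0 * y 1 - x 1 * y 0]

/-- Cramer's rule, without division. -/
lemma tripleProduct_smul (x y n w : E3) :
    tripleProduct x y n • w =
      tripleProduct w y n • x + tripleProduct x w n • y + tripleProduct x y w • n := by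
  ext i
  fin_cases i <;> simp [tripleProduct] <;> ring

/-- A functional that vanishes on `x` and `y` is proportional to `tripleProduct x y`. -/
lemma tripleProduct_mul_apply {x y : E3} (n : E3) {ξ : E3 → ℝ} (hadd : ∀ v w, ξ (v + w) = ξ v + ξ w)
    (hsmul : ∀ (c : ℝ) v, ξ (c • v) = c * ξ v) (hx : ξ x = 0) (hy : ξ y = 0) (w : E3) :
    tripleProduct x y n * ξ w = tripleProduct x y w * ξ n := by
  rw [← hsmul, tripleProduct_smul, hadd, hadd, hsmul, hsmul, hsmul, hx, hy]
  ring

lemma HasDerivAt.tripleProduct {f g h : ℝ → E3} {f' g' h' : E3} {t : ℝ} (hf : HasDerivAt f f' t)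
    (hg : HasDerivAt g g' t) (hh : HasDerivAt h h' t) :
    HasDerivAt (fun s => tripleProduct (f s) (g s) (h s))
      (tripleProduct f' (g t) (h t) + tripleProduct (f t) g' (h t) +
        tripleProduct (f t) (g t) h') t := by
  have e : ∀ {k : ℝ → E3} {k' : E3} (i : Fin 3), HasDerivAt k k' t →
      HasDerivAt (fun s => k s i) (k' i) t := fun i hk =>
    (EuclideanSpace.proj (𝕜 := ℝ) i).hasFDerivAt.comp_hasDerivAt t hk
  have h1 := (((e 0 hf).mul (((e 1 hg).mul (e 2 hh)).sub ((e 2 hg).mul (e 1 hh)))).sub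
    ((e 1 hf).mul (((e 0 hg).mul (e 2 hh)).sub ((e 2 hg).mul (e 0 hh))))).add
    ((e 2 hf).mul (((e 0 hg).mul (e 1 hh)).sub ((e 1 hg).mul (e 0 hh))))
  refine h1.congr_deriv ?_
  simp only [_root_.tripleProduct, Pi.mul_apply, Pi.sub_apply]
  ring

lemma ContDiff.tripleProduct {G : Type*} [NormedAddCommGroup G] [NormedSpace ℝ G]
    {n : WithTop ℕ∞} {f g h : G → E3} (hf : ContDiff ℝ n f) (hg : ContDiff ℝ n g)
    (hh : ContDiff ℝ n h) : ContDiff ℝ n fun p => tripleProduct (f p) (g p) (h p) := by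
  unfold _root_.tripleProduct
  fun_prop

lemma Continuous.tripleProduct {G : Type*} [TopologicalSpace G]
    {f g h : G → E3} (hf : Continuous f) (hg : Continuous g)
    (hh : Continuous h) : Continuous fun p => tripleProduct (f p) (g p) (h p) := by
  unfold _root_.tripleProduct
  fun_prop

lemma ContDiff.vectorProduct {G : Type*} [NormedAddCommGroup G] [NormedSpace ℝ G]
    {n : WithTop ℕ∞} {f g : G → E3} (hf : ContDiff ℝ n f) (hg : ContDiff ℝ n g) :
    ContDiff ℝ n fun p => vectorProduct (f p) (g p) := by
  refine contDiff_euclidean.mpr fun i => ?_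
  fin_cases i <;> simp [_root_.vectorProduct] <;> fun_prop

lemma not_linearIndependent_of_tripleProduct_eq_zero {w : Fin 3 → E3} {n : E3}
    (hn : tripleProduct (w 0) (w 1) n ≠ 0) (h : tripleProduct (w 0) (w 1) (w 2) = 0) :
    ¬ LinearIndependent ℝ w := by
  intro hli
  have h1 := tripleProduct_smul (w 0) (w 1) n (w 2)
  rw [h, zero_smul, add_zero] at h1
  have h2 := Fintype.linearIndependent_iff.mp hli
    ![-tripleProduct (w 2) (w 1) n, -tripleProduct (w 0) (w 2) n, tripleProduct (w 0) (w 1) n]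
    (by simp [Fin.sum_univ_three, h1]; abel)
  exact hn (by simpa using h2 2)

lemma tripleProduct_sum_smul (x y : E3) (c : E3) (z : Fin 3 → E3) :
    tripleProduct x y (∑ j, c j • z j) = ∑ j, c j * tripleProduct x y (z j) := by
  simp [tripleProduct, Fin.sum_univ_three]
  ring

end TripleProduct

/-! ### Singular controls in terms of 1-jets of vector fields -/

section Jets

/-! The constructions below depend on three vector fields only through their values `w i` and their
derivatives `A i` at a point. -/

variable (w : Fin 3 → E3) (A : Fin 3 → E3 →L[ℝ] E3)

/-- The value at a point of the Lie bracket of the `i`-th and the `j`-th field. -/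
def jetBracket (i j : Fin 3) : E3 := A j (w i) - A i (w j)

/-- The pairing of the covector `w₀ × w₁` with the bracket of the `i`-th and the `j`-th field. -/
def jetPairing (i j : Fin 3) : ℝ := tripleProduct (w 0) (w 1) (jetBracket w A i j)

/-- The vector `(h₁₂, h₂₀, h₀₁)`, which spans the kernel of the skew-symmetric matrix `(hᵢⱼ)` of
pairings: the singular feedback control. -/
def jetControl : E3 := !₂[jetPairing w A 1 2, jetPairing w A 2 0, jetPairing w A 0 1]

/-- The velocity generated by the singular feedback control. -/
def jetVelocity : E3 := ∑ i, jetControl w A i • w i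

/-- The derivative in the direction `v` of the determinant of the three fields. -/
def jetDetDeriv (v : E3) : ℝ :=
  tripleProduct (A 0 v) (w 1) (w 2) + tripleProduct (w 0) (A 1 v) (w 2) +
    tripleProduct (w 0) (w 1) (A 2 v)

/-- The gradient of the determinant of the three fields. -/
def jetDetGradient : E3 :=
  !₂[jetDetDeriv w A !₂[1, 0, 0], jetDetDeriv w A !₂[0, 1, 0], jetDetDeriv w A !₂[0, 0, 1]]

lemma clm_apply_eq_sum (B : E3 →L[ℝ] E3) (v : E3) :
    B v = v 0 • B !₂[1, 0, 0] + v 1 • B !₂[0, 1, 0] + v 2 • B !₂[0, 0, 1] := by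
  rw [← map_smul, ← map_smul, ← map_smul, ← map_add, ← map_add]
  congr 1
  ext i
  fin_cases i <;> simp

lemma jetDetDeriv_eq_sum (v : E3) : jetDetDeriv w A v = jetDetGradient w A 0 * v 0 +
    jetDetGradient w A 1 * v 1 + jetDetGradient w A 2 * v 2 := by
  simp only [jetDetDeriv, jetDetGradient]
  rw [clm_apply_eq_sum (A 0) v, clm_apply_eq_sum (A 1) v, clm_apply_eq_sum (A 2) v]
  simp [tripleProduct]
  ring

/-- The kernel property of the singular feedback control: the brackets with the velocity it
generates are annihilated by `w₀ × w₁`. -/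
lemma sum_jetControl_mul_jetPairing (i : Fin 3) :
    ∑ j, jetControl w A j * jetPairing w A j i = 0 := by
  have hskew : ∀ i j, jetPairing w A j i = - jetPairing w A i j := fun i j => by
    simp [jetPairing, jetBracket, tripleProduct]; ring
  have hdiag : ∀ i, jetPairing w A i i = 0 := fun i => by linarith [hskew i i]
  fin_cases i <;> simp [Fin.sum_univ_three, jetControl, hdiag]
  · rw [hskew 0 1]; ring
  · rw [hskew 1 2]; ring
  · rw [hskew 2 0]; ring

/-- A control in the kernel of the matrix of pairings that generates the same nonzero velocity as
the singular feedback control coincides with it. -/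
lemma eq_jetControl {c : E3} (hker : ∀ i, ∑ j, c j * jetPairing w A j i = 0)
    (hvel : ∑ j, c j • w j = jetVelocity w A) (hne : jetVelocity w A ≠ 0) :
    c = jetControl w A := by
  have hskew : ∀ i j, jetPairing w A j i = - jetPairing w A i j := fun i j => by
    simp [jetPairing, jetBracket, tripleProduct]; ring
  have hdiag : ∀ i, jetPairing w A i i = 0 := fun i => by linarith [hskew i i]
  have h0 := hker 0
  have h1 := hker 1
  have h2 := hker 2
  simp only [Fin.sum_univ_three, hdiag, mul_zero, add_zero, zero_add] at h0 h1 h2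
  rw [hskew 0 1] at h0
  rw [hskew 1 2] at h1
  rw [hskew 2 0] at h2
  -- the kernel condition says that `c` and the feedback control are proportional
  have hprop : ∀ k j, c j * jetControl w A k = c k * jetControl w A j := by
    intro k j
    fin_cases k <;> fin_cases j <;> simp [jetControl] <;> linarith
  have key : ∀ k, jetControl w A k • jetVelocity w A = c k • jetVelocity w A := by
    intro k
    conv_lhs => rw [← hvel]
    rw [jetVelocity, Finset.smul_sum, Finset.smul_sum]
    refine Finset.sum_congr rfl fun j _ => ?_
    rw [smul_smul, smul_smul, mul_comm, hprop k j]
  ext k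
  exact (smul_left_injective ℝ hne (key k)).symm

/-- The singular velocity is tangent to the dependence locus: the derivative of the determinant in
its direction is a multiple of the determinant. -/
lemma tripleProduct_mul_jetDetDeriv_jetVelocity (n : E3) :
    tripleProduct (w 0) (w 1) n * jetDetDeriv w A (jetVelocity w A) =
      (tripleProduct (w 0) (w 1) n * ∑ j, jetControl w A j *
          (A j !₂[1, 0, 0] 0 + A j !₂[0, 1, 0] 1 + A j !₂[0, 0, 1] 2) +
        tripleProduct (∑ j, jetControl w A j • jetBracket w A j 0) (w 1) n +
        tripleProduct (w 0) (∑ j, jetControl w A j • jetBracket w A j 1) n) *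
      tripleProduct (w 0) (w 1) (w 2) := by
  set c := jetControl w A with hc
  let B : E3 →L[ℝ] E3 := ∑ j, c j • A j
  let Z : Fin 3 → E3 := fun i => ∑ j, c j • jetBracket w A j i
  have hA : ∀ i, A i (jetVelocity w A) = B (w i) + Z i := by
    intro i
    simp only [jetVelocity, map_sum, map_smul, B, Z, jetBracket, ← hc,
      sum_apply, smul_apply, smul_sub, Finset.sum_sub_distrib]
    abel
  have hZ : ∀ i, tripleProduct (w 0) (w 1) (Z i) = 0 := fun i => by
    rw [tripleProduct_sum_smul]
    exact sum_jetControl_mul_jetPairing w A i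
  have htr : tripleProduct (B (w 0)) (w 1) (w 2) + tripleProduct (w 0) (B (w 1)) (w 2) +
      tripleProduct (w 0) (w 1) (B (w 2)) =
      (B !₂[1, 0, 0] 0 + B !₂[0, 1, 0] 1 + B !₂[0, 0, 1] 2) *
        tripleProduct (w 0) (w 1) (w 2) := by
    rw [clm_apply_eq_sum B (w 0), clm_apply_eq_sum B (w 1), clm_apply_eq_sum B (w 2)]
    simp only [tripleProduct, PiLp.add_apply, PiLp.smul_apply, smul_eq_mul]
    ring
  have hBtr : B !₂[1, 0, 0] 0 + B !₂[0, 1, 0] 1 + B !₂[0, 0, 1] 2 =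
      ∑ j, c j * (A j !₂[1, 0, 0] 0 + A j !₂[0, 1, 0] 1 + A j !₂[0, 0, 1] 2) := by
    simp [B, Fin.sum_univ_three]
    ring
  -- `Z 0` and `Z 1` lie in the plane of `w 0` and `w 1`
  have h0 : tripleProduct (w 0) (w 1) n * tripleProduct (Z 0) (w 1) (w 2) =
      tripleProduct (Z 0) (w 1) n * tripleProduct (w 0) (w 1) (w 2) := by
    have h := tripleProduct_smul (w 0) (w 1) n (Z 0)
    rw [hZ, zero_smul, add_zero] at h
    have h' := congrArg (fun z => tripleProduct z (w 1) (w 2)) h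
    simp only [tripleProduct, PiLp.add_apply, PiLp.smul_apply, smul_eq_mul] at h' ⊢
    linear_combination h'
  have h1 : tripleProduct (w 0) (w 1) n * tripleProduct (w 0) (Z 1) (w 2) =
      tripleProduct (w 0) (Z 1) n * tripleProduct (w 0) (w 1) (w 2) := by
    have h := tripleProduct_smul (w 0) (w 1) n (Z 1)
    rw [hZ, zero_smul, add_zero] at h
    have h' := congrArg (fun z => tripleProduct (w 0) z (w 2)) h
    simp only [tripleProduct, PiLp.add_apply, PiLp.smul_apply, smul_eq_mul] at h' ⊢
    linear_combination h'
  have hexp : jetDetDeriv w A (jetVelocity w A) =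
      (tripleProduct (B (w 0)) (w 1) (w 2) + tripleProduct (w 0) (B (w 1)) (w 2) +
        tripleProduct (w 0) (w 1) (B (w 2))) + tripleProduct (Z 0) (w 1) (w 2) +
        tripleProduct (w 0) (Z 1) (w 2) + tripleProduct (w 0) (w 1) (Z 2) := by
    rw [jetDetDeriv, hA, hA, hA]
    simp only [tripleProduct, PiLp.add_apply]
    ring
  rw [hexp, htr, hBtr, hZ]
  show _ = (_ + tripleProduct (Z 0) (w 1) n + tripleProduct (w 0) (Z 1) n) * _
  linear_combination h0 + h1

end Jets

/-! ### Lipschitz and absolutely continuous curves -/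

section Lipschitz

variable {E G : Type*} [NormedAddCommGroup E] [NormedSpace ℝ E]
  [NormedAddCommGroup G] [NormedSpace ℝ G] {c d : ℝ}

lemma ae_mem_Ioo_of_Icc (c d : ℝ) : ∀ᵐ t ∂(volume.restrict (Icc c d)), t ∈ Ioo c d := by
  rw [← Measure.restrict_congr_set Ioo_ae_eq_Icc]
  exact ae_restrict_mem measurableSet_Ioo

/-- A primitive of an essentially bounded function is Lipschitz. -/
lemma lipschitzOnWith_of_integral {f g : ℝ → E} (hg : IntegrableOn g (Icc c d))
    {m : NNReal} (hm : ∀ᵐ s ∂(volume.restrict (Icc c d)), ‖g s‖ ≤ m)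
    {t₀ : ℝ} (ht₀ : t₀ ∈ Icc c d) (hf : ∀ t ∈ Icc c d, f t = f t₀ + ∫ s in t₀..t, g s) :
    LipschitzOnWith m f (Icc c d) := by
  have hi : ∀ s ∈ Icc c d, ∀ t ∈ Icc c d, IntervalIntegrable g volume s t := fun s hs t ht =>
    (hg.mono_set (uIcc_subset_Icc hs ht)).intervalIntegrable
  refine LipschitzOnWith.of_dist_le_mul fun s hs t ht => ?_
  rw [dist_eq_norm, dist_eq_norm, hf s hs, hf t ht, add_sub_add_left_eq_sub,
    intervalIntegral.integral_interval_sub_left (hi _ ht₀ _ hs) (hi _ ht₀ _ ht)]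
  exact intervalIntegral.norm_integral_le_of_norm_le_const_ae (ae_uIoc_of_ae_Icc hm ht hs)

/-- A primitive of an integrable function has that function as derivative almost everywhere. -/
lemma ae_hasDerivAt_of_integral [CompleteSpace E] {f g : ℝ → E} (hg : IntegrableOn g (Icc c d))
    {t₀ : ℝ} (ht₀ : t₀ ∈ Icc c d) (hf : ∀ t ∈ Icc c d, f t = f t₀ + ∫ s in t₀..t, g s) :
    ∀ᵐ t ∂(volume.restrict (Icc c d)), HasDerivAt f (g t) t := by
  have hcd : c ≤ d := ht₀.1.trans ht₀.2
  have hi : IntervalIntegrable g volume c d := by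
    rw [← uIcc_of_le hcd] at hg
    exact hg.intervalIntegrable
  have h1 := ae_restrict_of_ae (s := Icc c d) hi.ae_hasDerivAt_integral
  filter_upwards [h1, ae_mem_Ioo_of_Icc c d, ae_restrict_mem measurableSet_Icc] with t h2 ht ht'
  have h3 := (h2 (by rwa [uIcc_of_le hcd]) t₀ (by rwa [uIcc_of_le hcd])).const_add (f t₀)
  refine h3.congr_of_eventuallyEq ?_
  filter_upwards [Icc_mem_nhds ht.1 ht.2] with s hs using hf s hs

/-- The composition of a Lipschitz curve with a `C¹` map is absolutely continuous. -/
lemma absolutelyContinuousOnInterval_comp (hcd : c ≤ d) {f : ℝ → E} {m : NNReal}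
    (hf : LipschitzOnWith m f (Icc c d)) {S : Set E} (hS : IsOpen S) {ψ : E → G}
    (hψ : ContDiffOn ℝ 1 ψ S) (hfS : MapsTo f (Icc c d) S) :
    AbsolutelyContinuousOnInterval (fun t => ψ (f t)) c d := by
  have hloc : LocallyLipschitzOn (Icc c d) fun t => ψ (f t) := by
    intro t ht
    obtain ⟨K, N, hN, hK⟩ := ((hψ (f t) (hfS ht)).contDiffAt
      (hS.mem_nhds (hfS ht))).exists_lipschitzOnWith
    refine ⟨K * m, f ⁻¹' N ∩ Icc c d, Filter.inter_mem
      ((hf.continuousOn t ht).preimage_mem_nhdsWithin hN) self_mem_nhdsWithin, ?_⟩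
    exact hK.comp (hf.mono inter_subset_right) fun s hs => hs.1
  obtain ⟨K, hK⟩ := hloc.exists_lipschitzOnWith_of_compact isCompact_Icc
  refine LipschitzOnWith.absolutelyContinuousOnInterval (K := K) ?_
  rwa [uIcc_of_le hcd]

/-- Grönwall's inequality for absolutely continuous functions. -/
lemma eq_zero_of_abs_deriv_le_mul_abs (hcd : c ≤ d) {w w' : ℝ → ℝ}
    (hw : AbsolutelyContinuousOnInterval w c d) {L : ℝ}
    (hd : ∀ᵐ t ∂(volume.restrict (Icc c d)), HasDerivAt w (w' t) t)
    (hL : ∀ t ∈ Icc c d, |w' t| ≤ L * |w t|) (h₀ : w c = 0) : ∀ t ∈ Icc c d, w t = 0 := by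
  have hc : ContinuousOn w (Icc c d) := by
    have := hw.continuousOn; rwa [uIcc_of_le hcd] at this
  refine eq_zero_of_norm_le_integral_norm hcd hc (L := L) fun t ht => ?_
  have h1 := (hw.mono (c := c) (d := t) (by
    rw [uIcc_of_le ht.1, uIcc_of_le hcd]; exact Icc_subset_Icc_right ht.2)).integral_deriv_eq_sub
  rw [h₀, sub_zero] at h1
  rw [← h1, ← intervalIntegral.integral_const_mul]
  refine intervalIntegral.norm_integral_le_of_norm_le ht.1 ?_
    ((ContinuousOn.intervalIntegrable (by
      rw [uIcc_of_le ht.1]; exact hc.norm.mono (Icc_subset_Icc_right ht.2))).const_mul _)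
  filter_upwards [(ae_restrict_iff' measurableSet_Icc).mp hd] with s hs hs'
  have hsI : s ∈ Icc c d := ⟨hs'.1.le, hs'.2.trans ht.2⟩
  rw [(hs hsI).deriv]
  exact hL s hsI

end Lipschitz

/-! ### Control systems defined by three vector fields on `ℝ³` -/

section ControlField

/-- The control system `v ↦ ∑ vᵢ Wᵢ(y)` on `ℝ³` defined by three vector fields. -/
def controlField (W : Fin 3 → E3 → E3) (hW : ∀ i, ContDiff ℝ ∞ (W i)) : C(E3, E3 →L[ℝ] E3) where
  toFun y := ∑ i, (EuclideanSpace.proj (𝕜 := ℝ) i : E3 →L[ℝ] ℝ).smulRight (W i y)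
  continuous_toFun := by
    have := fun i => (hW i).continuous
    refine continuous_finsetSum _ fun i _ => ?_
    exact ((ContinuousLinearMap.smulRightL ℝ E3 E3 (EuclideanSpace.proj i)).continuous).comp (this i)

variable {W : Fin 3 → E3 → E3} (hW : ∀ i, ContDiff ℝ ∞ (W i))

lemma controlField_apply (y v : E3) : controlField W hW y v = ∑ i, v i • W i y := by
  simp [controlField]

lemma contDiff_controlField : ContDiff ℝ ∞ (controlField W hW) := by
  show ContDiff ℝ ∞ fun y =>
    ∑ i, (EuclideanSpace.proj (𝕜 := ℝ) i : E3 →L[ℝ] ℝ).smulRight (W i y)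
  refine ContDiff.sum fun i _ => ?_
  exact (ContinuousLinearMap.smulRightL ℝ E3 E3 (EuclideanSpace.proj i)).contDiff.comp (hW i)

/-- The derivative of the control system in the state. -/
def controlFieldDeriv (W : Fin 3 → E3 → E3) (hW : ∀ i, ContDiff ℝ ∞ (W i)) :
    C(E3, E3 →L[ℝ] E3 →L[ℝ] E3) :=
  ⟨fderiv ℝ (controlField W hW), (contDiff_controlField hW).continuous_fderiv (by simp)⟩

lemma hasFDerivAt_controlField (y : E3) :
    HasFDerivAt (controlField W hW) (controlFieldDeriv W hW y) y :=
  ((contDiff_controlField hW).differentiable (by simp) y).hasFDerivAt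

lemma controlFieldDeriv_apply (y z v : E3) :
    controlFieldDeriv W hW y z v = ∑ i, v i • fderiv ℝ (W i) y z := by
  have h1 := (hasFDerivAt_controlField hW y).clm_apply (hasFDerivAt_const v y)
  have h2 : HasFDerivAt (fun y => ∑ i, v i • W i y) (∑ i, v i • fderiv ℝ (W i) y) y :=
    HasFDerivAt.fun_sum fun i _ => ((hW i).differentiable (by simp) y).hasFDerivAt.const_smul (v i)
  simp_rw [controlField_apply] at h1
  have h3 := congrArg (fun B => B z) (h1.unique h2)
  simpa using h3

end ControlField

/-! ### Singular arcs in `ℝ³` -/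

section SingularArcs

/-- Along the singular feedback control, the linearized dynamics preserves the plane spanned by
`w₀` and `w₁`: the derivative of the covector `w₀ × w₁` along the adjoint flow is a multiple of
this covector. -/
lemma tripleProduct_mul_adjoint_defect (w : Fin 3 → E3) (A : Fin 3 → E3 →L[ℝ] E3) (n y : E3) :
    tripleProduct (w 0) (w 1) n * (tripleProduct (A 0 (jetVelocity w A)) (w 1) y +
        tripleProduct (w 0) (A 1 (jetVelocity w A)) y +
        tripleProduct (w 0) (w 1) (∑ j, jetControl w A j • A j y)) =
      tripleProduct (w 0) (w 1) y * (tripleProduct (A 0 (jetVelocity w A)) (w 1) n +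
        tripleProduct (w 0) (A 1 (jetVelocity w A)) n +
        tripleProduct (w 0) (w 1) (∑ j, jetControl w A j • A j n)) := by
  have hF : ∀ i, ∑ j, jetControl w A j • A j (w i) =
      A i (jetVelocity w A) + ∑ j, jetControl w A j • jetBracket w A i j := by
    intro i
    simp only [jetVelocity, map_sum, map_smul, jetBracket, smul_sub, Finset.sum_sub_distrib]
    abel
  have hB : ∀ i, ∑ j, jetControl w A j * tripleProduct (w 0) (w 1) (jetBracket w A i j) = 0 := by
    intro i
    rw [← neg_eq_zero, ← sum_jetControl_mul_jetPairing w A i, ← Finset.sum_neg_distrib]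
    refine Finset.sum_congr rfl fun j _ => ?_
    simp only [jetPairing, jetBracket, tripleProduct, PiLp.sub_apply]
    ring
  refine tripleProduct_mul_apply n (ξ := fun y => tripleProduct (A 0 (jetVelocity w A)) (w 1) y +
        tripleProduct (w 0) (A 1 (jetVelocity w A)) y +
        tripleProduct (w 0) (w 1) (∑ j, jetControl w A j • A j y)) ?_ ?_ ?_ ?_ y
  · intro v v'
    simp only [map_add, Fin.sum_univ_three, tripleProduct, PiLp.add_apply, PiLp.smul_apply,
      smul_eq_mul]
    ring
  · intro c v
    simp only [map_smul, Fin.sum_univ_three, tripleProduct, PiLp.add_apply, PiLp.smul_apply,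
      smul_eq_mul]
    ring
  · have h := hB 0
    rw [← tripleProduct_sum_smul] at h
    simp only [hF]
    simp only [tripleProduct, PiLp.add_apply] at h ⊢
    linear_combination h
  · have h := hB 1
    rw [← tripleProduct_sum_smul] at h
    simp only [hF]
    simp only [tripleProduct, PiLp.add_apply] at h ⊢
    linear_combination h

/-- The singular feedback control of three vector fields on `ℝ³`. -/
def singularControl (W : Fin 3 → E3 → E3) (y : E3) : E3 :=
  jetControl (fun i => W i y) fun i => fderiv ℝ (W i) y

/-- The vector field generated by the singular feedback control. -/
def singularVelocity (W : Fin 3 → E3 → E3) (y : E3) : E3 :=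
  jetVelocity (fun i => W i y) fun i => fderiv ℝ (W i) y

/-- The value at `y` of the derivative of the covector `w₀ × w₁` along the adjoint of the dynamics
linearized along the singular velocity. -/
def adjointDefect (W : Fin 3 → E3 → E3) (z y : E3) : ℝ :=
  tripleProduct (fderiv ℝ (W 0) z (singularVelocity W z)) (W 1 z) y +
    tripleProduct (W 0 z) (fderiv ℝ (W 1) z (singularVelocity W z)) y +
    tripleProduct (W 0 z) (W 1 z) (∑ j, singularControl W z j • fderiv ℝ (W j) z y)

/-- A singular arc: an integral curve of the singular velocity field inside the dependence locus,
at points where the first two fields are independent (witnessed by `n`) and where the singular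
velocity does not vanish. -/
structure IsSingularArc (W : Fin 3 → E3 → E3) (n : E3) (a b : ℝ) (x : ℝ → E3) : Prop where
  hasDerivAt : ∀ t ∈ Icc a b, HasDerivAt x (singularVelocity W (x t)) t
  det_eq_zero : ∀ t ∈ Icc a b, tripleProduct (W 0 (x t)) (W 1 (x t)) (W 2 (x t)) = 0
  det_ne_zero : ∀ t ∈ Icc a b, tripleProduct (W 0 (x t)) (W 1 (x t)) n ≠ 0
  velocity_ne_zero : ∀ t ∈ Icc a b, singularVelocity W (x t) ≠ 0

section Smoothness

variable {W : Fin 3 → E3 → E3} (hW : ∀ i, ContDiff ℝ ∞ (W i))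
include hW

lemma contDiff_fderiv_apply {f : E3 → E3} (hf : ContDiff ℝ ∞ f) (i : Fin 3) :
    ContDiff ℝ ∞ fun y => fderiv ℝ (W i) y (f y) :=
  ((hW i).fderiv_right (by simp)).clm_apply hf

lemma contDiff_singularControl : ContDiff ℝ ∞ (singularControl W) := by
  have h : ∀ i j, ContDiff ℝ ∞ fun y =>
      jetPairing (fun i => W i y) (fun i => fderiv ℝ (W i) y) i j := fun i j =>
    (hW 0).tripleProduct (hW 1) ((contDiff_fderiv_apply hW (hW i) j).sub
      (contDiff_fderiv_apply hW (hW j) i))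
  refine contDiff_euclidean.mpr fun i => ?_
  fin_cases i
  · exact h 1 2
  · exact h 2 0
  · exact h 0 1

lemma contDiff_singularVelocity : ContDiff ℝ ∞ (singularVelocity W) :=
  ContDiff.sum (f := fun i y => singularControl W y i • W i y) (s := Finset.univ) fun i _ =>
    (contDiff_euclidean.mp (contDiff_singularControl hW) i).smul (hW i)

lemma continuous_adjointDefect (n : E3) : Continuous fun z => adjointDefect W z n :=
  (((contDiff_fderiv_apply hW (contDiff_singularVelocity hW) 0).continuous.tripleProduct
      (hW 1).continuous continuous_const).add ((hW 0).continuous.tripleProduct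
        (contDiff_fderiv_apply hW (contDiff_singularVelocity hW) 1).continuous
        continuous_const)).add
    ((hW 0).continuous.tripleProduct (hW 1).continuous (continuous_finsetSum _ fun j _ =>
      (contDiff_euclidean.mp (contDiff_singularControl hW) j).continuous.smul
        (contDiff_fderiv_apply hW contDiff_const j).continuous))

end Smoothness

variable {a b : ℝ}

lemma IsSingularArc.continuousOn {W : Fin 3 → E3 → E3} {n : E3} {γ : ℝ → E3}
    (hγ : IsSingularArc W n a b γ) : ContinuousOn γ (Icc a b) := fun t ht =>
  (hγ.hasDerivAt t ht).continuousAt.continuousWithinAt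

lemma IsSingularArc.exists_lipschitzOnWith {W : Fin 3 → E3 → E3} {n : E3} {γ : ℝ → E3}
    (hγ : IsSingularArc W n a b γ) (hW : ∀ i, ContDiff ℝ ∞ (W i)) :
    ∃ m, LipschitzOnWith m γ (Icc a b) := by
  obtain ⟨C, hC⟩ := isCompact_Icc.exists_bound_of_continuousOn
    ((contDiff_singularVelocity hW).continuous.comp_continuousOn hγ.continuousOn)
  refine ⟨C.toNNReal, (convex_Icc a b).lipschitzOnWith_of_nnnorm_hasDerivWithin_le
    (fun t ht => (hγ.hasDerivAt t ht).hasDerivWithinAt) fun t ht => ?_⟩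
  rw [← NNReal.coe_le_coe, coe_nnnorm]
  exact (hC t ht).trans (Real.le_coe_toNNReal C)

section Extend

variable {U G : Type*} [NormedAddCommGroup U] [NormedSpace ℝ U]
  [NormedAddCommGroup G] [NormedSpace ℝ G]

lemma IccExtend_controlIntegral (hab : a ≤ b) (t₀ : Icc a b)
    (v : Lp U ∞ (volume.restrict (Icc a b))) (B : C(Icc a b, U →L[ℝ] G)) :
    ∀ t ∈ Icc a b, IccExtend hab (controlIntegral hab t₀ v B) t =
      IccExtend hab (controlIntegral hab t₀ v B) t₀ +
        ∫ s in (t₀ : ℝ)..t, controlIntegrand hab v B s := by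
  intro t ht
  rw [IccExtend_of_mem hab _ ht, IccExtend_of_mem hab _ t₀.2, controlIntegral_apply,
    controlIntegral_apply, intervalIntegral.integral_same, zero_add]

lemma exists_lipschitzOnWith_controlIntegral (hab : a ≤ b) (t₀ : Icc a b)
    (v : Lp U ∞ (volume.restrict (Icc a b))) (B : C(Icc a b, U →L[ℝ] G)) :
    ∃ m, LipschitzOnWith m (IccExtend hab (controlIntegral hab t₀ v B)) (Icc a b) := by
  refine ⟨‖B‖₊ * ‖v‖₊, lipschitzOnWith_of_integral (integrableOn_controlIntegrand hab v B)
    ?_ t₀.2 (IccExtend_controlIntegral hab t₀ v B)⟩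
  filter_upwards [ae_norm_le_norm_Lp v] with s hs
  exact (B _).le_of_opNorm_le_of_le (B.norm_coe_le_norm _) hs

lemma ae_hasDerivAt_controlIntegral [CompleteSpace G] (hab : a ≤ b) (t₀ : Icc a b)
    (v : Lp U ∞ (volume.restrict (Icc a b))) (B : C(Icc a b, U →L[ℝ] G)) :
    ∀ᵐ t ∂(volume.restrict (Icc a b)), HasDerivAt (IccExtend hab (controlIntegral hab t₀ v B))
      (controlIntegrand hab v B t) t :=
  ae_hasDerivAt_of_integral (integrableOn_controlIntegrand hab v B) t₀.2
    (IccExtend_controlIntegral hab t₀ v B)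

end Extend

section Linearization

variable {W : Fin 3 → E3 → E3} (hW : ∀ i, ContDiff ℝ ∞ (W i))

/-- `D` is the linearization along `x` of the map sending a control near `u` to its trajectory. -/
def IsLinearization (hab : a ≤ b) (u : LInftyControl a b) (x : C(Icc a b, E3))
    (D : LInftyControl a b →L[ℝ] C(Icc a b, E3)) : Prop :=
  ∀ v, D v = controlIntegral hab ⟨a, left_mem_Icc.mpr hab⟩ v ((controlField W hW).comp x) +
    controlIntegral hab ⟨a, left_mem_Icc.mpr hab⟩ u
      (linearizedDynamics (controlFieldDeriv W hW) x (D v))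

variable {hW}

lemma IsLinearization.exists_lipschitzOnWith {hab : a ≤ b} {u : LInftyControl a b}
    {x : C(Icc a b, E3)} {D : LInftyControl a b →L[ℝ] C(Icc a b, E3)}
    (hD : IsLinearization hW hab u x D) (v : LInftyControl a b) :
    ∃ m, LipschitzOnWith m (IccExtend hab (D v)) (Icc a b) := by
  obtain ⟨m₁, h₁⟩ := exists_lipschitzOnWith_controlIntegral hab ⟨a, left_mem_Icc.mpr hab⟩ v
    ((controlField W hW).comp x)
  obtain ⟨m₂, h₂⟩ := exists_lipschitzOnWith_controlIntegral hab ⟨a, left_mem_Icc.mpr hab⟩ u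
    (linearizedDynamics (controlFieldDeriv W hW) x (D v))
  refine ⟨m₁ + m₂, ?_⟩
  rw [hD v]
  exact h₁.add h₂

lemma IsLinearization.apply_left {hab : a ≤ b} {u : LInftyControl a b}
    {x : C(Icc a b, E3)} {D : LInftyControl a b →L[ℝ] C(Icc a b, E3)}
    (hD : IsLinearization hW hab u x D) (v : LInftyControl a b) :
    IccExtend hab (D v) a = 0 := by
  rw [IccExtend_of_mem hab _ (left_mem_Icc.mpr hab), hD v, ContinuousMap.add_apply,
    controlIntegral_apply, controlIntegral_apply, intervalIntegral.integral_same,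
    intervalIntegral.integral_same, zero_add]

lemma IsLinearization.ae_hasDerivAt {hab : a ≤ b} {u : LInftyControl a b}
    {x : C(Icc a b, E3)} {D : LInftyControl a b →L[ℝ] C(Icc a b, E3)}
    (hD : IsLinearization hW hab u x D) (v : LInftyControl a b) :
    ∀ᵐ t ∂(volume.restrict (Icc a b)), HasDerivAt (IccExtend hab (D v))
      (∑ i, v t i • W i (IccExtend hab x t) +
        ∑ i, u t i • fderiv ℝ (W i) (IccExtend hab x t) (IccExtend hab (D v) t)) t := by
  filter_upwards [ae_hasDerivAt_controlIntegral hab ⟨a, left_mem_Icc.mpr hab⟩ v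
    ((controlField W hW).comp x), ae_hasDerivAt_controlIntegral hab ⟨a, left_mem_Icc.mpr hab⟩ u
    (linearizedDynamics (controlFieldDeriv W hW) x (D v))] with t h₁ h₂
  have h₃ := h₁.add h₂
  rw [controlIntegrand, controlIntegrand] at h₃
  have e1 := controlField_apply hW (IccExtend hab x t) (v t)
  have e2 := controlFieldDeriv_apply hW (IccExtend hab x t) (IccExtend hab (D v) t) (u t)
  rw [← e1, ← e2]
  refine h₃.congr_of_eventuallyEq (Filter.Eventually.of_forall fun s => ?_)
  show IccExtend hab (D v) s = _
  conv_lhs => rw [hD v]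
  rfl

/-- The singular feedback control along a singular arc is singular: the covector `w₀ × w₁` at the
endpoint annihilates all variations. -/
theorem IsSingularArc.not_surjective (hab : a < b) {n : E3} {γ : ℝ → E3}
    (hγ : IsSingularArc W n a b γ) {x : C(Icc a b, E3)} (hx : ∀ t, x t = γ t)
    {u : LInftyControl a b}
    (hu : ∀ᵐ t ∂(volume.restrict (Icc a b)), u t = singularControl W (γ t))
    {D : LInftyControl a b →L[ℝ] C(Icc a b, E3)} (hD : IsLinearization hW hab.le u x D) :
    ¬ Function.Surjective fun v => D v ⟨b, right_mem_Icc.mpr hab.le⟩ := by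
  have hWd := fun i y => ((hW i).differentiable (by simp) y).hasFDerivAt
  have key : ∀ v, tripleProduct (W 0 (γ b)) (W 1 (γ b)) (D v ⟨b, right_mem_Icc.mpr hab.le⟩) = 0 := by
    intro v
    set y := IccExtend hab.le (D v) with hy
    have hxE : ∀ t ∈ Icc a b, IccExtend hab.le x t = γ t := fun t ht => by
      rw [IccExtend_of_mem hab.le _ ht, hx]
    obtain ⟨m₁, hm₁⟩ := hD.exists_lipschitzOnWith v
    obtain ⟨m₂, hm₂⟩ := hγ.exists_lipschitzOnWith hW
    have hAC : AbsolutelyContinuousOnInterval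
        (fun t => tripleProduct (W 0 (γ t)) (W 1 (γ t)) (y t)) a b := by
      have hψ : ContDiff ℝ 1 fun q : E3 × E3 => tripleProduct (W 0 q.1) (W 1 q.1) q.2 :=
        ContDiff.tripleProduct (((hW 0).of_le (by simp)).comp contDiff_fst)
          (((hW 1).of_le (by simp)).comp contDiff_fst) contDiff_snd
      exact absolutelyContinuousOnInterval_comp (f := fun t => (γ t, y t))
        (ψ := fun q : E3 × E3 => tripleProduct (W 0 q.1) (W 1 q.1) q.2) hab.le
        (hm₂.prodMk hm₁) isOpen_univ hψ.contDiffOn (mapsTo_univ _ _)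
    have hcont : ContinuousOn
        (fun t => adjointDefect W (γ t) n / tripleProduct (W 0 (γ t)) (W 1 (γ t)) n) (Icc a b) := by
      have h1 : Continuous fun z => tripleProduct (W 0 z) (W 1 z) n :=
        (hW 0).continuous.tripleProduct (hW 1).continuous continuous_const
      have h2 := (continuous_adjointDefect hW n).comp_continuousOn hγ.continuousOn
      exact h2.div (h1.comp_continuousOn hγ.continuousOn) hγ.det_ne_zero
    obtain ⟨L, hL⟩ := isCompact_Icc.exists_bound_of_continuousOn hcont
    -- the pairing of `w₀ × w₁` with the variation solves a homogeneous linear equation: the control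
    -- term drops out since all the fields lie in the plane of `w₀` and `w₁`
    have hz := eq_zero_of_abs_deriv_le_mul_abs hab.le hAC (L := L)
      (w' := fun t => adjointDefect W (γ t) n / tripleProduct (W 0 (γ t)) (W 1 (γ t)) n *
        tripleProduct (W 0 (γ t)) (W 1 (γ t)) (y t)) ?_ ?_ ?_ b (right_mem_Icc.mpr hab.le)
    · rwa [hy, IccExtend_of_mem hab.le _ (right_mem_Icc.mpr hab.le)] at hz
    · filter_upwards [hu, hD.ae_hasDerivAt v, ae_restrict_mem measurableSet_Icc] with t hut hyt ht
      rw [hxE t ht, hut] at hyt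
      have h1 := ((hWd 0 (γ t)).comp_hasDerivAt t (hγ.hasDerivAt t ht)).tripleProduct
        ((hWd 1 (γ t)).comp_hasDerivAt t (hγ.hasDerivAt t ht)) hyt
      refine h1.congr_deriv ?_
      have h2 := tripleProduct_mul_adjoint_defect (fun i => W i (γ t))
        (fun i => fderiv ℝ (W i) (γ t)) n (y t)
      have h3 : tripleProduct (W 0 (γ t)) (W 1 (γ t)) (∑ i, v t i • W i (γ t)) = 0 := by
        rw [tripleProduct_sum_smul, Fin.sum_univ_three, hγ.det_eq_zero t ht]
        simp only [tripleProduct]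
        ring
      have h4 : ∀ p q r s : E3, tripleProduct p q (r + s) =
          tripleProduct p q r + tripleProduct p q s := fun p q r s => by
        simp only [tripleProduct, PiLp.add_apply]; ring
      rw [div_mul_eq_mul_div, eq_div_iff (hγ.det_ne_zero t ht)]
      simp only [Function.comp_apply, h4]
      rw [h3, zero_add, mul_comm]
      refine h2.trans ?_
      rw [mul_comm]
      rfl
    · intro t ht
      rw [abs_mul]
      exact mul_le_mul_of_nonneg_right (hL t ht) (abs_nonneg _)
    · rw [hy, hD.apply_left]
      simp [tripleProduct]
  intro hs
  obtain ⟨v, hv⟩ := hs n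
  refine hγ.det_ne_zero b (right_mem_Icc.mpr hab.le) ?_
  rw [← hv]
  exact key v

end Linearization

end SingularArcs

/-! ### Uniqueness of the singular control -/

section Adjoint

set_option maxSynthPendingDepth 3

variable {a b : ℝ} {W : Fin 3 → E3 → E3} {hW : ∀ i, ContDiff ℝ ∞ (W i)}

/-- The map sending the derivative `B = DV(y)` of a control system to the coefficient
`p ↦ (v ↦ -p ∘ B(·) v)` of its adjoint equation. -/
def adjointCoefficient :
    (E3 →L[ℝ] E3 →L[ℝ] E3) → ((E3 →L[ℝ] ℝ) →L[ℝ] E3 →L[ℝ] E3 →L[ℝ] ℝ) := fun B =>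
  -((ContinuousLinearMap.compL ℝ E3 (E3 →L[ℝ] E3) (E3 →L[ℝ] ℝ)).flip B.flip).comp
    (ContinuousLinearMap.compL ℝ E3 E3 ℝ)

lemma continuous_adjointCoefficient : Continuous adjointCoefficient := by
  have h1 : Continuous fun B : E3 →L[ℝ] E3 →L[ℝ] E3 => B.flip :=
    (ContinuousLinearMap.flipₗᵢ ℝ E3 E3 E3).continuous
  have h2 := (ContinuousLinearMap.compL ℝ E3 (E3 →L[ℝ] E3) (E3 →L[ℝ] ℝ)).flip.continuous.comp h1
  exact (h2.clm_comp continuous_const).neg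

/-- Solvability of the adjoint equation backward in time. Its solutions vanish nowhere unless they
vanish at the final time. -/
lemma exists_adjoint_solution (hW : ∀ i, ContDiff ℝ ∞ (W i)) (hab : a ≤ b)
    (u : LInftyControl a b) (x : C(Icc a b, E3)) (φ : E3 →L[ℝ] ℝ) :
    ∃ p : C(Icc a b, E3 →L[ℝ] ℝ), p ⟨b, right_mem_Icc.mpr hab⟩ = φ ∧
      (∃ m, LipschitzOnWith m (IccExtend hab p) (Icc a b)) ∧
      (∀ᵐ t ∂(volume.restrict (Icc a b)), ∃ p' : E3 →L[ℝ] ℝ, HasDerivAt (IccExtend hab p) p' t ∧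
        ∀ z, p' z = - IccExtend hab p t (∑ i, u t i • fderiv ℝ (W i) (IccExtend hab x t) z)) ∧
      (φ ≠ 0 → ∀ t, p t ≠ 0) := by
  let tb : Icc a b := ⟨b, right_mem_Icc.mpr hab⟩
  let M : C(Icc a b, (E3 →L[ℝ] ℝ) →L[ℝ] E3 →L[ℝ] E3 →L[ℝ] ℝ) :=
    ⟨fun s => adjointCoefficient (controlFieldDeriv W hW (x s)),
      continuous_adjointCoefficient.comp ((controlFieldDeriv W hW).continuous.comp x.continuous)⟩
  let T := pointwiseApply (Icc a b) (E3 →L[ℝ] ℝ) (E3 →L[ℝ] E3 →L[ℝ] ℝ) M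
  obtain ⟨L, hL, hT⟩ := exists_norm_pointwiseApply_le M
  obtain ⟨e, he⟩ := isUnit_one_sub_volterra hab tb u T hL hT
  let p : C(Icc a b, E3 →L[ℝ] ℝ) := (↑e⁻¹ : C(Icc a b, E3 →L[ℝ] ℝ) →L[ℝ] C(Icc a b, E3 →L[ℝ] ℝ))
    (ContinuousMap.const _ φ)
  have hp : p = ContinuousMap.const _ φ + controlIntegral hab tb u (T p) := by
    have h1 : (↑e : C(Icc a b, E3 →L[ℝ] ℝ) →L[ℝ] C(Icc a b, E3 →L[ℝ] ℝ)) p =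
        ContinuousMap.const _ φ := by
      show ((↑e : C(Icc a b, E3 →L[ℝ] ℝ) →L[ℝ] C(Icc a b, E3 →L[ℝ] ℝ)) *
        (↑e⁻¹ : C(Icc a b, E3 →L[ℝ] ℝ) →L[ℝ] C(Icc a b, E3 →L[ℝ] ℝ))) _ = _
      rw [Units.mul_inv]
      rfl
    rw [he] at h1
    exact sub_eq_iff_eq_add.mp h1
  have hpE : ∀ t, IccExtend hab p t = φ + IccExtend hab (controlIntegral hab tb u (T p)) t := by
    intro t
    conv_lhs => rw [hp]
    rfl
  have hpint : ∀ c ∈ Icc a b, ∀ t ∈ Icc a b, IccExtend hab p t = IccExtend hab p c +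
      ∫ s in c..t, controlIntegrand hab u (T p) s := by
    intro c hc t ht
    rw [hpE, hpE, IccExtend_controlIntegral hab tb u _ t ht,
      IccExtend_controlIntegral hab tb u _ c hc,
      ← intervalIntegral.integral_interval_sub_left
        (intervalIntegrable_controlIntegrand hab u _ tb.2 ht)
        (intervalIntegrable_controlIntegrand hab u _ tb.2 hc)]
    abel
  refine ⟨p, ?_, ?_, ?_, ?_⟩
  · have h1 := congrArg (fun q : C(Icc a b, E3 →L[ℝ] ℝ) => q tb) hp
    simp only [ContinuousMap.add_apply, ContinuousMap.const_apply, controlIntegral_apply,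
      intervalIntegral.integral_same, add_zero] at h1
    exact h1
  · obtain ⟨m, hm⟩ := exists_lipschitzOnWith_controlIntegral hab tb u (T p)
    refine ⟨m, fun s hs t ht => ?_⟩
    rw [hpE, hpE, edist_add_left]
    exact hm hs ht
  · filter_upwards [ae_hasDerivAt_controlIntegral hab tb u (T p)] with t ht
    refine ⟨_, (ht.const_add φ).congr_of_eventuallyEq (Filter.Eventually.of_forall hpE), fun z => ?_⟩
    have h1 := controlFieldDeriv_apply hW (IccExtend hab x t) z (u t)
    rw [← h1]
    rfl
  · intro hφ t₀ ht₀
    refine hφ ?_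
    have hcont : Continuous (IccExtend hab p) := p.continuous.Icc_extend'
    have hz := eq_zero_of_norm_le_integral_norm (c := t₀) (d := b) t₀.2.2
      (w := IccExtend hab p) hcont.continuousOn (L := L * ‖u‖) (fun t ht => by
        have htI : t ∈ Icc a b := ⟨t₀.2.1.trans ht.1, ht.2⟩
        rw [hpint t₀ t₀.2 t htI, IccExtend_of_mem hab _ t₀.2, ht₀, zero_add,
          ← intervalIntegral.integral_const_mul]
        refine intervalIntegral.norm_integral_le_of_norm_le ht.1 ?_
          (hcont.norm.intervalIntegrable _ _ |>.const_mul _)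
        filter_upwards [(ae_restrict_iff' measurableSet_Icc).mp (ae_norm_le_norm_Lp u)] with s hs hs'
        have hsI : s ∈ Icc a b := ⟨t₀.2.1.trans hs'.1.le, hs'.2.trans ht.2⟩
        calc ‖controlIntegrand hab u (T p) s‖ ≤ (L * ‖p (projIcc a b hab s)‖) * ‖u‖ :=
              (T p _).le_of_opNorm_le_of_le (hT p _) (hs hsI)
          _ = L * ‖u‖ * ‖IccExtend hab p s‖ := by
              simp only [IccExtend, Function.comp_apply]; ring)
    have h1 := hz b (right_mem_Icc.mpr t₀.2.2)
    rw [hpint t₀ t₀.2 b tb.2, IccExtend_of_mem hab _ t₀.2, ht₀, zero_add] at h1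
    have h2 := hpint t₀ t₀.2 b tb.2
    rw [h1, IccExtend_of_mem hab _ t₀.2, ht₀, zero_add] at h2
    have h3 := congrArg (fun q : C(Icc a b, E3 →L[ℝ] ℝ) => q tb) hp
    simp only [ContinuousMap.add_apply, ContinuousMap.const_apply, controlIntegral_apply,
      intervalIntegral.integral_same, add_zero] at h3
    rw [← h3, ← h2, IccExtend_of_mem hab _ tb.2]

/-- A covector annihilating all variations at the final time propagates, by the adjoint equation, to
a covector annihilating all the control fields along the trajectory. -/
lemma IsLinearization.adjoint_annihilates (hab : a < b) {u : LInftyControl a b}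
    {x : C(Icc a b, E3)} {D : LInftyControl a b →L[ℝ] C(Icc a b, E3)}
    (hD : IsLinearization hW hab.le u x D) {p : C(Icc a b, E3 →L[ℝ] ℝ)}
    (hpL : ∃ m, LipschitzOnWith m (IccExtend hab.le p) (Icc a b))
    (hpd : ∀ᵐ t ∂(volume.restrict (Icc a b)), ∃ p' : E3 →L[ℝ] ℝ,
      HasDerivAt (IccExtend hab.le p) p' t ∧ ∀ z, p' z =
        - IccExtend hab.le p t (∑ i, u t i • fderiv ℝ (W i) (IccExtend hab.le x t) z))
    (hann : ∀ v, p ⟨b, right_mem_Icc.mpr hab.le⟩ (D v ⟨b, right_mem_Icc.mpr hab.le⟩) = 0)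
    (i : Fin 3) : ∀ t ∈ Icc a b, IccExtend hab.le p t (W i (IccExtend hab.le x t)) = 0 := by
  set P := IccExtend hab.le p with hP
  set X := IccExtend hab.le x with hX
  have hPc : Continuous P := p.continuous.Icc_extend'
  have hXc : Continuous X := x.continuous.Icc_extend'
  -- test against the control whose components are the pairings of the covector with the fields
  let q : ℝ → E3 := fun t => WithLp.toLp 2 fun j => P t (W j (X t))
  have hqc : Continuous q := by
    refine (PiLp.continuous_toLp 2 _).comp (continuous_pi fun j => ?_)
    exact hPc.clm_apply ((hW j).continuous.comp hXc)
  obtain ⟨C, hC⟩ := isCompact_Icc.exists_bound_of_continuousOn (hqc.continuousOn (s := Icc a b))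
  have hq : MemLp q ∞ (volume.restrict (Icc a b)) :=
    memLp_top_of_bound hqc.aestronglyMeasurable C
      (by filter_upwards [ae_restrict_mem measurableSet_Icc] with t ht using hC t ht)
  let v : LInftyControl a b := hq.toLp q
  obtain ⟨m₁, hm₁⟩ := hpL
  obtain ⟨m₂, hm₂⟩ := hD.exists_lipschitzOnWith v
  have hAC : AbsolutelyContinuousOnInterval (fun t => P t (IccExtend hab.le (D v) t)) a b := by
    have hψ : ContDiff ℝ 1 fun r : (E3 →L[ℝ] ℝ) × E3 => r.1 r.2 :=
      contDiff_fst.clm_apply contDiff_snd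
    exact absolutelyContinuousOnInterval_comp (f := fun t => (P t, IccExtend hab.le (D v) t))
      (ψ := fun r : (E3 →L[ℝ] ℝ) × E3 => r.1 r.2) hab.le
      (hm₁.prodMk hm₂) isOpen_univ hψ.contDiffOn (mapsTo_univ _ _)
  have hder : ∀ᵐ t ∂(volume.restrict (Icc a b)),
      deriv (fun t => P t (IccExtend hab.le (D v) t)) t = ∑ j, P t (W j (X t)) ^ 2 := by
    filter_upwards [hpd, hD.ae_hasDerivAt v, hq.coeFn_toLp] with t ⟨p', hp', hp''⟩ hy hv
    rw [(hp'.clm_apply hy).deriv, hp'', hv, map_add, neg_add_cancel_comm_assoc, map_sum]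
    refine Finset.sum_congr rfl fun j _ => ?_
    rw [map_smul, smul_eq_mul, sq]
  have hint : ∫ t in a..b, ∑ j, P t (W j (X t)) ^ 2 = 0 := by
    have h1 := hAC.integral_deriv_eq_sub
    rw [hD.apply_left, map_zero, sub_zero, IccExtend_of_mem hab.le _ (right_mem_Icc.mpr hab.le),
      hP, IccExtend_of_mem hab.le _ (right_mem_Icc.mpr hab.le), hann] at h1
    rw [← h1]
    refine intervalIntegral.integral_congr_ae ?_
    filter_upwards [ae_uIoc_of_ae_Icc hder (left_mem_Icc.mpr hab.le)
      (right_mem_Icc.mpr hab.le)] with t ht ht' using (ht ht').symm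
  have hsc : Continuous fun t => ∑ j, P t (W j (X t)) ^ 2 :=
    continuous_finsetSum _ fun j _ => (hPc.clm_apply ((hW j).continuous.comp hXc)).pow 2
  have hs0 : ∀ t, 0 ≤ ∑ j, P t (W j (X t)) ^ 2 := fun t => Finset.sum_nonneg fun _ _ => sq_nonneg _
  have hzero : EqOn (fun t => ∑ j, P t (W j (X t)) ^ 2) 0 (Icc a b) := by
    rw [intervalIntegral.integral_of_le hab.le, ← integral_Icc_eq_integral_Ioc,
      integral_eq_zero_iff_of_nonneg hs0
        (hsc.continuousOn.integrableOn_compact isCompact_Icc)] at hint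
    exact Measure.eqOn_Icc_of_ae_eq volume hab.ne hint hsc.continuousOn continuousOn_const
  intro t ht
  have h1 := hzero ht
  simp only [Pi.zero_apply] at h1
  rw [Finset.sum_eq_zero_iff_of_nonneg fun _ _ => sq_nonneg _] at h1
  exact pow_eq_zero_iff (two_ne_zero) |>.mp (h1 i (Finset.mem_univ i))

/-- A singular control generating a singular arc is the singular feedback control. -/
theorem IsSingularArc.ae_eq_singularControl (hab : a < b) {n : E3} {γ : ℝ → E3}
    (hγ : IsSingularArc W n a b γ) {x : C(Icc a b, E3)} (hx : ∀ t, x t = γ t)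
    {u : LInftyControl a b}
    (hu : ∀ᵐ t ∂(volume.restrict (Icc a b)), ∑ i, u t i • W i (γ t) = singularVelocity W (γ t))
    {D : LInftyControl a b →L[ℝ] C(Icc a b, E3)} (hD : IsLinearization hW hab.le u x D)
    (hs : ¬ Function.Surjective fun v => D v ⟨b, right_mem_Icc.mpr hab.le⟩) :
    ∀ᵐ t ∂(volume.restrict (Icc a b)), u t = singularControl W (γ t) := by
  have hWd := fun i y => ((hW i).differentiable (by simp) y).hasFDerivAt
  have hxE : ∀ t ∈ Icc a b, IccExtend hab.le x t = γ t := fun t ht => by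
    rw [IccExtend_of_mem hab.le _ ht, hx]
  -- a covector that annihilates the image of the linearized endpoint mapping
  obtain ⟨φ, hφ, hφD⟩ : ∃ φ : E3 →L[ℝ] ℝ, φ ≠ 0 ∧
      ∀ v, φ (D v ⟨b, right_mem_Icc.mpr hab.le⟩) = 0 := by
    let f : LInftyControl a b →ₗ[ℝ] E3 :=
      ((ContinuousMap.evalCLM ℝ ⟨b, right_mem_Icc.mpr hab.le⟩).comp D).toLinearMap
    have hf : LinearMap.range f < ⊤ := lt_top_iff_ne_top.mpr fun h =>
      hs (LinearMap.range_eq_top.mp h)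
    obtain ⟨g, hg, hgk⟩ := Submodule.exists_le_ker_of_lt_top _ hf
    refine ⟨LinearMap.toContinuousLinearMap g, fun h => hg ?_, fun v => hgk ⟨v, rfl⟩⟩
    exact LinearMap.toContinuousLinearMap.map_eq_zero_iff.mp h
  obtain ⟨p, hpb, hpL, hpd, hp0⟩ := exists_adjoint_solution hW hab.le u x φ
  have hann := hD.adjoint_annihilates hab hpL hpd (fun v => by rw [hpb]; exact hφD v)
  set P := IccExtend hab.le p with hP
  filter_upwards [hu, hpd, ae_mem_Ioo_of_Icc a b, ae_restrict_mem measurableSet_Icc] with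
    t hut ⟨p', hp', hp''⟩ hto ht
  have hPt : P t ≠ 0 := by
    rw [hP, IccExtend_of_mem hab.le _ ht]; exact hp0 hφ _
  have hPW : ∀ s ∈ Icc a b, ∀ i, P s (W i (γ s)) = 0 := fun s hs i => by
    rw [← hxE s hs]; exact hann i s hs
  -- the covector is a nonzero multiple of `w₀ × w₁`
  have hprop : ∀ z, tripleProduct (W 0 (γ t)) (W 1 (γ t)) n * P t z =
      tripleProduct (W 0 (γ t)) (W 1 (γ t)) z * P t n := fun z =>
    tripleProduct_mul_apply n (map_add (P t)) (fun c v => by rw [map_smul, smul_eq_mul])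
      (hPW t ht 0) (hPW t ht 1) z
  have hPn : P t n ≠ 0 := by
    intro h
    refine hPt (ContinuousLinearMap.ext fun z => ?_)
    have h1 := hprop z
    rw [h, mul_zero] at h1
    exact (mul_eq_zero.mp h1).resolve_left (hγ.det_ne_zero t ht)
  refine eq_jetControl _ _ (fun i => ?_) hut (hγ.velocity_ne_zero t ht)
  -- differentiate the relation `P (W i) = 0` along the arc
  have h1 : HasDerivAt (fun s => P s (W i (γ s))) _ t :=
    hp'.clm_apply ((hWd i (γ t)).comp_hasDerivAt t (hγ.hasDerivAt t ht))
  have h2 : HasDerivAt (fun s => P s (W i (γ s))) 0 t := by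
    refine (hasDerivAt_const t (0 : ℝ)).congr_of_eventuallyEq ?_
    filter_upwards [Icc_mem_nhds hto.1 hto.2] with s hs using hPW s hs i
  have h3 := h1.unique h2
  rw [hp'', hxE t ht, ← hut] at h3
  have h4 : P t (∑ j, u t j • jetBracket (fun i => W i (γ t)) (fun i => fderiv ℝ (W i) (γ t)) j i)
      = 0 := by
    rw [neg_add_eq_sub, ← map_sub, map_sum, ← Finset.sum_sub_distrib] at h3
    rw [← h3]
    congr 1
    refine Finset.sum_congr rfl fun j _ => ?_
    rw [jetBracket, map_smul, smul_sub]
  have h5 := hprop (∑ j, u t j •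
    jetBracket (fun i => W i (γ t)) (fun i => fderiv ℝ (W i) (γ t)) j i)
  rw [h4, mul_zero, tripleProduct_sum_smul] at h5
  exact (mul_eq_zero.mp h5.symm).resolve_right hPn

end Adjoint

/-! ### The foliation of the dependence locus by singular arcs -/

section ArcFamily

variable {W : Fin 3 → E3 → E3}

/-- The gradient of the determinant of three vector fields. -/
def detGradient (W : Fin 3 → E3 → E3) (y : E3) : E3 :=
  jetDetGradient (fun i => W i y) fun i => fderiv ℝ (W i) y

/-- A field tangent to the level sets of the determinant and transverse to the singular velocity. -/
def transverseVelocity (W : Fin 3 → E3 → E3) (y : E3) : E3 :=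
  vectorProduct (detGradient W y) (singularVelocity W y)

lemma contDiff_detGradient (hW : ∀ i, ContDiff ℝ ∞ (W i)) : ContDiff ℝ ∞ (detGradient W) := by
  have h : ∀ v : E3, ContDiff ℝ ∞ fun y =>
      jetDetDeriv (fun i => W i y) (fun i => fderiv ℝ (W i) y) v := fun v =>
    (((contDiff_fderiv_apply hW contDiff_const 0).tripleProduct (hW 1) (hW 2)).add
      ((hW 0).tripleProduct (contDiff_fderiv_apply hW contDiff_const 1) (hW 2))).add
      ((hW 0).tripleProduct (hW 1) (contDiff_fderiv_apply hW contDiff_const 2))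
  refine contDiff_euclidean.mpr fun i => ?_
  fin_cases i
  · exact h _
  · exact h _
  · exact h _

lemma contDiff_transverseVelocity (hW : ∀ i, ContDiff ℝ ∞ (W i)) :
    ContDiff ℝ ∞ (transverseVelocity W) :=
  (contDiff_detGradient hW).vectorProduct (contDiff_singularVelocity hW)

lemma singularVelocity_eq_zero {y : E3} (h : ∀ i, W i y = 0) : singularVelocity W y = 0 := by
  simp [singularVelocity, jetVelocity, h]

/-- The auxiliary fields vanish with the three given ones, so compact support of the latter makes the
former globally Lipschitz. -/
lemma exists_lipschitzWith_of_singularVelocity_zero (hc : ∀ i, HasCompactSupport (W i))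
    {f : E3 → E3} (hf : ContDiff ℝ ∞ f) (h0 : ∀ y, singularVelocity W y = 0 → f y = 0) :
    ∃ K, LipschitzWith K f := by
  have hcs : HasCompactSupport f := by
    refine HasCompactSupport.intro (K := ⋃ i, tsupport (W i)) (isCompact_iUnion hc) fun y hy => ?_
    refine h0 y (singularVelocity_eq_zero fun i => ?_)
    exact image_eq_zero_of_notMem_tsupport fun h => hy (mem_iUnion.mpr ⟨i, h⟩)
  exact hf.lipschitzWith_of_hasCompactSupport hcs (by simp)

lemma hasDerivAt_det (hW : ∀ i, ContDiff ℝ ∞ (W i)) {γ : ℝ → E3} {v : E3} {t : ℝ}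
    (hγ : HasDerivAt γ v t) :
    HasDerivAt (fun s => tripleProduct (W 0 (γ s)) (W 1 (γ s)) (W 2 (γ s)))
      (jetDetDeriv (fun i => W i (γ t)) (fun i => fderiv ℝ (W i) (γ t)) v) t := by
  have hWd := fun i y => ((hW i).differentiable (by simp) y).hasFDerivAt
  exact ((hWd 0 _).comp_hasDerivAt t hγ).tripleProduct ((hWd 1 _).comp_hasDerivAt t hγ)
    ((hWd 2 _).comp_hasDerivAt t hγ)

lemma jetDetDeriv_vectorProduct_self (w : Fin 3 → E3) (A : Fin 3 → E3 →L[ℝ] E3) (v : E3) :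
    jetDetDeriv w A (vectorProduct (jetDetGradient w A) v) = 0 := by
  rw [jetDetDeriv_eq_sum]
  simp [vectorProduct]
  ring

/-- The determinant satisfies a linear homogeneous differential equation along the singular
velocity, so it stays equal to zero. -/
lemma det_eq_zero_of_singularVelocity (hW : ∀ i, ContDiff ℝ ∞ (W i)) {n : E3} {b : ℝ} {γ : ℝ → E3}
    (hγ : ∀ t ∈ Icc 0 b, HasDerivAt γ (singularVelocity W (γ t)) t)
    (hn : ∀ t ∈ Icc 0 b, tripleProduct (W 0 (γ t)) (W 1 (γ t)) n ≠ 0)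
    (h0 : tripleProduct (W 0 (γ 0)) (W 1 (γ 0)) (W 2 (γ 0)) = 0) :
    ∀ t ∈ Icc 0 b, tripleProduct (W 0 (γ t)) (W 1 (γ t)) (W 2 (γ t)) = 0 := by
  have hγc : ContinuousOn γ (Icc 0 b) := fun t ht => (hγ t ht).continuousAt.continuousWithinAt
  let c : E3 → Fin 3 → ℝ := fun y => singularControl W y
  have hc : ∀ j, Continuous fun y => c y j := fun j =>
    (contDiff_euclidean.mp (contDiff_singularControl hW) j).continuous
  have hWc := fun i => (hW i).continuous
  have hA : ∀ (j : Fin 3) {f : E3 → E3}, ContDiff ℝ ∞ f →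
      Continuous fun y => fderiv ℝ (W j) y (f y) := fun j f hf =>
    (contDiff_fderiv_apply hW hf j).continuous
  have hA' : ∀ (j : Fin 3) (v : E3) (k : Fin 3), Continuous fun y => fderiv ℝ (W j) y v k :=
    fun j v k => (contDiff_euclidean.mp (contDiff_fderiv_apply hW contDiff_const j) k).continuous
  let B : E3 → Fin 3 → Fin 3 → E3 := fun y j i =>
    jetBracket (fun i => W i y) (fun i => fderiv ℝ (W i) y) j i
  have hB : ∀ j i, Continuous fun y => B y j i := fun j i => (hA i (hW j)).sub (hA j (hW i))
  let m : E3 → ℝ := fun y => tripleProduct (W 0 y) (W 1 y) n * ∑ j, c y j *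
          (fderiv ℝ (W j) y !₂[1, 0, 0] 0 + fderiv ℝ (W j) y !₂[0, 1, 0] 1 +
            fderiv ℝ (W j) y !₂[0, 0, 1] 2) +
        tripleProduct (∑ j, c y j • B y j 0) (W 1 y) n +
        tripleProduct (W 0 y) (∑ j, c y j • B y j 1) n
  have hτ : Continuous fun y => tripleProduct (W 0 y) (W 1 y) n :=
    (hWc 0).tripleProduct (hWc 1) continuous_const
  have hm : Continuous m :=
    ((hτ.mul (continuous_finsetSum _ fun j _ => (hc j).mul
      (((hA' j _ 0).add (hA' j _ 1)).add (hA' j _ 2)))).add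
      (Continuous.tripleProduct (continuous_finsetSum _ fun j _ => (hc j).smul (hB j 0)) (hWc 1)
        continuous_const)).add
      (Continuous.tripleProduct (hWc 0) (continuous_finsetSum _ fun j _ => (hc j).smul (hB j 1))
        continuous_const)
  have hcont : ContinuousOn (fun t => m (γ t) / tripleProduct (W 0 (γ t)) (W 1 (γ t)) n)
      (Icc 0 b) := (hm.comp_continuousOn hγc).div (hτ.comp_continuousOn hγc) hn
  obtain ⟨L, hL⟩ := isCompact_Icc.exists_bound_of_continuousOn hcont
  refine eq_zero_of_abs_deriv_le_mul_abs_self_of_eq_zero_right (K := L)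
    (f := fun t => tripleProduct (W 0 (γ t)) (W 1 (γ t)) (W 2 (γ t)))
    (fun t ht => (hasDerivAt_det hW (hγ t ht)).continuousAt.continuousWithinAt)
    (fun t ht => (hasDerivAt_det hW (hγ t (Ico_subset_Icc_self ht))).hasDerivWithinAt) h0 ?_
  intro t ht
  have ht' := Ico_subset_Icc_self ht
  have h1 := tripleProduct_mul_jetDetDeriv_jetVelocity (fun i => W i (γ t))
    (fun i => fderiv ℝ (W i) (γ t)) n
  have h2 : jetDetDeriv (fun i => W i (γ t)) (fun i => fderiv ℝ (W i) (γ t))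
      (singularVelocity W (γ t)) = m (γ t) / tripleProduct (W 0 (γ t)) (W 1 (γ t)) n *
        tripleProduct (W 0 (γ t)) (W 1 (γ t)) (W 2 (γ t)) := by
    rw [div_mul_eq_mul_div, eq_div_iff (hn t ht'), mul_comm]
    exact h1
  rw [h2, norm_mul]
  exact mul_le_mul_of_nonneg_right (hL t ht') (norm_nonneg _)

/-- At a point of the dependence locus where the singular velocity and the gradient of the
determinant do not vanish, the two transported directions are independent. -/
lemma eq_zero_of_smul_transverse_add_smul_singular {y n : E3}
    (hn : tripleProduct (W 0 y) (W 1 y) n ≠ 0)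
    (hd : tripleProduct (W 0 y) (W 1 y) (W 2 y) = 0) (hv : singularVelocity W y ≠ 0)
    (hg : detGradient W y ≠ 0) {σ τ : ℝ}
    (h : σ • transverseVelocity W y + τ • singularVelocity W y = 0) : σ = 0 ∧ τ = 0 := by
  have horth : detGradient W y 0 * singularVelocity W y 0 +
      detGradient W y 1 * singularVelocity W y 1 + detGradient W y 2 * singularVelocity W y 2 = 0 := by
    have h1 := tripleProduct_mul_jetDetDeriv_jetVelocity (fun i => W i y) (fun i => fderiv ℝ (W i) y) n
    rw [hd, mul_zero] at h1
    have h2 := (mul_eq_zero.mp h1).resolve_left hn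
    rwa [jetDetDeriv_eq_sum] at h2
  have hpos : ∀ z : E3, z ≠ 0 → 0 < z 0 ^ 2 + z 1 ^ 2 + z 2 ^ 2 := by
    intro z hz
    have h1 := EuclideanSpace.real_norm_sq_eq z
    rw [Fin.sum_univ_three] at h1
    rw [← h1]
    exact pow_pos (norm_pos_iff.mpr hz) 2
  have hv' := hpos _ hv
  have hg' := hpos _ hg
  have hi : ∀ i, σ * transverseVelocity W y i + τ * singularVelocity W y i = 0 := fun i => by
    simpa using congrArg (fun z : E3 => z i) h
  have h0 := hi 0
  have h1 := hi 1
  have h2 := hi 2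
  simp only [transverseVelocity, vectorProduct] at h0 h1 h2
  generalize singularVelocity W y = f at *
  generalize detGradient W y = g at *
  simp at h0 h1 h2
  have hτ : τ = 0 := by
    have : τ * (f 0 ^ 2 + f 1 ^ 2 + f 2 ^ 2) = 0 := by
      linear_combination f 0 * h0 + f 1 * h1 + f 2 * h2
    exact (mul_eq_zero.mp this).resolve_right hv'.ne'
  refine ⟨?_, hτ⟩
  have : σ * ((f 0 ^ 2 + f 1 ^ 2 + f 2 ^ 2) * (g 0 ^ 2 + g 1 ^ 2 + g 2 ^ 2)) = 0 := by
    rw [hτ] at h0 h1 h2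
    linear_combination (g 1 * f 2 - g 2 * f 1) * h0 + (g 2 * f 0 - g 0 * f 2) * h1 +
      (g 0 * f 1 - g 1 * f 0) * h2 + σ * (g 0 * f 0 + g 1 * f 1 + g 2 * f 2) * horth
  exact (mul_eq_zero.mp this).resolve_right (by positivity)

/-- A map with injective strict derivative is injective near the point. -/
lemma exists_injOn_of_injective_hasStrictFDerivAt {G H : Type*} [NormedAddCommGroup G]
    [NormedSpace ℝ G] [CompleteSpace G] [NormedAddCommGroup H] [NormedSpace ℝ H]
    [FiniteDimensional ℝ H] {f : G → H} {f' : G →L[ℝ] H} {x : G} (hf : HasStrictFDerivAt f f' x)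
    (hf' : Function.Injective f') : ∃ N ∈ 𝓝 x, InjOn f N := by
  obtain ⟨g, hg⟩ := f'.toLinearMap.exists_leftInverse_of_injective (LinearMap.ker_eq_bot.mpr hf')
  let g' : H →L[ℝ] G := LinearMap.toContinuousLinearMap g
  have h1 : HasStrictFDerivAt (fun y => g' (f y))
      ((ContinuousLinearEquiv.refl ℝ G : G ≃L[ℝ] G) : G →L[ℝ] G) x := by
    have h2 := g'.hasStrictFDerivAt.comp x hf
    refine h2.congr_fderiv ?_
    ext z
    exact LinearMap.congr_fun hg z
  refine ⟨(h1.toOpenPartialHomeomorph _).source,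
    (h1.toOpenPartialHomeomorph _).open_source.mem_nhds h1.mem_toOpenPartialHomeomorph_source, ?_⟩
  intro y hy z hz hyz
  refine (h1.toOpenPartialHomeomorph _).injOn hy hz ?_
  show g' (f y) = g' (f z)
  rw [hyz]

/-- Near a point of the dependence locus where the first two fields are independent and where the
singular velocity and the gradient of the determinant do not vanish, the dependence locus is
foliated by singular arcs. -/
theorem exists_singularArc_family (hW : ∀ i, ContDiff ℝ ∞ (W i))
    (hc : ∀ i, HasCompactSupport (W i)) {x₀ n : E3}
    (hn : tripleProduct (W 0 x₀) (W 1 x₀) n ≠ 0)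
    (hd : tripleProduct (W 0 x₀) (W 1 x₀) (W 2 x₀) = 0) (hv : singularVelocity W x₀ ≠ 0)
    (hg : detGradient W x₀ ≠ 0) {S : Set E3} (hS : S ∈ 𝓝 x₀) :
    ∃ (b : ℝ) (Φ : ℝ × ℝ → E3) (O : Set (ℝ × ℝ)), 0 < b ∧ IsOpen O ∧
      Ioo (-1 : ℝ) 1 ×ˢ Icc 0 b ⊆ O ∧ ContDiffOn ℝ ∞ Φ O ∧ InjOn Φ O ∧ MapsTo Φ O S ∧
      ∀ s ∈ Ioo (-1 : ℝ) 1, IsSingularArc W n 0 b fun t => Φ (s, t) := by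
  obtain ⟨K₁, hK₁⟩ := exists_lipschitzWith_of_singularVelocity_zero hc
    (contDiff_singularVelocity hW) fun y h => h
  obtain ⟨K₂, hK₂⟩ := exists_lipschitzWith_of_singularVelocity_zero hc
    (contDiff_transverseVelocity hW) fun y h => by
      simp only [transverseVelocity, h]
      ext i
      fin_cases i <;> simp [vectorProduct]
  obtain ⟨ε₁, hε₁, θ, hθ, hθ0, hθd⟩ := exists_contDiffOn_flow (contDiff_singularVelocity hW) hK₁ x₀
  obtain ⟨ε₂, hε₂, η, hη, hη0, hηd⟩ :=
    exists_contDiffOn_flow (contDiff_transverseVelocity hW) hK₂ x₀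
  have hx₁ : x₀ ∈ Metric.ball x₀ ε₁ := Metric.mem_ball_self hε₁
  have hx₂ : x₀ ∈ Metric.ball x₀ ε₂ := Metric.mem_ball_self hε₂
  have h0₁ : (0 : ℝ) ∈ Metric.ball (0 : ℝ) ε₁ := Metric.mem_ball_self hε₁
  have h0₂ : (0 : ℝ) ∈ Metric.ball (0 : ℝ) ε₂ := Metric.mem_ball_self hε₂
  let g : ℝ → E3 := fun s => η (x₀, s)
  have hgc : ContDiffOn ℝ ∞ g (Metric.ball 0 ε₂) :=
    hη.comp (contDiff_const.prodMk contDiff_id).contDiffOn fun s hs => mk_mem_prod hx₂ hs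
  have hg0 : g 0 = x₀ := hη0 x₀ hx₂
  -- the determinant vanishes along the transverse curve
  have hgd : ∀ s ∈ Metric.ball (0 : ℝ) ε₂,
      tripleProduct (W 0 (g s)) (W 1 (g s)) (W 2 (g s)) = 0 := by
    intro s hs
    have hder := fun r hr => hasDerivAt_det hW (hηd x₀ hx₂ r hr)
    have h1 := Metric.isOpen_ball.is_const_of_deriv_eq_zero
      (f := fun r => tripleProduct (W 0 (g r)) (W 1 (g r)) (W 2 (g r)))
      (convex_ball (0 : ℝ) ε₂).isPreconnected
      (fun r hr => (hder r hr).differentiableAt.differentiableWithinAt)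
      (fun r hr => by
        rw [(hder r hr).deriv]
        exact jetDetDeriv_vectorProduct_self _ _ _) hs h0₂
    rw [h1, hg0]
    exact hd
  let O₁ : Set ℝ := Metric.ball 0 ε₂ ∩ g ⁻¹' Metric.ball x₀ ε₁
  have hO₁ : IsOpen O₁ := hgc.continuousOn.isOpen_inter_preimage Metric.isOpen_ball
    Metric.isOpen_ball
  have h0O₁ : (0 : ℝ) ∈ O₁ := ⟨h0₂, by rw [mem_preimage, hg0]; exact hx₁⟩
  -- the first parameter runs along a curve transverse to the singular velocity inside the
  -- dependence locus, the second one along the singular arcs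
  let Ψ : ℝ × ℝ → E3 := fun q => θ (g q.1, q.2)
  have hΨ : ContDiffOn ℝ ∞ Ψ (O₁ ×ˢ Metric.ball 0 ε₁) :=
    hθ.comp ((hgc.comp contDiff_fst.contDiffOn fun q hq => hq.1.1).prodMk
      contDiff_snd.contDiffOn) fun q hq => mk_mem_prod hq.1.2 hq.2
  have hOo : IsOpen (O₁ ×ˢ Metric.ball (0 : ℝ) ε₁) := hO₁.prod Metric.isOpen_ball
  have h00 : ((0 : ℝ), (0 : ℝ)) ∈ O₁ ×ˢ Metric.ball (0 : ℝ) ε₁ := mk_mem_prod h0O₁ h0₁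
  have hΨ0 : Ψ (0, 0) = x₀ := by
    show θ (g 0, 0) = x₀
    rw [hg0, hθ0 x₀ hx₁]
  have hΨat : ContDiffAt ℝ ∞ Ψ (0, 0) := hΨ.contDiffAt (hOo.mem_nhds h00)
  have hstrict := hΨat.hasStrictFDerivAt (by simp)
  obtain ⟨N, hN, hinj⟩ : ∃ N ∈ 𝓝 ((0 : ℝ), (0 : ℝ)), InjOn Ψ N := by
    refine exists_injOn_of_injective_hasStrictFDerivAt hstrict ?_
    have e1 : fderiv ℝ Ψ (0, 0) (1, 0) = transverseVelocity W x₀ := by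
      have h1 : HasDerivAt (fun s => Ψ (s, 0)) (fderiv ℝ Ψ (0, 0) (1, 0)) 0 :=
        HasFDerivAt.comp_hasDerivAt (f := fun s : ℝ => (s, (0 : ℝ))) 0 hstrict.hasFDerivAt
          ((hasDerivAt_id 0).prodMk (hasDerivAt_const 0 0))
      have h2 := hηd x₀ hx₂ 0 h0₂
      rw [hη0 x₀ hx₂] at h2
      refine h1.unique (h2.congr_of_eventuallyEq ?_)
      filter_upwards [hO₁.mem_nhds h0O₁] with s hs using hθ0 _ hs.2
    have e2 : fderiv ℝ Ψ (0, 0) (0, 1) = singularVelocity W x₀ := by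
      have h1 : HasDerivAt (fun t => Ψ (0, t)) (fderiv ℝ Ψ (0, 0) (0, 1)) 0 :=
        HasFDerivAt.comp_hasDerivAt (f := fun t : ℝ => ((0 : ℝ), t)) 0 hstrict.hasFDerivAt
          ((hasDerivAt_const 0 0).prodMk (hasDerivAt_id 0))
      have h2 := hθd x₀ hx₁ 0 h0₁
      rw [hθ0 x₀ hx₁] at h2
      refine h1.unique ?_
      simp only [Ψ, hg0]
      exact h2
    refine (injective_iff_map_eq_zero _).mpr fun q hq => ?_
    have h1 : q = q.1 • ((1 : ℝ), (0 : ℝ)) + q.2 • ((0 : ℝ), (1 : ℝ)) := by ext <;> simp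
    rw [h1, map_add, map_smul, map_smul, e1, e2] at hq
    obtain ⟨h2, h3⟩ := eq_zero_of_smul_transverse_add_smul_singular hn hd hv hg hq
    exact Prod.ext h2 h3
  -- on a small square all the required open conditions hold
  have hopen : S ∩ {y | tripleProduct (W 0 y) (W 1 y) n ≠ 0} ∩ {y | singularVelocity W y ≠ 0} ∈
      𝓝 (Ψ (0, 0)) := by
    rw [hΨ0]
    refine Filter.inter_mem (Filter.inter_mem hS ?_) ?_
    · exact (((hW 0).continuous.tripleProduct (hW 1).continuous
        continuous_const).continuousAt.eventually_ne hn)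
    · exact (contDiff_singularVelocity hW).continuous.continuousAt.eventually_ne hv
  have hnhds := Filter.inter_mem (Filter.inter_mem (hOo.mem_nhds h00) hN)
    (hΨat.continuousAt.preimage_mem_nhds hopen)
  obtain ⟨ρ, hρ, hball⟩ := Metric.mem_nhds_iff.mp hnhds
  rw [← ball_prod_same] at hball
  let j : ℝ × ℝ → ℝ × ℝ := fun q => (ρ * q.1, q.2)
  have hj : ContDiff ℝ ∞ j := (contDiff_const.mul contDiff_fst).prodMk contDiff_snd
  let O : Set (ℝ × ℝ) := Ioo (-1 : ℝ) 1 ×ˢ Metric.ball 0 ρ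
  have hjO : MapsTo j O (Metric.ball (0 : ℝ) ρ ×ˢ Metric.ball (0 : ℝ) ρ) := by
    rintro ⟨s, t⟩ ⟨hs, ht⟩
    refine ⟨?_, ht⟩
    show ρ * s ∈ _
    rw [mem_ball_zero_iff, norm_mul, Real.norm_of_nonneg hρ.le]
    exact mul_lt_of_lt_one_right hρ (abs_lt.mpr hs)
  have hOsub : Ioo (-1 : ℝ) 1 ×ˢ Icc 0 (ρ / 2) ⊆ O := by
    refine prod_mono le_rfl fun t ht => ?_
    rw [mem_ball_zero_iff, Real.norm_of_nonneg ht.1]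
    linarith [ht.2]
  refine ⟨ρ / 2, fun q => Ψ (j q), O, half_pos hρ, isOpen_Ioo.prod Metric.isOpen_ball, hOsub,
    hΨ.comp hj.contDiffOn fun q hq => (hball (hjO hq)).1.1, ?_, fun q hq => (hball (hjO hq)).2.1.1,
    fun s hs => ?_⟩
  · intro q hq r hr hqr
    have h1 := hinj (hball (hjO hq)).1.2 (hball (hjO hr)).1.2 hqr
    have h2 := congrArg Prod.fst h1
    have h3 := congrArg Prod.snd h1
    exact Prod.ext (mul_left_cancel₀ hρ.ne' h2) h3
  · have hmem : ∀ t ∈ Icc 0 (ρ / 2), _ := fun t ht => hball (hjO (hOsub (mk_mem_prod hs ht)))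
    have h0 : (0 : ℝ) ∈ Icc 0 (ρ / 2) := left_mem_Icc.mpr (half_pos hρ).le
    have hder : ∀ t ∈ Icc 0 (ρ / 2),
        HasDerivAt (fun t => Ψ (j (s, t))) (singularVelocity W (Ψ (j (s, t)))) t := fun t ht =>
      hθd _ (hmem t ht).1.1.1.2 t (hmem t ht).1.1.2
    have hne : ∀ t ∈ Icc 0 (ρ / 2), tripleProduct (W 0 (Ψ (j (s, t)))) (W 1 (Ψ (j (s, t)))) n ≠ 0 :=
      fun t ht => (hmem t ht).2.1.2
    refine ⟨hder, ?_, hne, fun t ht => (hmem t ht).2.2⟩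
    refine det_eq_zero_of_singularVelocity hW hder hne ?_
    have h1 : Ψ (j (s, 0)) = g (ρ * s) := hθ0 _ (hmem 0 h0).1.1.1.2
    simp only [h1]
    exact hgd _ (hmem 0 h0).1.1.1.1

end ArcFamily

/-! ### Vector fields and curves in a chart -/

section Charts

variable {M : Type*} [TopologicalSpace M] [ChartedSpace E3 M] [IsManifold (𝓡 3) ∞ M]

/-- A vector field is recovered from its coordinate expression. -/
lemma mfderiv_extChartAt_symm_inChart (V : SmoothVectorField M) (p : M) {y : E3}
    (hy : y ∈ (extChartAt (𝓡 3) p).target) :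
    mfderiv 𝓘(ℝ, E3) (𝓡 3) (extChartAt (𝓡 3) p).symm y (V.inChart p y) =
      V ((extChartAt (𝓡 3) p).symm y) := by
  have h := mfderivWithin_extChartAt_symm_comp_mfderiv_extChartAt (I := 𝓡 3) hy
  have h1 := congrArg (fun T => T (V ((extChartAt (𝓡 3) p).symm y))) h
  have hr : range (𝓡 3) = univ := ModelWithCorners.range_eq_univ _
  rw [hr, mfderivWithin_univ] at h1
  exact h1

lemma mdifferentiableAt_extChartAt_symm_of_mem {p : M} {y : E3}
    (hy : y ∈ (extChartAt (𝓡 3) p).target) :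
    MDifferentiableAt 𝓘(ℝ, E3) (𝓡 3) (extChartAt (𝓡 3) p).symm y := by
  have h := mdifferentiableWithinAt_extChartAt_symm (I := 𝓡 3) hy
  rwa [ModelWithCorners.range_eq_univ, mdifferentiableWithinAt_univ] at h

lemma bijective_mfderiv_extChartAt_symm {p : M} {y : E3}
    (hy : y ∈ (extChartAt (𝓡 3) p).target) :
    Function.Bijective (mfderiv 𝓘(ℝ, E3) (𝓡 3) (extChartAt (𝓡 3) p).symm y) := by
  have h := isInvertible_mfderivWithin_extChartAt_symm (I := 𝓡 3) hy
  rw [ModelWithCorners.range_eq_univ, mfderivWithin_univ] at h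
  exact h.bijective

lemma contDiffOn_inChart (V : SmoothVectorField M) (p : M) :
    ContDiffOn ℝ ∞ (V.inChart p) (extChartAt (𝓡 3) p).target := by
  have hV : ContMDiff (𝓡 3) (𝓡 3).tangent ∞
      (fun x => (⟨x, V x⟩ : TangentBundle (𝓡 3) M)) := V.contMDiff
  have hT : IsOpen (extChartAt (𝓡 3) p).target := isOpen_extChartAt_target p
  have h : ContMDiffOn 𝓘(ℝ, E3) 𝓘(ℝ, E3).tangent ∞
      (fun y => (⟨y, VectorField.mpullback 𝓘(ℝ, E3) (𝓡 3) (extChartAt (𝓡 3) p).symm (fun x => V x) y⟩ :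
        TangentBundle 𝓘(ℝ, E3) E3)) (extChartAt (𝓡 3) p).target := by
    intro y hy
    refine (ContMDiffAt.mpullback_vectorField_preimage (n := ∞) (hV.contMDiffAt) ?_ ?_ ?_).contMDiffWithinAt
    · exact (contMDiffOn_extChartAt_symm p).contMDiffAt (hT.mem_nhds hy)
    · have h := isInvertible_mfderivWithin_extChartAt_symm (I := 𝓡 3) hy
      rwa [ModelWithCorners.range_eq_univ, mfderivWithin_univ] at h
    · simp
  -- the coordinate expression is the pullback under the inverse of the chart
  rw [contMDiffOn_vectorSpace_iff_contDiffOn] at h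
  refine h.congr fun y hy => ?_
  have hb := bijective_mfderiv_extChartAt_symm (p := p) hy
  apply hb.1
  rw [mfderiv_extChartAt_symm_inChart V p hy, VectorField.mpullback_apply]
  have h := isInvertible_mfderivWithin_extChartAt_symm (I := 𝓡 3) hy
  rw [ModelWithCorners.range_eq_univ, mfderivWithin_univ] at h
  exact (h.self_apply_inverse _).symm

/-- Every germ of a smooth vector field on the chart image is the coordinate expression of a global
vector field: multiply by a bump function. -/
lemma exists_smoothVectorField_inChart_eventuallyEq [T2Space M] (p : M) {c : E3 → E3}
    (hc : ContDiff ℝ ∞ c) :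
    ∃ V : SmoothVectorField M, V.inChart p =ᶠ[𝓝 (extChartAt (𝓡 3) p p)] c := by
  let f : SmoothBumpFunction (𝓡 3) p := Classical.arbitrary _
  let s : (x : M) → TangentSpace (𝓡 3) x :=
    VectorField.mpullback (𝓡 3) 𝓘(ℝ, E3) (extChartAt (𝓡 3) p) c
  have hs : ContMDiffOn (𝓡 3) (𝓡 3).tangent ∞
      (fun x => (⟨x, s x⟩ : TangentBundle (𝓡 3) M)) (extChartAt (𝓡 3) p).source := by
    intro x hx
    refine (ContMDiffAt.mpullback_vectorField_preimage (n := ∞) ?_ ?_ ?_ ?_).contMDiffWithinAt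
    · exact (contMDiffAt_vectorSpace_iff_contDiffAt (V := c)).2 hc.contDiffAt
    · exact contMDiffAt_extChartAt' (by simpa using hx)
    · exact isInvertible_mfderiv_extChartAt hx
    · simp
  have h := ContMDiffOn.smul_section_of_tsupport (u := (extChartAt (𝓡 3) p).source) (s := s)
    f.contMDiff.contMDiffOn (isOpen_extChartAt_source p) f.tsupport_subset_extChartAt_source hs
  refine ⟨⟨_, h⟩, ?_⟩
  have hT : (extChartAt (𝓡 3) p).target ∈ 𝓝 (extChartAt (𝓡 3) p p) :=
    extChartAt_target_mem_nhds p
  have h1 : ∀ᶠ y in 𝓝 (extChartAt (𝓡 3) p p), f ((extChartAt (𝓡 3) p).symm y) = 1 := by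
    have := continuousAt_extChartAt_symm (I := 𝓡 3) p
    have h2 := f.eventuallyEq_one
    rw [ContinuousAt, extChartAt_to_inv] at this
    exact this.eventually h2
  filter_upwards [hT, h1] with y hy hy1
  have hx : (extChartAt (𝓡 3) p).symm y ∈ (extChartAt (𝓡 3) p).source :=
    (extChartAt (𝓡 3) p).map_target hy
  have h3 : (⟨_, h⟩ : SmoothVectorField M) ((extChartAt (𝓡 3) p).symm y) =
      s ((extChartAt (𝓡 3) p).symm y) := by
    change f ((extChartAt (𝓡 3) p).symm y) • s _ = _
    rw [hy1, one_smul]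
  rw [SmoothVectorField.inChart, h3]
  change _ = c y
  have h4 := (isInvertible_mfderiv_extChartAt (I := 𝓡 3) hx).self_apply_inverse
    (c (extChartAt (𝓡 3) p ((extChartAt (𝓡 3) p).symm y)))
  rw [(extChartAt (𝓡 3) p).right_inv hy] at h4
  refine Eq.trans ?_ h4
  have h5 : s ((extChartAt (𝓡 3) p).symm y) = (mfderiv (𝓡 3) 𝓘(ℝ, E3) (extChartAt (𝓡 3) p)
      ((extChartAt (𝓡 3) p).symm y)).inverse
        (c (extChartAt (𝓡 3) p ((extChartAt (𝓡 3) p).symm y))) := rfl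
  rw [h5, (extChartAt (𝓡 3) p).right_inv hy]

lemma eventually_iteratedFDeriv_inChart_sub_lt (V : SmoothVectorField M) (p : M) (k : ℕ)
    {K : Set E3} (hK : IsCompact K) (hKt : K ⊆ (extChartAt (𝓡 3) p).target) {ε : ℝ} (hε : 0 < ε) :
    ∀ᶠ V' in 𝓝 V, ∀ y ∈ K,
      ‖iteratedFDeriv ℝ k (V'.inChart p) y - iteratedFDeriv ℝ k (V.inChart p) y‖ < ε := by
  let S : Set (Set E3) := {K : Set E3 | IsCompact K ∧ K ⊆ (extChartAt (𝓡 3) p).target}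
  have hle : (SmoothVectorField.instTopologicalSpace : TopologicalSpace (SmoothVectorField M)) ≤
      TopologicalSpace.induced (fun V => UniformOnFun.ofFun S
        (iteratedFDeriv ℝ k (V.inChart p))) inferInstance :=
    (iInf_le _ p).trans (iInf_le _ k)
  have hc : Continuous fun V : SmoothVectorField M => UniformOnFun.ofFun S
        (iteratedFDeriv ℝ k (V.inChart p)) := continuous_iff_le_induced.2 hle
  have ht := (hc.tendsto V)
  rw [UniformOnFun.tendsto_iff_tendstoUniformlyOn] at ht
  have h := ht K ⟨hK, hKt⟩
  rw [Metric.tendstoUniformlyOn_iff] at h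
  filter_upwards [h ε hε] with V' hV' y hy
  have := hV' y hy
  rwa [dist_comm, dist_eq_norm] at this

lemma hasMFDerivAt_extChartAt_symm_comp {p : M} {z : ℝ → E3} {z' : E3} {t : ℝ}
    (hz : HasDerivAt z z' t) (ht : z t ∈ (extChartAt (𝓡 3) p).target) :
    HasMFDerivAt 𝓘(ℝ, ℝ) (𝓡 3) (fun s => (extChartAt (𝓡 3) p).symm (z s)) t
      ((1 : ℝ →L[ℝ] ℝ).smulRight
        (mfderiv 𝓘(ℝ, E3) (𝓡 3) (extChartAt (𝓡 3) p).symm (z t) z')) := by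
  have h1 := (mdifferentiableAt_extChartAt_symm_of_mem ht).hasMFDerivAt
  have h2 := h1.comp t hz.hasFDerivAt.hasMFDerivAt
  refine h2.congr_mfderiv (ContinuousLinearMap.ext fun r => ?_)
  let r' : ℝ := r
  exact ContinuousLinearMap.map_smul
    (mfderiv 𝓘(ℝ, E3) (𝓡 3) (extChartAt (𝓡 3) p).symm (z t)) r' z'

lemma hasDerivAt_extChartAt_comp {p : M} {x : ℝ → M} {t : ℝ} {w : TangentSpace (𝓡 3) (x t)}
    (hx : HasMFDerivAt 𝓘(ℝ, ℝ) (𝓡 3) x t ((1 : ℝ →L[ℝ] ℝ).smulRight w))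
    (ht : x t ∈ (extChartAt (𝓡 3) p).source) :
    HasDerivAt (fun s => extChartAt (𝓡 3) p (x s))
      (mfderiv (𝓡 3) 𝓘(ℝ, E3) (extChartAt (𝓡 3) p) (x t) w) t := by
  have h1 : HasMFDerivAt (𝓡 3) 𝓘(ℝ, E3) (extChartAt (𝓡 3) p) (x t) _ :=
    (mdifferentiableAt_extChartAt (by simpa using ht)).hasMFDerivAt
  let L : ℝ →L[ℝ] E3 :=
    (mfderiv (𝓡 3) 𝓘(ℝ, E3) (extChartAt (𝓡 3) p) (x t)).comp ((1 : ℝ →L[ℝ] ℝ).smulRight w)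
  have h2 : HasFDerivAt (fun s => extChartAt (𝓡 3) p (x s)) L t := (h1.comp t hx).hasFDerivAt
  have h3 := h2.hasDerivAt
  have h4 : (mfderiv (𝓡 3) 𝓘(ℝ, E3) (extChartAt (𝓡 3) p) (x t)) ((1 : ℝ) • w) =
      mfderiv (𝓡 3) 𝓘(ℝ, E3) (extChartAt (𝓡 3) p) (x t) w := by rw [one_smul]
  rw [← h4]
  exact h3

lemma contDiffOn_extChartAt_comp_symm (p q : M) :
    ContDiffOn ℝ ∞ (fun e => extChartAt (𝓡 3) q ((extChartAt (𝓡 3) p).symm e))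
      ((extChartAt (𝓡 3) p).target ∩
        (extChartAt (𝓡 3) p).symm ⁻¹' (extChartAt (𝓡 3) q).source) := by
  have h1 : ContMDiffOn (𝓡 3) 𝓘(ℝ, E3) ∞ (extChartAt (𝓡 3) q) (extChartAt (𝓡 3) q).source := by
    rw [extChartAt_source]
    exact contMDiffOn_extChartAt
  have h2 : ContMDiffOn 𝓘(ℝ, E3) (𝓡 3) ∞ (extChartAt (𝓡 3) p).symm _ :=
    (contMDiffOn_extChartAt_symm p).mono (inter_subset_left (t :=
        (extChartAt (𝓡 3) p).symm ⁻¹' (extChartAt (𝓡 3) q).source))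
  exact (h1.comp h2 inter_subset_right).contDiffOn

end Charts

/-! ### Trajectories in a chart -/

section ChartTrajectories

/-- The fundamental theorem of calculus for absolutely continuous curves in a normed space whose
derivative is essentially bounded. -/
lemma eq_add_integral_of_absolutelyContinuous {E : Type*} [NormedAddCommGroup E] [NormedSpace ℝ E]
    [CompleteSpace E] {c d : ℝ} (hcd : c ≤ d) {f g : ℝ → E}
    (hf : AbsolutelyContinuousOnInterval f c d) (hg : IntegrableOn g (Icc c d)) {m : NNReal}
    (hm : ∀ᵐ s ∂(volume.restrict (Icc c d)), ‖g s‖ ≤ m)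
    (hd : ∀ᵐ s ∂(volume.restrict (Icc c d)), HasDerivAt f (g s) s) :
    ∀ t ∈ Icc c d, f t = f c + ∫ s in c..t, g s := by
  have hc : c ∈ Icc c d := left_mem_Icc.mpr hcd
  have hP : ∀ t ∈ Icc c d, (∫ s in c..t, g s) = (∫ s in c..c, g s) + ∫ s in c..t, g s := by simp
  have h1 : AbsolutelyContinuousOnInterval (fun t => ∫ s in c..t, g s) c d := by
    refine LipschitzOnWith.absolutelyContinuousOnInterval (K := m) ?_
    rw [uIcc_of_le hcd]
    exact lipschitzOnWith_of_integral hg hm hc hP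
  have h2 := ae_hasDerivAt_of_integral hg hc hP
  have h3 := (hf.sub h1).const_of_ae_hasDerivAt_zero (by
    rw [uIcc_of_le hcd, ← ae_restrict_iff' measurableSet_Icc]
    filter_upwards [hd, h2] with s hs hs'
    simpa using hs.sub hs')
  obtain ⟨C, hC⟩ := h3
  intro t ht
  rw [uIcc_of_le hcd] at hC
  have h4 := hC t ht
  have h5 := hC c hc
  simp only [Pi.sub_apply, intervalIntegral.integral_same, sub_zero] at h4 h5
  rw [h5, ← h4, sub_add_cancel]

variable {M : Type*} [TopologicalSpace M] [ChartedSpace E3 M] [IsManifold (𝓡 3) ∞ M]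
  {X : Fin 3 → SmoothVectorField M} {p : M} {W : Fin 3 → E3 → E3} {B : Set E3} {a b : ℝ}

/-! In the remaining part `B` is a region of the chart image in which the fields `W i` on `ℝ³` are the
coordinate expressions of the fields `X i` on the manifold. -/

lemma mfderiv_extChartAt_symm_sum (hBt : B ⊆ (extChartAt (𝓡 3) p).target)
    (hWX : ∀ i, EqOn (W i) ((X i).inChart p) B) {y : E3} (hy : y ∈ B) (v : E3) :
    mfderiv 𝓘(ℝ, E3) (𝓡 3) (extChartAt (𝓡 3) p).symm y (∑ i, v i • W i y) =
      ∑ i, v i • X i ((extChartAt (𝓡 3) p).symm y) := by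
  have h := fun i => mfderiv_extChartAt_symm_inChart (X i) p (hBt hy)
  have h1 := map_sum (mfderiv 𝓘(ℝ, E3) (𝓡 3) (extChartAt (𝓡 3) p).symm y)
    (fun i => v i • W i y) Finset.univ
  refine h1.trans (Finset.sum_congr rfl fun i _ => ?_)
  have h2 := ContinuousLinearMap.map_smul
    (mfderiv 𝓘(ℝ, E3) (𝓡 3) (extChartAt (𝓡 3) p).symm y) (v i) (W i y)
  refine h2.trans ?_
  rw [hWX i hy]
  exact congrArg (v i • ·) (h i)

lemma mfderiv_extChartAt_sum (hWX : ∀ i, EqOn (W i) ((X i).inChart p) B) {x : M}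
    (hx : x ∈ (extChartAt (𝓡 3) p).source) (hxB : extChartAt (𝓡 3) p x ∈ B) (v : E3) :
    mfderiv (𝓡 3) 𝓘(ℝ, E3) (extChartAt (𝓡 3) p) x (∑ i, v i • X i x) =
      ∑ i, v i • W i (extChartAt (𝓡 3) p x) := by
  have h1 := map_sum (mfderiv (𝓡 3) 𝓘(ℝ, E3) (extChartAt (𝓡 3) p) x)
    (fun i => v i • X i x) Finset.univ
  refine h1.trans (Finset.sum_congr rfl fun i _ => ?_)
  have h2 := ContinuousLinearMap.map_smul
    (mfderiv (𝓡 3) 𝓘(ℝ, E3) (extChartAt (𝓡 3) p) x) (v i) (X i x)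
  refine h2.trans ?_
  rw [hWX i hxB, SmoothVectorField.inChart, (extChartAt (𝓡 3) p).left_inv hx]
  rfl

/-- A trajectory of the coordinate system gives a trajectory on the manifold. -/
lemma isTrajectory_extChartAt_symm (hB : IsOpen B) (hBt : B ⊆ (extChartAt (𝓡 3) p).target)
    (hW : ∀ i, ContDiff ℝ ∞ (W i)) (hWX : ∀ i, EqOn (W i) ((X i).inChart p) B) (hab : a ≤ b)
    {z : E3} {v : LInftyControl a b} {y : C(Icc a b, E3)}
    (hy : IsIntegralTrajectory hab ⟨a, left_mem_Icc.mpr hab⟩ (controlField W hW) z v y)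
    (hyB : ∀ t, y t ∈ B) :
    IsTrajectory X a b v fun t => (extChartAt (𝓡 3) p).symm (IccExtend hab y t) := by
  have hfB : ∀ t, IccExtend hab y t ∈ B := fun t => hyB _
  have ha : a ∈ Icc a b := left_mem_Icc.mpr hab
  have hya : IccExtend hab y a = z := by
    rw [IccExtend_of_mem hab _ ha, hy, intervalIntegral.integral_same, add_zero]
  have heq : ∀ t ∈ Icc a b, IccExtend hab y t = IccExtend hab y a +
      ∫ s in a..t, controlIntegrand hab v ((controlField W hW).comp y) s := fun t ht => by
    rw [hya, IccExtend_of_mem hab _ ht, hy]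
  have hcont : Continuous (IccExtend hab y) := y.continuous.Icc_extend'
  have hsymm : ContinuousOn (extChartAt (𝓡 3) p).symm B :=
    (continuousOn_extChartAt_symm p).mono hBt
  refine ⟨⟨(hsymm.comp_continuous hcont hfB).continuousOn, fun q c d hac hcd hdb hq => ?_⟩, ?_⟩
  · obtain ⟨m, hm⟩ : ∃ m, LipschitzOnWith m (IccExtend hab y) (Icc a b) := by
      refine ⟨‖(controlField W hW).comp y‖₊ * ‖v‖₊, lipschitzOnWith_of_integral
        (integrableOn_controlIntegrand hab v _) ?_ ha heq⟩
      filter_upwards [ae_norm_le_norm_Lp v] with s hs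
      exact ((controlField W hW).comp y _).le_of_opNorm_le_of_le
        (((controlField W hW).comp y).norm_coe_le_norm _) hs
    let S := B ∩ (extChartAt (𝓡 3) p).symm ⁻¹' (extChartAt (𝓡 3) q).source
    have hS : IsOpen S := hsymm.isOpen_inter_preimage hB (isOpen_extChartAt_source q)
    have hψ : ContDiffOn ℝ 1 (fun e => extChartAt (𝓡 3) q ((extChartAt (𝓡 3) p).symm e)) S :=
      ((contDiffOn_extChartAt_comp_symm p q).mono (inter_subset_inter_left _ hBt)).of_le (by simp)
    exact absolutelyContinuousOnInterval_comp hcd (f := IccExtend hab y)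
      (ψ := fun e => extChartAt (𝓡 3) q ((extChartAt (𝓡 3) p).symm e))
      (hm.mono (Icc_subset_Icc hac hdb)) hS hψ fun t ht => ⟨hfB t, hq (mem_image_of_mem _ ht)⟩
  · filter_upwards [ae_hasDerivAt_of_integral (integrableOn_controlIntegrand hab v _) ha heq]
      with t ht
    have h1 := hasMFDerivAt_extChartAt_symm_comp ht (hBt (hfB t))
    have h2 : controlIntegrand hab v ((controlField W hW).comp y) t =
        ∑ i, v t i • W i (IccExtend hab y t) := controlField_apply hW _ _
    rw [h2] at h1
    exact h1.congr_mfderiv (congrArg (ContinuousLinearMap.smulRight (1 : ℝ →L[ℝ] ℝ))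
      (mfderiv_extChartAt_symm_sum hBt hWX (hfB t) (v t)))

/-- A trajectory on the manifold is, inside the region, a trajectory of the coordinate system in
integral form. -/
lemma IsTrajectory.integral_equation (hW : ∀ i, ContDiff ℝ ∞ (W i))
    (hWX : ∀ i, EqOn (W i) ((X i).inChart p) B)
    {v : LInftyControl a b} {x : ℝ → M} (hx : IsTrajectory X a b v x) {c d : ℝ}
    (hac : a ≤ c) (hcd : c ≤ d) (hdb : d ≤ b)
    (hxs : ∀ t ∈ Icc c d, x t ∈ (extChartAt (𝓡 3) p).source)
    (hxB : ∀ t ∈ Icc c d, extChartAt (𝓡 3) p (x t) ∈ B) :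
    ContinuousOn (fun t => extChartAt (𝓡 3) p (x t)) (Icc c d) ∧
    ∀ t ∈ Icc c d, extChartAt (𝓡 3) p (x t) = extChartAt (𝓡 3) p (x c) +
      ∫ s in c..t, controlField W hW (extChartAt (𝓡 3) p (x s)) (v s) := by
  have hsub : Icc c d ⊆ Icc a b := Icc_subset_Icc hac hdb
  have hac := hx.1.2 p c d hac hcd hdb (image_subset_iff.mpr hxs)
  have hcont : ContinuousOn (fun t => extChartAt (𝓡 3) p (x t)) (Icc c d) := by
    have := hac.continuousOn; rwa [uIcc_of_le hcd] at this
  have hV : ContinuousOn (fun t => controlField W hW (extChartAt (𝓡 3) p (x t))) (Icc c d) :=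
    (controlField W hW).continuous.comp_continuousOn hcont
  obtain ⟨C, hC⟩ := isCompact_Icc.exists_bound_of_continuousOn hV
  have hvm : AEStronglyMeasurable v (volume.restrict (Icc c d)) :=
    (Lp.aestronglyMeasurable v).mono_measure (Measure.restrict_mono_set _ hsub)
  have hbound : ∀ᵐ s ∂(volume.restrict (Icc c d)),
      ‖controlField W hW (extChartAt (𝓡 3) p (x s)) (v s)‖ ≤ (C * ‖v‖).toNNReal := by
    filter_upwards [ae_restrict_of_ae_restrict_of_subset hsub (ae_norm_le_norm_Lp v),
      ae_restrict_mem measurableSet_Icc] with s hs hs'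
    exact ((controlField W hW _).le_of_opNorm_le_of_le (hC s hs') hs).trans
      (Real.le_coe_toNNReal _)
  refine ⟨hcont, eq_add_integral_of_absolutelyContinuous hcd hac ?_ hbound ?_⟩
  · refine Integrable.of_bound ?_ _ hbound
    exact (ContinuousLinearMap.id ℝ (E3 →L[ℝ] E3)).aestronglyMeasurable_comp₂
      (hV.aestronglyMeasurable measurableSet_Icc) hvm
  · filter_upwards [ae_restrict_of_ae_restrict_of_subset hsub hx.2,
      ae_restrict_mem measurableSet_Icc] with s hs hs'
    have h1 := hasDerivAt_extChartAt_comp hs (hxs s hs')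
    rw [mfderiv_extChartAt_sum hWX (hxs s hs') (hxB s hs')] at h1
    rw [controlField_apply]
    exact h1

lemma exists_lipschitzWith_controlField (hW : ∀ i, ContDiff ℝ ∞ (W i))
    (hc : ∀ i, HasCompactSupport (W i)) : ∃ K, LipschitzWith K (controlField W hW) := by
  refine ContDiff.lipschitzWith_of_hasCompactSupport (𝕂 := ℝ) ?_ (contDiff_controlField hW)
    (by simp)
  refine HasCompactSupport.intro (isCompact_iUnion hc) fun y hy => ?_
  ext1 v
  rw [controlField_apply]
  refine Finset.sum_eq_zero fun i _ => ?_
  rw [image_eq_zero_of_notMem_tsupport fun h => hy (mem_iUnion_of_mem i h), smul_zero]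

/-- A trajectory of the system on the manifold that starts inside the chart domain follows the
trajectory of the coordinate system, as long as the latter stays in the region where the two systems
agree. -/
lemma IsTrajectory.eq_extChartAt_symm [T2Space M] (hB : IsOpen B)
    (hBt : B ⊆ (extChartAt (𝓡 3) p).target)
    (hW : ∀ i, ContDiff ℝ ∞ (W i)) (hc : ∀ i, HasCompactSupport (W i))
    (hWX : ∀ i, EqOn (W i) ((X i).inChart p) B) (hab : a ≤ b)
    {z : E3} {v : LInftyControl a b} {y : C(Icc a b, E3)}
    (hy : IsIntegralTrajectory hab ⟨a, left_mem_Icc.mpr hab⟩ (controlField W hW) z v y)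
    (hyB : ∀ t, y t ∈ B) {x : ℝ → M} (hx : IsTrajectory X a b v x)
    (hxa : x a = (extChartAt (𝓡 3) p).symm z) :
    ∀ t ∈ Icc a b, x t = (extChartAt (𝓡 3) p).symm (IccExtend hab y t) := by
  have hfB : ∀ t, IccExtend hab y t ∈ B := fun t => hyB _
  have ha : a ∈ Icc a b := left_mem_Icc.mpr hab
  have hf : Continuous (IccExtend hab y) := y.continuous.Icc_extend'
  have hsymm : ContinuousOn (extChartAt (𝓡 3) p).symm B :=
    (continuousOn_extChartAt_symm p).mono hBt
  have hg : Continuous fun t => (extChartAt (𝓡 3) p).symm (IccExtend hab y t) :=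
    hsymm.comp_continuous hf hfB
  have hyeq : ∀ t ∈ Icc a b, IccExtend hab y t =
      z + ∫ s in a..t, controlIntegrand hab v ((controlField W hW).comp y) s := fun t ht => by
    rw [IccExtend_of_mem hab _ ht, hy]
  obtain ⟨K, hK⟩ := exists_lipschitzWith_controlField hW hc
  let S : Set ℝ := {t | x t = (extChartAt (𝓡 3) p).symm (IccExtend hab y t)}
  refine IsClosed.Icc_subset_of_forall_mem_nhdsWithin (s := S) ?_ ?_ ?_
  · have h1 : ContinuousOn (fun t => (x t, (extChartAt (𝓡 3) p).symm (IccExtend hab y t)))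
        (Icc a b) := hx.1.1.prodMk hg.continuousOn
    have h2 := h1.preimage_isClosed_of_isClosed isClosed_Icc isClosed_diagonal
    rwa [inter_comm] at h2
  · show x a = _
    rw [hxa, hyeq a ha, intervalIntegral.integral_same, add_zero]
  · rintro c ⟨hcS, hc1⟩
    have hcS : x c = (extChartAt (𝓡 3) p).symm (IccExtend hab y c) := hcS
    have hcI : c ∈ Icc a b := Ico_subset_Icc_self hc1
    -- on a short interval to the right of `c` the trajectory remains in the region
    have hxc : x c ∈ (extChartAt (𝓡 3) p).source := by
      rw [hcS]; exact (extChartAt (𝓡 3) p).map_target (hBt (hfB c))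
    have hxcB : extChartAt (𝓡 3) p (x c) ∈ B := by
      rw [hcS, (extChartAt (𝓡 3) p).right_inv (hBt (hfB c))]; exact hfB c
    have hO : (extChartAt (𝓡 3) p).source ∩ extChartAt (𝓡 3) p ⁻¹' B ∈ 𝓝 (x c) :=
      ((continuousOn_extChartAt p).isOpen_inter_preimage (isOpen_extChartAt_source p) hB).mem_nhds
        ⟨hxc, hxcB⟩
    have h1 : x ⁻¹' ((extChartAt (𝓡 3) p).source ∩ extChartAt (𝓡 3) p ⁻¹' B) ∈ 𝓝[≥] c := by
      have h2 := (hx.1.1 c hcI).preimage_mem_nhdsWithin hO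
      rw [← nhdsWithin_Icc_eq_nhdsGE hc1.2]
      exact nhdsWithin_mono c (Icc_subset_Icc_left hcI.1) h2
    obtain ⟨d, hd, hdO⟩ := (mem_nhdsGE_iff_exists_Icc_subset).mp h1
    have hcd' : c < min d b := lt_min hd hc1.2
    set e := min d b with he
    have heb : e ≤ b := min_le_right _ _
    have hsub : Icc c e ⊆ Icc a b := Icc_subset_Icc hcI.1 heb
    have hO' : ∀ t ∈ Icc c e, x t ∈ (extChartAt (𝓡 3) p).source ∩ extChartAt (𝓡 3) p ⁻¹' B :=
      fun t ht => hdO ⟨ht.1, ht.2.trans (min_le_left _ _)⟩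
    obtain ⟨hcont, hxeq⟩ := hx.integral_equation hW hWX hcI.1 hcd'.le heb
      (fun t ht => (hO' t ht).1) (fun t ht => (hO' t ht).2)
    have hyeq' : ∀ t ∈ Icc c e, IccExtend hab y t = IccExtend hab y c +
        ∫ s in c..t, controlField W hW (IccExtend hab y s) (v s) := by
      intro t ht
      have h3 := intervalIntegral.integral_add_adjacent_intervals
        (intervalIntegrable_controlIntegrand hab v ((controlField W hW).comp y) ha hcI)
        (intervalIntegrable_controlIntegrand hab v ((controlField W hW).comp y) hcI (hsub ht))
      rw [hyeq t (hsub ht), hyeq c hcI, ← h3, add_assoc]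
      rfl
    have hEq := eqOn_of_integral_equation hcd'.le hK
      ((Lp.aestronglyMeasurable v).mono_measure (Measure.restrict_mono_set _ hsub))
      (ae_restrict_of_ae_restrict_of_subset hsub (ae_norm_le_norm_Lp v)) hcont hf.continuousOn
      hxeq hyeq' (by rw [hcS, (extChartAt (𝓡 3) p).right_inv (hBt (hfB c))])
    filter_upwards [Ioc_mem_nhdsGT hcd'] with t ht
    have ht' : t ∈ Icc c e := ⟨ht.1.le, ht.2⟩
    show x t = _
    rw [← hEq ht', (extChartAt (𝓡 3) p).left_inv (hO' t ht').1]

end ChartTrajectories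

/-! ### Singularity of a control in a chart -/

section SingularControls

variable {M : Type*} [TopologicalSpace M] [ChartedSpace E3 M] [IsManifold (𝓡 3) ∞ M] [T2Space M]
  {X : Fin 3 → SmoothVectorField M} {p : M} {W : Fin 3 → E3 → E3} {B : Set E3} {a b : ℝ}

/-- For a trajectory that stays in a region of a chart, singularity of the control on the manifold
is the same as degeneracy of the linearized endpoint mapping of the coordinate system. -/
lemma exists_isLinearization_isSingularControl_iff (hB : IsOpen B)
    (hBt : B ⊆ (extChartAt (𝓡 3) p).target)
    (hW : ∀ i, ContDiff ℝ ∞ (W i)) (hc : ∀ i, HasCompactSupport (W i))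
    (hWX : ∀ i, EqOn (W i) ((X i).inChart p) B) (hab : a ≤ b)
    {z : E3} {u : LInftyControl a b} {y : C(Icc a b, E3)}
    (hy : IsIntegralTrajectory hab ⟨a, left_mem_Icc.mpr hab⟩ (controlField W hW) z u y)
    (hyB : ∀ t, y t ∈ B) :
    ∃ D : LInftyControl a b →L[ℝ] C(Icc a b, E3), IsLinearization hW hab u y D ∧
      (IsSingularControl X a b ((extChartAt (𝓡 3) p).symm z) u ↔
        ¬ Function.Surjective fun v => D v ⟨b, right_mem_Icc.mpr hab⟩) := by
  have ha : a ∈ Icc a b := left_mem_Icc.mpr hab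
  have hb : b ∈ Icc a b := right_mem_Icc.mpr hab
  obtain ⟨N, Y, hN, huN, hY, hYu, hYsol⟩ := exists_contDiffOn_trajectory hab ⟨a, ha⟩
    (controlField W hW) (contDiff_controlField hW) hy
  have hι : Continuous fun v : LInftyControl a b => (z, v) := by fun_prop
  have hNu : ∀ᶠ v in 𝓝 u, (z, v) ∈ N := hι.continuousAt.eventually (hN.mem_nhds huN)
  have hYd : DifferentiableAt ℝ (fun v : LInftyControl a b => Y (z, v)) u := by
    have h1 : DifferentiableAt ℝ Y (z, u) :=
      (hY.contDiffAt (hN.mem_nhds huN)).differentiableAt (by simp)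
    exact h1.comp u ((differentiableAt_const z).prodMk differentiableAt_id)
  set Z : LInftyControl a b → C(Icc a b, E3) := fun v => Y (z, v)
  have hZu : Z u = y := hYu
  have hsol : ∀ᶠ v in 𝓝 u,
      IsIntegralTrajectory hab ⟨a, ha⟩ (controlField W hW) z v (Z v) :=
    hNu.mono fun v hv => hYsol _ hv
  let D := fderiv ℝ Z u
  have hZD : HasFDerivAt Z D u := hYd.hasFDerivAt
  have hlin : IsLinearization hW hab u y D := fun v => by
    have := linearized_of_hasFDerivAt hab ⟨a, ha⟩ (controlField W hW) (controlFieldDeriv W hW)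
      (hasFDerivAt_controlField hW) hZD hsol v
    rwa [hZu] at this
  refine ⟨D, hlin, ?_⟩
  have hZB : ∀ᶠ v in 𝓝 u, ∀ t, Z v t ∈ B := by
    have h1 := ContinuousMap.isOpen_setOfPred_mapsTo (X := Icc a b) (Y := E3) isCompact_univ hB
    have h2 := hYd.continuousAt.eventually (h1.mem_nhds (fun t _ => by rw [hZu]; exact hyB t))
    exact h2.mono fun v hv t => hv (mem_univ t)
  let C : Set (LInftyControl a b) := {v |
    IsIntegralTrajectory hab ⟨a, ha⟩ (controlField W hW) z v (Z v) ∧ ∀ t, Z v t ∈ B}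
  have hC : C ∈ 𝓝 u := hsol.and hZB
  let F : LInftyControl a b → M := fun v => (extChartAt (𝓡 3) p).symm (Z v ⟨b, hb⟩)
  have hFu : IsEndpointMapOn X a b ((extChartAt (𝓡 3) p).symm z) C F := by
    intro v hv
    refine ⟨⟨_, isTrajectory_extChartAt_symm hB hBt hW hWX hab hv.1 hv.2, ?_⟩, fun x hx hxa => ?_⟩
    · rw [IccExtend_of_mem hab _ ha, hv.1, intervalIntegral.integral_same, add_zero]
    · rw [hx.eq_extChartAt_symm hB hBt hW hc hWX hab hv.1 hv.2 hxa b hb, IccExtend_of_mem hab _ hb]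
  let ev : C(Icc a b, E3) →L[ℝ] E3 := ContinuousMap.evalCLM ℝ ⟨b, hb⟩
  have hbt : y ⟨b, hb⟩ ∈ (extChartAt (𝓡 3) p).target := hBt (hyB _)
  let T : E3 →L[ℝ] TangentSpace (𝓡 3) ((extChartAt (𝓡 3) p).symm (y ⟨b, hb⟩)) :=
    mfderiv 𝓘(ℝ, E3) (𝓡 3) (extChartAt (𝓡 3) p).symm (y ⟨b, hb⟩)
  have hT : Function.Bijective T := bijective_mfderiv_extChartAt_symm hbt
  have hFD : HasMFDerivAt 𝓘(ℝ, LInftyControl a b) (𝓡 3) F u (T.comp (ev.comp D)) := by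
    have h1 : HasMFDerivAt 𝓘(ℝ, E3) (𝓡 3) (extChartAt (𝓡 3) p).symm (ev (Z u)) T := by
      rw [hZu]
      exact (mdifferentiableAt_extChartAt_symm_of_mem hbt).hasMFDerivAt
    exact h1.comp u (ev.hasFDerivAt.comp u hZD).hasMFDerivAt
  have hsurj : Function.Surjective (T.comp (ev.comp D)) ↔
      Function.Surjective fun v => D v ⟨b, hb⟩ :=
    Function.Surjective.of_comp_iff' hT (ev.comp D)
  constructor
  · rintro ⟨C', hC', F', hF', D', hD', hns⟩
    -- two endpoint mappings agree near `u`, because trajectories exist and end where both prescribe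
    have hFF : F' =ᶠ[𝓝 u] F := by
      filter_upwards [hC, hC'] with v hv hv'
      obtain ⟨x, hx, hxa⟩ := (hFu v hv).1
      rw [(hFu v hv).2 x hx hxa, (hF' v hv').2 x hx hxa]
    have h1 := hasMFDerivAt_unique (hFD.congr_of_eventuallyEq hFF) hD'
    rw [← hsurj]
    intro h2
    apply hns
    rw [← h1]
    exact h2
  · intro h
    exact ⟨C, hC, F, hFu, _, hFD, fun h' => h (hsurj.mp h')⟩

end SingularControls

/-! ### Singular lifts of arcs -/

section SingularLifts

variable {M : Type*} [TopologicalSpace M] [ChartedSpace E3 M] [IsManifold (𝓡 3) ∞ M]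
  {X : Fin 3 → SmoothVectorField M} {p : M} {W : Fin 3 → E3 → E3} {B : Set E3} {a b : ℝ}

/-- A singular arc is the trajectory of the singular feedback control. -/
lemma IsSingularArc.isIntegralTrajectory (hW : ∀ i, ContDiff ℝ ∞ (W i)) (hab : a ≤ b) {n : E3}
    {γ : ℝ → E3} (hγ : IsSingularArc W n a b γ) {y : C(Icc a b, E3)} (hy : ∀ t, y t = γ t)
    {u : LInftyControl a b}
    (hu : ∀ᵐ t ∂(volume.restrict (Icc a b)), u t = singularControl W (γ t)) :
    IsIntegralTrajectory hab ⟨a, left_mem_Icc.mpr hab⟩ (controlField W hW) (γ a) u y := by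
  intro t
  have ha : a ∈ Icc a b := left_mem_Icc.mpr hab
  have hsub : uIcc a t ⊆ Icc a b := uIcc_subset_Icc ha t.2
  have h1 := intervalIntegral.integral_eq_sub_of_hasDerivAt
    (fun s hs => hγ.hasDerivAt s (hsub hs))
    (((contDiff_singularVelocity hW).continuous.comp_continuousOn
      (hγ.continuousOn.mono hsub)).intervalIntegrable)
  have h2 : ∫ s in a..t, controlIntegrand hab u ((controlField W hW).comp y) s =
      ∫ s in a..t, singularVelocity W (γ s) := by
    refine intervalIntegral.integral_congr_ae ?_
    filter_upwards [(ae_restrict_iff' measurableSet_Icc).mp hu] with s hs hs'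
    have hsI : s ∈ Icc a b := hsub (uIoc_subset_uIcc hs')
    have h3 : y (projIcc a b hab s) = γ s := by rw [hy, projIcc_of_mem hab hsI]
    show controlField W hW (y (projIcc a b hab s)) (u s) = _
    rw [h3, controlField_apply, hs hsI]
    rfl
  rw [hy, h2]
  show _ = γ a + ∫ s in a..t, singularVelocity W (γ s)
  rw [h1, add_sub_cancel]

lemma exists_LInftyControl_ae_eq {f : ℝ → E3} (hf : ContinuousOn f (Icc a b)) :
    ∃ u : LInftyControl a b, ∀ᵐ t ∂(volume.restrict (Icc a b)), u t = f t := by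
  obtain ⟨C, hC⟩ := isCompact_Icc.exists_bound_of_continuousOn hf
  have h : MemLp f ∞ (volume.restrict (Icc a b)) := by
    refine memLp_top_of_bound (hf.aestronglyMeasurable measurableSet_Icc) C ?_
    filter_upwards [ae_restrict_mem measurableSet_Icc] with t ht using hC t ht
  exact ⟨h.toLp f, h.coeFn_toLp⟩

/-- A singular arc in the chart, read on the manifold, is generated by exactly one singular control,
namely the singular feedback control. The curve is extended by its end values outside `[a, b]`. -/
theorem IsSingularArc.existsUnique_isSingularLift [T2Space M] (hB : IsOpen B)
    (hBt : B ⊆ (extChartAt (𝓡 3) p).target)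
    (hW : ∀ i, ContDiff ℝ ∞ (W i)) (hc : ∀ i, HasCompactSupport (W i))
    (hWX : ∀ i, EqOn (W i) ((X i).inChart p) B) (hab : a < b) {n : E3} {γ : ℝ → E3}
    (hγ : IsSingularArc W n a b γ) (hγB : ∀ t ∈ Icc a b, γ t ∈ B) {Ω : Set E3}
    (hΩ : ∀ t ∈ Icc a b, singularControl W (γ t) ∈ Ω) {y : C(Icc a b, E3)}
    (hy : ∀ t, y t = γ t) :
    ∃! u : LInftyControl a b,
      IsSingularLift Ω X a b (fun t => (extChartAt (𝓡 3) p).symm (IccExtend hab.le y t)) u := by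
  have ha : a ∈ Icc a b := left_mem_Icc.mpr hab.le
  have hyB : ∀ t, y t ∈ B := fun t => by rw [hy]; exact hγB t t.2
  have hya : IccExtend hab.le y a = γ a := by rw [IccExtend_of_mem hab.le _ ha, hy]
  obtain ⟨u, hu⟩ := exists_LInftyControl_ae_eq
    ((contDiff_singularControl hW).continuous.comp_continuousOn hγ.continuousOn)
  have hut := hγ.isIntegralTrajectory hW hab.le hy hu
  refine ⟨u, ⟨?_, ?_, ?_⟩, ?_⟩
  · filter_upwards [hu, ae_restrict_mem measurableSet_Icc] with t ht ht'
    rw [ht]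
    exact hΩ t ht'
  · exact isTrajectory_extChartAt_symm hB hBt hW hWX hab.le hut hyB
  · obtain ⟨D, hD, hiff⟩ :=
      exists_isLinearization_isSingularControl_iff hB hBt hW hc hWX hab.le hut hyB
    show IsSingularControl X a b ((extChartAt (𝓡 3) p).symm (IccExtend hab.le y a)) u
    rw [hya, hiff]
    exact hγ.not_surjective hab hy hu hD
  · rintro v ⟨-, hvx, hvs⟩
    have hvs' : IsSingularControl X a b
      ((extChartAt (𝓡 3) p).symm (IccExtend hab.le y a)) v := hvs
    rw [hya] at hvs'
    have hinv : ∀ t, extChartAt (𝓡 3) p ((extChartAt (𝓡 3) p).symm (IccExtend hab.le y t)) =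
        IccExtend hab.le y t := fun t => (extChartAt (𝓡 3) p).right_inv (hBt (hyB _))
    have hsrc : ∀ t, (extChartAt (𝓡 3) p).symm (IccExtend hab.le y t) ∈
        (extChartAt (𝓡 3) p).source := fun t => (extChartAt (𝓡 3) p).map_target (hBt (hyB _))
    have hvt : IsIntegralTrajectory hab.le ⟨a, ha⟩ (controlField W hW) (γ a) v y := by
      intro t
      have h := (hvx.integral_equation hW hWX le_rfl hab.le le_rfl (fun t _ => hsrc t)
        (fun t _ => by rw [hinv]; exact hyB _)).2 t t.2
      simp only [hinv] at h
      rw [hya, IccExtend_of_mem hab.le _ t.2] at h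
      exact h
    obtain ⟨D, hD, hiff⟩ :=
      exists_isLinearization_isSingularControl_iff hB hBt hW hc hWX hab.le hvt hyB
    have hvel : ∀ᵐ t ∂(volume.restrict (Icc a b)),
        ∑ i, v t i • W i (γ t) = singularVelocity W (γ t) := by
      filter_upwards [hvx.2, ae_mem_Ioo_of_Icc a b] with t ht htI
      have h1 := hasDerivAt_extChartAt_comp ht (hsrc t)
      rw [mfderiv_extChartAt_sum hWX (hsrc t) (by rw [hinv]; exact hyB _)] at h1
      simp only [hinv] at h1
      have htI' := Ioo_subset_Icc_self htI
      have h2 : IccExtend hab.le y =ᶠ[𝓝 t] γ := by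
        filter_upwards [Icc_mem_nhds htI.1 htI.2] with s hs
        rw [IccExtend_of_mem hab.le _ hs, hy]
      rw [h2.eq_of_nhds] at h1
      exact (h1.congr_of_eventuallyEq h2.symm).unique (hγ.hasDerivAt t htI')
    have hve := hγ.ae_eq_singularControl hab hy hvel hD (hiff.mp hvs')
    refine Lp.ext ?_
    filter_upwards [hu, hve] with t h1 h2
    rw [h1, h2]
    rfl

lemma mem_dependenceLocus_of_tripleProduct_eq_zero (hBt : B ⊆ (extChartAt (𝓡 3) p).target)
    (hWX : ∀ i, EqOn (W i) ((X i).inChart p) B) {y n : E3} (hy : y ∈ B)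
    (hn : tripleProduct (W 0 y) (W 1 y) n ≠ 0)
    (h0 : tripleProduct (W 0 y) (W 1 y) (W 2 y) = 0) :
    (extChartAt (𝓡 3) p).symm y ∈ dependenceLocus X := by
  have h := not_linearIndependent_of_tripleProduct_eq_zero (w := fun i => W i y) hn h0
  intro hli
  apply h
  have hbij := bijective_mfderiv_extChartAt_symm (hBt hy)
  rw [Fintype.linearIndependent_iff] at hli ⊢
  intro g hg
  refine hli g ?_
  have h1 := mfderiv_extChartAt_symm_sum hBt hWX hy (WithLp.toLp 2 g)
  refine h1.symm.trans ?_
  refine (congrArg (mfderiv 𝓘(ℝ, E3) (𝓡 3) (extChartAt (𝓡 3) p).symm y) hg).trans ?_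
  exact map_zero _

end SingularLifts

/-! ### Embedded families of arcs -/

section ArcFamilies

lemma IsEmbeddedArcFamily.isNontrivialCurve {M : Type*} [TopologicalSpace M] [ChartedSpace E3 M]
    [IsManifold (𝓡 3) ∞ M] {a b : ℝ} {Φ : ℝ → ℝ → M} (h : IsEmbeddedArcFamily a b Φ) {s : ℝ}
    (hs : s ∈ Ioo (-1 : ℝ) 1) : IsNontrivialCurve a b (Φ s) := by
  rintro c d hac hcd hdb ⟨m, hm⟩
  have h1 : Φ s c = Φ s d := by
    rw [hm c (left_mem_Icc.mpr hcd.le), hm d (right_mem_Icc.mpr hcd.le)]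
  have h2 : ((s, c) : ℝ × ℝ) = (s, d) :=
    h.2.1 ⟨hs, hac, hcd.le.trans hdb⟩ ⟨hs, hac.trans hcd.le, hdb⟩ h1
  exact hcd.ne (congrArg Prod.snd h2)

variable {M : Type*} [TopologicalSpace M] [ChartedSpace E3 M] [IsManifold (𝓡 3) ∞ M]
  {X : Fin 3 → SmoothVectorField M} {p : M} {W : Fin 3 → E3 → E3} {B : Set E3} {b : ℝ}

/-- A smooth injective family of singular arcs in the chart gives an embedded family of arcs on the
manifold. The time is clamped to `[0, b]`, so that each arc is defined on the whole line. -/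
lemma isEmbeddedArcFamily_extChartAt_symm (hBt : B ⊆ (extChartAt (𝓡 3) p).target) {n : E3}
    {Φ : ℝ × ℝ → E3} {O : Set (ℝ × ℝ)} (hb : 0 < b)
    (hOsub : Ioo (-1) 1 ×ˢ Icc 0 b ⊆ O) (hΦ : ContDiffOn ℝ ∞ Φ O) (hinj : InjOn Φ O)
    (hΦB : MapsTo Φ O B)
    (hγ : ∀ s ∈ Ioo (-1 : ℝ) 1, IsSingularArc W n 0 b fun t => Φ (s, t)) :
    IsEmbeddedArcFamily 0 b
      fun s t => (extChartAt (𝓡 3) p).symm (Φ (s, projIcc 0 b hb.le t)) := by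
  have hproj : ∀ s, ∀ t ∈ Icc 0 b, (extChartAt (𝓡 3) p).symm (Φ (s, projIcc 0 b hb.le t)) =
      (extChartAt (𝓡 3) p).symm (Φ (s, t)) := fun s t ht => by rw [projIcc_of_mem hb.le ht]
  refine ⟨?_, ?_, ?_⟩
  · have h1 : ContMDiffOn 𝓘(ℝ, ℝ × ℝ) (𝓡 3) ∞ (fun q => (extChartAt (𝓡 3) p).symm (Φ q))
        (Ioo (-1) 1 ×ˢ Icc 0 b) :=
      (contMDiffOn_extChartAt_symm p).comp (hΦ.mono hOsub).contMDiffOn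
        fun q hq => hBt (hΦB (hOsub hq))
    exact h1.congr fun q hq => hproj q.1 q.2 hq.2
  · intro q hq q' hq' h
    have h1 : (extChartAt (𝓡 3) p).symm (Φ q) = (extChartAt (𝓡 3) p).symm (Φ q') :=
      (hproj q.1 q.2 hq.2).symm.trans (h.trans (hproj q'.1 q'.2 hq'.2))
    exact hinj (hOsub hq) (hOsub hq') ((extChartAt (𝓡 3) p).symm.injOn (hBt (hΦB (hOsub hq)))
      (hBt (hΦB (hOsub hq'))) h1)
  · intro s hs t ht h0
    have hmem : Φ (s, t) ∈ (extChartAt (𝓡 3) p).target := hBt (hΦB (hOsub ⟨hs, ht⟩))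
    have h1 := hasMFDerivAt_extChartAt_symm_comp ((hγ s hs).hasDerivAt t ht) hmem
    have h2 := h1.hasMFDerivWithinAt (s := Icc 0 b)
    have h3 := h2.congr_of_eventuallyEq (f₁ := fun t =>
      (extChartAt (𝓡 3) p).symm (Φ (s, projIcc 0 b hb.le t)))
      (Filter.eventuallyEq_of_mem self_mem_nhdsWithin fun t' ht' => hproj s t' ht')
      (hproj s t ht)
    have h4 := h3.mfderivWithin ((uniqueDiffOn_Icc hb t ht).uniqueMDiffWithinAt)
    have h5 : (1 : ℝ) • mfderiv 𝓘(ℝ, E3) (𝓡 3) (extChartAt (𝓡 3) p).symm (Φ (s, t))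
        (singularVelocity W (Φ (s, t))) = 0 :=
      congrArg (fun L : ℝ →L[ℝ] E3 => L 1) (h4.symm.trans h0)
    rw [one_smul] at h5
    exact (hγ s hs).velocity_ne_zero t ht ((bijective_mfderiv_extChartAt_symm hmem).1
      (h5.trans (map_zero _).symm))

end ArcFamilies

/-! ### Nondegenerate points of the dependence locus -/

section NondegeneratePoints

/-- The first-order conditions on three vector fields, with values `w` and derivatives `A` at a
point, which make the singular arcs near that point a smooth family: independence of the first two
values (witnessed by `n`), singular feedback control in `Ω`, non-vanishing singular velocity and
non-vanishing gradient of the determinant. -/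
def IsNondegenerateJet (Ω : Set E3) (n : E3) (w : Fin 3 → E3) (A : Fin 3 → E3 →L[ℝ] E3) : Prop :=
  tripleProduct (w 0) (w 1) n ≠ 0 ∧ jetControl w A ∈ Ω ∧ jetVelocity w A ≠ 0 ∧
    jetDetGradient w A ≠ 0

lemma contDiff_smul_of_tsupport_subset {χ : E3 → ℝ} (hχ : ContDiff ℝ ∞ χ) {T : Set E3}
    (hT : IsOpen T) (hχT : tsupport χ ⊆ T) {V : E3 → E3} (hV : ContDiffOn ℝ ∞ V T) :
    ContDiff ℝ ∞ fun y => χ y • V y := by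
  rw [contDiff_iff_contDiffAt]
  intro y
  by_cases hy : y ∈ tsupport χ
  · exact hχ.contDiffAt.smul (hV.contDiffAt (hT.mem_nhds (hχT hy)))
  · refine (contDiffAt_const (c := (0 : E3))).congr_of_eventuallyEq ?_
    filter_upwards [(isClosed_tsupport χ).isOpen_compl.mem_nhds hy] with z hz
    rw [image_eq_zero_of_notMem_tsupport hz, zero_smul]

variable {M : Type*} [TopologicalSpace M] [ChartedSpace E3 M] [IsManifold (𝓡 3) ∞ M] [T2Space M]

/-- At a nondegenerate point of the dependence locus there is an embedded family of singular
trajectories with unique singular controls. The coordinate expressions are multiplied by a bump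
function to obtain compactly supported fields on `ℝ³`. -/
theorem exists_embeddedArcFamily_of_isNondegenerateJet {X : Fin 3 → SmoothVectorField M} {p : M}
    {Ω : Set E3} (hΩ : IsOpen Ω) {n x₀ : E3} (hx₀ : x₀ ∈ (extChartAt (𝓡 3) p).target)
    (hdet : tripleProduct ((X 0).inChart p x₀) ((X 1).inChart p x₀) ((X 2).inChart p x₀) = 0)
    (hjet : IsNondegenerateJet Ω n (fun i => (X i).inChart p x₀)
      fun i => fderiv ℝ ((X i).inChart p) x₀) :
    ∃ (a b : ℝ) (Φ : ℝ → ℝ → M), a < b ∧ IsEmbeddedArcFamily a b Φ ∧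
      ∀ s ∈ Ioo (-1 : ℝ) 1, IsNontrivialCurve a b (Φ s) ∧
        (∀ t ∈ Icc a b, Φ s t ∈ dependenceLocus X) ∧
        ∃! u : LInftyControl a b, IsSingularLift Ω X a b (Φ s) u := by
  have hT : IsOpen (extChartAt (𝓡 3) p).target := isOpen_extChartAt_target p
  obtain ⟨R, hR, hRT⟩ := Metric.isOpen_iff.mp hT x₀ hx₀
  let χ : ContDiffBump x₀ := ⟨R / 4, R / 2, by positivity, by linarith⟩
  have hχT : tsupport χ ⊆ (extChartAt (𝓡 3) p).target := by
    rw [χ.tsupport_eq]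
    exact (Metric.closedBall_subset_ball (by show R / 2 < R; linarith)).trans hRT
  let W : Fin 3 → E3 → E3 := fun i y => χ y • (X i).inChart p y
  have hW : ∀ i, ContDiff ℝ ∞ (W i) := fun i =>
    contDiff_smul_of_tsupport_subset χ.contDiff hT hχT (contDiffOn_inChart (X i) p)
  have hc : ∀ i, HasCompactSupport (W i) := fun i => χ.hasCompactSupport.smul_right
  let B : Set E3 := Metric.ball x₀ (R / 4)
  have hB : IsOpen B := Metric.isOpen_ball
  have hxB : x₀ ∈ B := Metric.mem_ball_self (by positivity)
  have hBt : B ⊆ (extChartAt (𝓡 3) p).target :=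
    (Metric.ball_subset_ball (by linarith)).trans hRT
  have hWX : ∀ i, EqOn (W i) ((X i).inChart p) B := fun i y hy => by
    show χ y • _ = _
    rw [χ.one_of_mem_closedBall (Metric.ball_subset_closedBall hy), one_smul]
  have hw : (fun i => W i x₀) = fun i => (X i).inChart p x₀ := funext fun i => hWX i hxB
  have hA : (fun i => fderiv ℝ (W i) x₀) = fun i => fderiv ℝ ((X i).inChart p) x₀ := funext fun i =>
    ((hWX i).eventuallyEq_of_mem (hB.mem_nhds hxB)).fderiv_eq
  rw [← hw, ← hA] at hjet
  obtain ⟨hn, hu, hv, hg⟩ := hjet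
  have hd : tripleProduct (W 0 x₀) (W 1 x₀) (W 2 x₀) = 0 := by
    rw [hWX 0 hxB, hWX 1 hxB, hWX 2 hxB, hdet]
  have hS : B ∩ singularControl W ⁻¹' Ω ∈ 𝓝 x₀ := Filter.inter_mem (hB.mem_nhds hxB)
    ((contDiff_singularControl hW).continuous.continuousAt.preimage_mem_nhds (hΩ.mem_nhds hu))
  obtain ⟨b, Φ, O, hb, -, hOsub, hΦ, hinj, hmaps, hγ⟩ :=
    exists_singularArc_family hW hc hn hd hv hg hS
  have hemb := isEmbeddedArcFamily_extChartAt_symm (p := p) hBt hb hOsub hΦ hinj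
    (fun q hq => (hmaps hq).1) hγ
  refine ⟨0, b, _, hb, hemb, fun s hs => ⟨hemb.isNontrivialCurve hs, fun t ht => ?_, ?_⟩⟩
  · have hmem : (s, ((projIcc 0 b hb.le t : Icc 0 b) : ℝ)) ∈ O := hOsub ⟨hs, (projIcc 0 b hb.le t).2⟩
    exact mem_dependenceLocus_of_tripleProduct_eq_zero hBt hWX (hmaps hmem).1
      ((hγ s hs).det_ne_zero _ (projIcc 0 b hb.le t).2)
      ((hγ s hs).det_eq_zero _ (projIcc 0 b hb.le t).2)
  · have hmem : ∀ t ∈ Icc 0 b, Φ (s, t) ∈ B ∩ singularControl W ⁻¹' Ω := fun t ht =>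
      hmaps (hOsub ⟨hs, ht⟩)
    let y : C(Icc 0 b, E3) := ⟨fun t => Φ (s, t), (hγ s hs).continuousOn.domRestrict⟩
    exact (hγ s hs).existsUnique_isSingularLift hB hBt hW hc hWX hb (fun t ht => (hmem t ht).1)
      (fun t ht => (hmem t ht).2) (y := y) fun t => rfl

end NondegeneratePoints

/-! ### Persistence of nondegenerate points -/

section Perturbation

/-- The values and the derivatives at `y` of three vector fields. -/
def fieldJet (V : Fin 3 → E3 → E3) (y : E3) : (Fin 3 → E3) × (Fin 3 → E3 →L[ℝ] E3) :=
  (fun i => V i y, fun i => fderiv ℝ (V i) y)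

lemma continuousOn_fieldJet {V : Fin 3 → E3 → E3} {T : Set E3} (hT : IsOpen T)
    (hV : ∀ i, ContDiffOn ℝ ∞ (V i) T) : ContinuousOn (fieldJet V) T :=
  (continuousOn_pi.mpr fun i => (hV i).continuousOn).prodMk
    (continuousOn_pi.mpr fun i => (hV i).continuousOn_fderiv_of_isOpen hT (by simp))

lemma continuous_jetPairing (i j : Fin 3) :
    Continuous fun q : (Fin 3 → E3) × (Fin 3 → E3 →L[ℝ] E3) => jetPairing q.1 q.2 i j := by
  unfold jetPairing jetBracket
  refine Continuous.tripleProduct (by fun_prop) (by fun_prop) (by fun_prop)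

lemma continuous_jetDetDeriv (v : E3) :
    Continuous fun q : (Fin 3 → E3) × (Fin 3 → E3 →L[ℝ] E3) => jetDetDeriv q.1 q.2 v := by
  unfold jetDetDeriv
  refine ((Continuous.tripleProduct ?_ ?_ ?_).add (Continuous.tripleProduct ?_ ?_ ?_)).add
    (Continuous.tripleProduct ?_ ?_ ?_) <;> fun_prop

lemma continuous_jetControl :
    Continuous fun q : (Fin 3 → E3) × (Fin 3 → E3 →L[ℝ] E3) => jetControl q.1 q.2 := by
  unfold jetControl
  refine (PiLp.continuous_toLp 2 _).comp (continuous_pi fun i => ?_)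
  fin_cases i
  exacts [continuous_jetPairing 1 2, continuous_jetPairing 2 0, continuous_jetPairing 0 1]

lemma continuous_jetDetGradient :
    Continuous fun q : (Fin 3 → E3) × (Fin 3 → E3 →L[ℝ] E3) => jetDetGradient q.1 q.2 := by
  unfold jetDetGradient
  refine (PiLp.continuous_toLp 2 _).comp (continuous_pi fun i => ?_)
  fin_cases i
  exacts [continuous_jetDetDeriv _, continuous_jetDetDeriv _, continuous_jetDetDeriv _]

lemma isOpen_isNondegenerateJet {Ω : Set E3} (hΩ : IsOpen Ω) (n : E3) :
    IsOpen {q : (Fin 3 → E3) × (Fin 3 → E3 →L[ℝ] E3) | IsNondegenerateJet Ω n q.1 q.2} := by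
  have h1 : Continuous fun q : (Fin 3 → E3) × (Fin 3 → E3 →L[ℝ] E3) =>
      tripleProduct (q.1 0) (q.1 1) n :=
    Continuous.tripleProduct (by fun_prop) (by fun_prop) (by fun_prop)
  have h2 : Continuous fun q : (Fin 3 → E3) × (Fin 3 → E3 →L[ℝ] E3) => jetVelocity q.1 q.2 := by
    unfold jetVelocity
    refine continuous_finsetSum _ fun i _ => ?_
    have h : Continuous fun u : E3 => u i := by fun_prop
    exact (h.comp continuous_jetControl).smul (by fun_prop)
  have h3 := (isOpen_ne (x := (0 : ℝ))).preimage h1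
  have h4 := hΩ.preimage continuous_jetControl
  have h5 := (isOpen_ne (x := (0 : E3))).preimage h2
  have h6 := (isOpen_ne (x := (0 : E3))).preimage continuous_jetDetGradient
  exact h3.inter (h4.inter (h5.inter h6))

variable {M : Type*} [TopologicalSpace M] [ChartedSpace E3 M] [IsManifold (𝓡 3) ∞ M]

/-- In the `C^∞` topology, the 1-jets of the coordinate expressions depend continuously on the
vector fields, uniformly on compact sets. -/
lemma eventually_dist_fieldJet_lt (X₀ : Fin 3 → SmoothVectorField M) (p : M) {K : Set E3}
    (hK : IsCompact K) (hKt : K ⊆ (extChartAt (𝓡 3) p).target) {ε : ℝ} (hε : 0 < ε) :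
    ∀ᶠ X in 𝓝 X₀, ∀ y ∈ K, dist (fieldJet (fun i => (X i).inChart p) y)
      (fieldJet (fun i => (X₀ i).inChart p) y) < ε := by
  have h : ∀ i, ∀ k : ℕ, ∀ᶠ X in 𝓝 X₀, ∀ y ∈ K, ‖iteratedFDeriv ℝ k ((X i).inChart p) y -
      iteratedFDeriv ℝ k ((X₀ i).inChart p) y‖ < ε := fun i k =>
    (continuous_apply i).continuousAt.eventually
      (eventually_iteratedFDeriv_inChart_sub_lt (X₀ i) p k hK hKt hε)
  filter_upwards [Filter.eventually_all.mpr fun i => h i 0,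
    Filter.eventually_all.mpr fun i => h i 1] with X h0 h1 y hy
  refine max_lt ((dist_pi_lt_iff hε).mpr fun i => ?_) ((dist_pi_lt_iff hε).mpr fun i => ?_)
  · have h2 := h0 i y hy
    rw [iteratedFDeriv_zero_eq_comp, iteratedFDeriv_zero_eq_comp, Function.comp_apply,
      Function.comp_apply, ← map_sub, LinearIsometryEquiv.norm_map] at h2
    rwa [dist_eq_norm]
  · refine lt_of_le_of_lt ?_ (h1 i y hy)
    rw [dist_eq_norm]
    refine ContinuousLinearMap.opNorm_le_bound _ (norm_nonneg _) fun v => ?_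
    have h3 := (iteratedFDeriv ℝ 1 ((X i).inChart p) y -
      iteratedFDeriv ℝ 1 ((X₀ i).inChart p) y).le_opNorm fun _ => v
    rw [sub_apply, iteratedFDeriv_one_apply, iteratedFDeriv_one_apply, Fin.prod_univ_one] at h3
    exact h3

/-- Nondegenerate points of the dependence locus persist under perturbation when the determinant
changes sign transversally along a line. -/
lemma eventually_exists_isNondegenerateJet {Ω : Set E3} (hΩ : IsOpen Ω)
    (X₀ : Fin 3 → SmoothVectorField M) (p : M) {n e : E3}
    (hjet : IsNondegenerateJet Ω n (fun i => (X₀ i).inChart p (extChartAt (𝓡 3) p p))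
      fun i => fderiv ℝ ((X₀ i).inChart p) (extChartAt (𝓡 3) p p))
    (hsign : ∀ᶠ r in 𝓝 (0 : ℝ), tripleProduct
      ((X₀ 0).inChart p (extChartAt (𝓡 3) p p + r • e))
      ((X₀ 1).inChart p (extChartAt (𝓡 3) p p + r • e))
      ((X₀ 2).inChart p (extChartAt (𝓡 3) p p + r • e)) = r) :
    ∀ᶠ X in 𝓝 X₀, ∃ x₀ ∈ (extChartAt (𝓡 3) p).target,
      tripleProduct ((X 0).inChart p x₀) ((X 1).inChart p x₀) ((X 2).inChart p x₀) = 0 ∧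
      IsNondegenerateJet Ω n (fun i => (X i).inChart p x₀)
        fun i => fderiv ℝ ((X i).inChart p) x₀ := by
  set y₀ := extChartAt (𝓡 3) p p with hy₀
  have hT : IsOpen (extChartAt (𝓡 3) p).target := isOpen_extChartAt_target p
  have hy₀T : y₀ ∈ (extChartAt (𝓡 3) p).target := mem_extChartAt_target p
  set J : E3 → (Fin 3 → E3) × (Fin 3 → E3 →L[ℝ] E3) := fieldJet fun i => (X₀ i).inChart p with hJ
  have hJc : ContinuousAt J y₀ :=
    (continuousOn_fieldJet hT fun i => contDiffOn_inChart (X₀ i) p).continuousAt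
      (hT.mem_nhds hy₀T)
  obtain ⟨δ, hδ, hball⟩ := Metric.isOpen_iff.mp (isOpen_isNondegenerateJet hΩ n) (J y₀) hjet
  -- the segment `[y₀ - r e, y₀ + r e]` lies in the chart, and on it the jets of `X₀` are close to
  -- the jet at `y₀`
  have hline : Continuous fun r : ℝ => y₀ + r • e := by fun_prop
  have hl0 : y₀ + (0 : ℝ) • e = y₀ := by rw [zero_smul, add_zero]
  have h1 : ∀ᶠ r in 𝓝 (0 : ℝ), y₀ + r • e ∈ (extChartAt (𝓡 3) p).target := by
    have := hline.tendsto 0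
    rw [hl0] at this
    exact this.eventually (hT.mem_nhds hy₀T)
  have h2 : ∀ᶠ r in 𝓝 (0 : ℝ), dist (J (y₀ + r • e)) (J y₀) < δ / 2 := by
    have := hline.tendsto 0
    rw [hl0] at this
    exact (hJc.tendsto.comp this).eventually (Metric.ball_mem_nhds _ (half_pos hδ))
  obtain ⟨ρ, hρ, hρ'⟩ := Metric.eventually_nhds_iff_ball.mp (h1.and (h2.and hsign))
  set r := ρ / 2 with hr
  have hr0 : 0 < r := half_pos hρ
  have hseg : ∀ s ∈ Icc (-r) r, s ∈ Metric.ball (0 : ℝ) ρ := fun s hs => by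
    rw [mem_ball_zero_iff, Real.norm_eq_abs]
    exact (abs_le.mpr hs).trans_lt (by rw [hr]; linarith)
  let K : Set E3 := (fun s : ℝ => y₀ + s • e) '' Icc (-r) r
  have hK : IsCompact K := isCompact_Icc.image hline
  have hKt : K ⊆ (extChartAt (𝓡 3) p).target := by
    rintro _ ⟨s, hs, rfl⟩
    exact (hρ' s (hseg s hs)).1
  -- the sign of the determinant at the two ends of the segment is an open condition on the jet
  have hdetc : Continuous fun q : (Fin 3 → E3) × (Fin 3 → E3 →L[ℝ] E3) =>
      tripleProduct (q.1 0) (q.1 1) (q.1 2) :=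
    Continuous.tripleProduct (by fun_prop) (by fun_prop) (by fun_prop)
  have hrI : r ∈ Icc (-r) r := ⟨by linarith, le_rfl⟩
  have hrI' : -r ∈ Icc (-r) r := ⟨le_rfl, by linarith⟩
  have hpos : 0 < tripleProduct ((J (y₀ + r • e)).1 0) ((J (y₀ + r • e)).1 1)
      ((J (y₀ + r • e)).1 2) := by
    exact hr0.trans_eq (hρ' r (hseg r hrI)).2.2.symm
  have hneg : tripleProduct ((J (y₀ + (-r) • e)).1 0) ((J (y₀ + (-r) • e)).1 1)
      ((J (y₀ + (-r) • e)).1 2) < 0 := by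
    exact (hρ' (-r) (hseg _ hrI')).2.2.trans_lt (neg_neg_of_pos hr0)
  obtain ⟨δ₁, hδ₁, hb₁⟩ := Metric.isOpen_iff.mp (isOpen_lt continuous_const hdetc) _ hpos
  obtain ⟨δ₂, hδ₂, hb₂⟩ := Metric.isOpen_iff.mp (isOpen_lt hdetc continuous_const) _ hneg
  filter_upwards [eventually_dist_fieldJet_lt X₀ p hK hKt (half_pos hδ),
    eventually_dist_fieldJet_lt X₀ p hK hKt hδ₁, eventually_dist_fieldJet_lt X₀ p hK hKt hδ₂]
    with X hX hX₁ hX₂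
  have hp := hb₁ (hX₁ _ (mem_image_of_mem _ hrI))
  have hm := hb₂ (hX₂ _ (mem_image_of_mem _ hrI'))
  have hcont : ContinuousOn (fun s : ℝ => tripleProduct ((X 0).inChart p (y₀ + s • e))
      ((X 1).inChart p (y₀ + s • e)) ((X 2).inChart p (y₀ + s • e))) (Icc (-r) r) :=
    hdetc.comp_continuousOn ((continuousOn_fieldJet hT fun i => contDiffOn_inChart (X i) p).comp
      hline.continuousOn fun s hs => (hρ' s (hseg s hs)).1)
  obtain ⟨s, hs, hs0⟩ := intermediate_value_Icc (by linarith) hcont ⟨hm.le, hp.le⟩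
  have hsK : y₀ + s • e ∈ K := mem_image_of_mem _ hs
  refine ⟨y₀ + s • e, hKt hsK, hs0,
    @hball (fieldJet (fun i => (X i).inChart p) (y₀ + s • e)) ?_⟩
  have h3 := dist_triangle (fieldJet (fun i => (X i).inChart p) (y₀ + s • e)) (J (y₀ + s • e)) (J y₀)
  have h4 := hX _ hsK
  have h5 := (hρ' s (hseg s hs)).2.1
  rw [Metric.mem_ball]
  linarith

end Perturbation

/-! ### The model triple -/

section Model

/-! The model vector fields are `∂₀`, `∂₁ + u₂ x ∂₂` and `(-u₁ x + u₀ y) ∂₂`, where `x` and `y` are the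
first two coordinates relative to the base point and `u` is the singular control to be realized
there. Their determinant is `-u₁ x + u₀ y`. -/

/-- The values of the model vector fields at the base point. -/
def modelValue : Fin 3 → E3 := ![!₂[1, 0, 0], !₂[0, 1, 0], 0]

/-- The derivatives of the model vector fields. -/
def modelDeriv (u : E3) : Fin 3 → E3 →L[ℝ] E3 :=
  ![0, (u 2 • EuclideanSpace.proj (𝕜 := ℝ) (0 : Fin 3) : E3 →L[ℝ] ℝ).smulRight !₂[0, 0, 1],
    (-u 1 • EuclideanSpace.proj (𝕜 := ℝ) (0 : Fin 3) +
      u 0 • EuclideanSpace.proj (𝕜 := ℝ) (1 : Fin 3) : E3 →L[ℝ] ℝ).smulRight !₂[0, 0, 1]]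

/-- The model has singular feedback control `u` at the base point. -/
lemma jetControl_model (u : E3) : jetControl modelValue (modelDeriv u) = u := by
  ext i
  fin_cases i <;>
    simp [jetControl, jetPairing, jetBracket, tripleProduct, modelValue, modelDeriv]

lemma isNondegenerateJet_model {Ω : Set E3} {u : E3} (hu : u ∈ Ω) (hu0 : u 0 ≠ 0) :
    IsNondegenerateJet Ω !₂[0, 0, 1] modelValue (modelDeriv u) := by
  refine ⟨?_, ?_, fun h => hu0 ?_, fun h => hu0 ?_⟩
  · simp [tripleProduct, modelValue]
  · rwa [jetControl_model]
  · rw [jetVelocity, jetControl_model] at h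
    have := congrArg (fun v : E3 => v 0) h
    simpa [Fin.sum_univ_three, modelValue] using this
  · have := congrArg (fun v : E3 => v 1) h
    simpa [jetDetGradient, jetDetDeriv, tripleProduct, modelValue, modelDeriv] using this

/-- The determinant of the model fields, restricted to a line transverse to its zero locus and
parametrized so that it equals the parameter. -/
lemma tripleProduct_model {u : E3} (hu0 : u 0 ≠ 0) (r : ℝ) :
    tripleProduct (modelValue 0 + modelDeriv u 0 (r • !₂[0, (u 0)⁻¹, 0]))
      (modelValue 1 + modelDeriv u 1 (r • !₂[0, (u 0)⁻¹, 0]))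
      (modelValue 2 + modelDeriv u 2 (r • !₂[0, (u 0)⁻¹, 0])) = r := by
  simp [tripleProduct, modelValue, modelDeriv]
  field_simp

lemma exists_mem_apply_zero_ne_zero {Ω : Set E3} (hΩ : IsOpen Ω) (hne : Ω.Nonempty) :
    ∃ u ∈ Ω, u 0 ≠ 0 := by
  obtain ⟨u, hu⟩ := hne
  by_cases h0 : u 0 = 0
  · have hc : Continuous fun r : ℝ => u + r • (!₂[1, 0, 0] : E3) := by fun_prop
    have h1 := hc.tendsto 0
    rw [zero_smul, add_zero] at h1
    have h2 : ∀ᶠ r in 𝓝[≠] (0 : ℝ), u + r • (!₂[1, 0, 0] : E3) ∈ Ω :=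
      (h1.eventually (hΩ.mem_nhds hu)).filter_mono nhdsWithin_le_nhds
    obtain ⟨r, hr, hr0⟩ := (h2.and self_mem_nhdsWithin).exists
    refine ⟨_, hr, ?_⟩
    simpa [h0] using hr0
  · exact ⟨u, hu, h0⟩

variable {M : Type*} [TopologicalSpace M] [ChartedSpace E3 M] [IsManifold (𝓡 3) ∞ M] [T2Space M]

/-- The model vector fields, cut off in a chart, form a triple all of whose perturbations have
nondegenerate points in their dependence locus. -/
lemma exists_eventually_isNondegenerateJet {Ω : Set E3} (hΩ : IsOpen Ω) (hne : Ω.Nonempty)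
    (p : M) :
    ∃ (X₀ : Fin 3 → SmoothVectorField M) (n : E3), ∀ᶠ X in 𝓝 X₀,
      ∃ x₀ ∈ (extChartAt (𝓡 3) p).target,
        tripleProduct ((X 0).inChart p x₀) ((X 1).inChart p x₀) ((X 2).inChart p x₀) = 0 ∧
        IsNondegenerateJet Ω n (fun i => (X i).inChart p x₀)
          fun i => fderiv ℝ ((X i).inChart p) x₀ := by
  obtain ⟨u, hu, hu0⟩ := exists_mem_apply_zero_ne_zero hΩ hne
  set y₀ := extChartAt (𝓡 3) p p with hy₀
  let V : Fin 3 → E3 → E3 := fun i y => modelValue i + modelDeriv u i (y - y₀)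
  have hV : ∀ i, ContDiff ℝ ∞ (V i) := fun i =>
    contDiff_const.add ((modelDeriv u i).contDiff.comp (contDiff_id.sub contDiff_const))
  choose X₀ hX₀ using fun i => exists_smoothVectorField_inChart_eventuallyEq p (hV i)
  rw [← hy₀] at hX₀
  have hval : (fun i => (X₀ i).inChart p y₀) = modelValue := funext fun i => by
    rw [(hX₀ i).eq_of_nhds]
    show modelValue i + modelDeriv u i (y₀ - y₀) = _
    rw [sub_self, map_zero, add_zero]
  have hder : (fun i => fderiv ℝ ((X₀ i).inChart p) y₀) = modelDeriv u := funext fun i => by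
    rw [(hX₀ i).fderiv_eq]
    have h1 : HasFDerivAt (V i) ((modelDeriv u i).comp (ContinuousLinearMap.id ℝ E3)) y₀ :=
      ((modelDeriv u i).hasFDerivAt.comp y₀ ((hasFDerivAt_id y₀).sub_const y₀)).const_add _
    rw [h1.fderiv, ContinuousLinearMap.comp_id]
  refine ⟨X₀, !₂[0, 0, 1], eventually_exists_isNondegenerateJet hΩ X₀ p
    (e := !₂[0, (u 0)⁻¹, 0]) ?_ ?_⟩
  · rw [← hy₀, hval, hder]
    exact isNondegenerateJet_model hu hu0
  · have hline : Continuous fun r : ℝ => y₀ + r • (!₂[0, (u 0)⁻¹, 0] : E3) := by fun_prop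
    have h1 := hline.tendsto 0
    rw [zero_smul, add_zero] at h1
    filter_upwards [h1.eventually (hX₀ 0), h1.eventually (hX₀ 1), h1.eventually (hX₀ 2)]
      with r h2 h3 h4
    rw [← hy₀, h2, h3, h4]
    simp only [V, add_sub_cancel_left]
    exact tripleProduct_model hu0 r

end Model

end

theorem mainTheorem1 {M : Type*} [TopologicalSpace M] [T2Space M] [SecondCountableTopology M]
    [Nonempty M] [ChartedSpace E3 M] [IsManifold (𝓡 3) ∞ M]
    (Ω : Set E3) (hΩ : IsOpen Ω) (hΩne : Ω.Nonempty) :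
    ∃ U : Set (Fin 3 → SmoothVectorField M), IsOpen U ∧ U.Nonempty ∧
      ∀ X ∈ U, ∃ (a b : ℝ) (Φ : ℝ → ℝ → M), a < b ∧ IsEmbeddedArcFamily a b Φ ∧
        ∀ s ∈ Ioo (-1 : ℝ) 1,
          IsNontrivialCurve a b (Φ s) ∧
          (∀ t ∈ Icc a b, Φ s t ∈ dependenceLocus X) ∧
          ∃! u : LInftyControl a b, IsSingularLift Ω X a b (Φ s) u := by
  obtain ⟨X₀, n, hX₀⟩ := exists_eventually_isNondegenerateJet hΩ hΩne (Classical.arbitrary M)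
  obtain ⟨U, hU, hUo, hX₀U⟩ := eventually_nhds_iff.mp hX₀
  refine ⟨U, hUo, ⟨X₀, hX₀U⟩, fun X hX => ?_⟩
  obtain ⟨x₀, hx₀, hdet, hjet⟩ := hU X hX
  exact exists_embeddedArcFamily_of_isNondegenerateJet hΩ hx₀ hdet hjet
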